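/- **Setting.** Fix a weight $\omega:[0,\infty)\to[1,\infty)$, differentiable, with $1/\omega\in L^1$, $\omega'/\omega\in L^\infty$ and $\ln\omega(y)/(1+y)\in L^\infty$, and let $\|f\|_{L^2(\omega)}^2=\int_0^\infty|f|^2\omega$. A *shear flow* is a function $U_s\in C^\infty([0,\infty),[0,1))$ with $U_s(0)=0$, $U_s(+\infty)=1$, $U_s'>0$ on $[0,\infty)$, $U_s''(0)\neq0$, $U_s''$ having finitely many zeros in $[0,\infty)$, $\Delta_s:=\int_0^\infty(1-U_s)\,dy<\infty$, $U_s^{(j)}\in L^\infty$ and $(1+y)U_s^{(j)}\in L^2(\omega)$ for $1\le j\le3$, $1-U_s\in L^2(\omega)$, $(1-U_s)^2/U_s'\to0$ and $y(1-U_s)\to0$ as $y\to\infty$, $\frac{(1-U_s)^2}{(U_s')^2}U_s''\in L^1(0,\infty)$, and such that for some $0<\kappa<\frac12$ and $y_\kappa,c_\kappa>0$ one has $(1-U_s)^{2-\kappa}U_s''\le-c_\kappa(U_s')^3$ for all $y\ge y_\kappa$. For unknowns $U(t,x,y),V(t,x,y),u_e(t,x)$, $2\pi$-periodic and mean-free in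 $x$, consider for $y>0$ $$\partial_tU+U_s\partial_xU+VU_s'-\partial_y^2U=\partial_tu_e+\partial_xu_e,\qquad \partial_xU+\partial_yV=0,$$ $$U|_{y=0}=V|_{y=0}=0,\qquad \lim_{y\to+\infty}U=u_e .$$ The (linearized) *PDT system* consists of these equations together with $\int_0^\infty(u_e-U)\,dy=\Delta_su_e$. The (linearized) *IBL system* with parameter $\nu>0$ consists of these equations together with $u_e=\sqrt\nu\,\mathcal{DN}\int_0^\infty(u_e-U)\,dy$, where $\widehat{\mathcal{DN}f}(n)=|n|\hat f(n)$, $n\in\mathbb Z$. For an integer $k\ge1$ and $\lambda\in\mathbb C$ with $\operatorname{Re}\lambda>0$, a system *displays a $(\lambda,k)$ instability* if there are $\mathcal U,\mathcal V\in C^\infty([0,\infty),\mathbb C)$ such that $(U,V,u_e)=e^{\lambda t}e^{ikx}(\mathcal U(y),\mathcal V(y),1)$ is a smooth solution of it. Let $$\Gamma_1=\Big\{a+ib:\ 0<a<1,\ 0<b<\sqrt{\tfrac{3a(1-a)^2}{4-3a}}\Big\},$$ $$\Gamma_2=\Big\{a+ib:\ 0<a<\tfrac23,\ 0<b<\sqrt{\tfrac{a(2-3a)}3}\Big\},\qquad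 \Gamma_3=\Big\{a+ib:\ 0<a<1,\ 0<b<\sqrt{a(1-a)}\Big\}.$$ **Theorem.** 1. (PDT) For every $\mu\in\Gamma_1$ there exist a shear flow $U_s$, $K>0$ and a sequence $(\lambda_k)$ with $\lambda_k\sim-ik\mu$ as $k\to\infty$ such that, for every integer $k\ge K$, the PDT system displays a $(\lambda_k,k)$ instability. 2. (IBL) For every $\mu\in\Gamma_2$ and every $\varepsilon>0$ there exist a shear flow $U_s$, $K>0$ and $\gamma_+>0$ such that, for every integer $k\ge K$ and every $\nu>0$ with $(\sqrt\nu k)^{-1}\le\gamma_+$, there is $\lambda=\lambda_{k,\nu}$ with $|\lambda/k+i\mu|\le\varepsilon$ such that the IBL system displays a $(\lambda,k)$ instability. 3. (IBL) For every $\mu\in\Gamma_3$, every $\gamma>0$ and every $\varepsilon>0$ there exist a shear flow $U_s$, $K>0$ and $0<\gamma_-<\gamma<\gamma_+$ such that, for every integer $k\ge K$ and every $\nu>0$ with $\gamma_-\le(\sqrt\nu k)^{-1}\le\gamma_+$, there is $\lambda=\lambda_{k,\nu}$ with $|\lambda/k+i\mu|\le\varepsilon$ such that the IBL system displays a $(\lambda,k)$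 instability. -/

import Mathlib

open Set Filter Topology MeasureTheory
open scoped ContDiff

noncomputable section

namespace BoundaryLayer

/-! ### Shear flows -/

/-- An admissible weight on `[0, ∞)`: `w ≥ 1`, `1/w ∈ L¹`, `w'/w ∈ L^∞`, and
`(ln w)/(1+y) ∈ L^∞`. -/
structure IsWeight (w : ℝ → ℝ) : Prop where
  one_le : ∀ y, 0 ≤ y → 1 ≤ w y
  differentiableOn : DifferentiableOn ℝ w (Ici 0)
  inv_integrable : IntegrableOn (fun y => 1 / w y) (Ioi 0)
  logDeriv_bounded : ∃ C : ℝ, ∀ y, 0 ≤ y → |derivWithin w (Ici 0) y / w y| ≤ C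
  log_bounded : ∃ C : ℝ, ∀ y, 0 ≤ y → |Real.log (w y) / (1 + y)| ≤ C

/-- `f ∈ L²(w)` on `(0, ∞)`, for real functions. -/
def MemWeightedL2 (w f : ℝ → ℝ) : Prop :=
  AEStronglyMeasurable f (volume.restrict (Ioi 0)) ∧
    IntegrableOn (fun y => f y ^ 2 * w y) (Ioi 0)

/-- The `j`-th derivative on the closed half-line `[0, ∞)` (one-sided at `0`). -/
def halfDeriv (j : ℕ) (U : ℝ → ℝ) : ℝ → ℝ := iteratedDerivWithin j U (Ici 0)

/-- Monotone shear flows with decaying derivatives, relative to the weight `w`.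
Only the values of `U` on `[0, ∞)` matter. -/
structure IsShearFlow (w U : ℝ → ℝ) : Prop where
  smooth : ContDiffOn ℝ ∞ U (Ici 0)
  mapsTo : MapsTo U (Ici 0) (Ico 0 1)
  at_zero : U 0 = 0
  at_top : Tendsto U atTop (𝓝 1)
  deriv_pos : ∀ y, 0 ≤ y → 0 < halfDeriv 1 U y
  deriv2_zero_ne : halfDeriv 2 U 0 ≠ 0
  deriv2_finite_zeros : {y : ℝ | 0 ≤ y ∧ halfDeriv 2 U y = 0}.Finite
  displacement_finite : IntegrableOn (fun y => 1 - U y) (Ioi 0)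
  deriv_bounded : ∀ j, 1 ≤ j → j ≤ 3 → ∃ C : ℝ, ∀ y, 0 ≤ y → |halfDeriv j U y| ≤ C
  defect_memL2 : MemWeightedL2 w (fun y => 1 - U y)
  deriv_memL2 : ∀ j, 1 ≤ j → j ≤ 3 → MemWeightedL2 w (fun y => (1 + y) * halfDeriv j U y)
  ratio1 : Tendsto (fun y => (1 - U y) ^ 2 / halfDeriv 1 U y) atTop (𝓝 0)
  ratio2 : Tendsto (fun y => (1 - U y) * y) atTop (𝓝 0)
  ratio3 : IntegrableOn
    (fun y => (1 - U y) ^ 2 / halfDeriv 1 U y ^ 2 * halfDeriv 2 U y) (Ioi 0)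
  kappa : ∃ κ yκ cκ : ℝ, 0 < κ ∧ κ < 1 / 2 ∧ 0 < yκ ∧ 0 < cκ ∧ ∀ y, yκ ≤ y →
    (1 - U y) ^ (2 - κ) * halfDeriv 2 U y ≤ -cκ * halfDeriv 1 U y ^ 3

/-- Displacement thickness `Δ_s` of a shear flow. -/
def displacement (Us : ℝ → ℝ) : ℝ := ∫ y in Ioi (0 : ℝ), (1 - Us y)

/-! ### The linearized systems

Unknowns: `U V : t → x → y → ℂ` and `ue : t → x → ℂ`, for `t ≥ 0`, `x ∈ ℝ` (with period `2π`),
`y ≥ 0`. -/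

/-- The equations common to both linearized systems: `U`, `V`, `ue` are smooth up to the boundary,
`2π`-periodic and mean-free in `x`, and satisfy the linearized Prandtl equations with
`U = V = 0` at `y = 0`, `U → ue` as `y → ∞`. -/
structure SolvesLinearizedBL (Us : ℝ → ℝ) (U V : ℝ → ℝ → ℝ → ℂ) (ue : ℝ → ℝ → ℂ) : Prop where
  smooth_U : ContDiffOn ℝ ∞ (fun p : ℝ × ℝ × ℝ => U p.1 p.2.1 p.2.2)
    {p | 0 ≤ p.1 ∧ 0 ≤ p.2.2}
  smooth_V : ContDiffOn ℝ ∞ (fun p : ℝ × ℝ × ℝ => V p.1 p.2.1 p.2.2)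
    {p | 0 ≤ p.1 ∧ 0 ≤ p.2.2}
  smooth_ue : ContDiffOn ℝ ∞ (fun p : ℝ × ℝ => ue p.1 p.2) {p | 0 ≤ p.1}
  periodic_U : ∀ t x y, 0 ≤ t → 0 ≤ y → U t (x + 2 * Real.pi) y = U t x y
  periodic_V : ∀ t x y, 0 ≤ t → 0 ≤ y → V t (x + 2 * Real.pi) y = V t x y
  periodic_ue : ∀ t x, 0 ≤ t → ue t (x + 2 * Real.pi) = ue t x
  meanFree_U : ∀ t y, 0 ≤ t → 0 ≤ y → ∫ x in (0 : ℝ)..(2 * Real.pi), U t x y = 0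
  meanFree_V : ∀ t y, 0 ≤ t → 0 ≤ y → ∫ x in (0 : ℝ)..(2 * Real.pi), V t x y = 0
  meanFree_ue : ∀ t, 0 ≤ t → ∫ x in (0 : ℝ)..(2 * Real.pi), ue t x = 0
  momentum : ∀ t x y, 0 < t → 0 < y →
    deriv (fun s => U s x y) t + (Us y : ℂ) * deriv (fun z => U t z y) x
        + V t x y * ((halfDeriv 1 Us y : ℝ) : ℂ) - iteratedDeriv 2 (fun z => U t x z) y
      = deriv (fun s => ue s x) t + deriv (fun z => ue t z) x
  divergence : ∀ t x y, 0 < t → 0 < y →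
    deriv (fun z => U t z y) x + deriv (fun z => V t x z) y = 0
  U_wall : ∀ t x, 0 ≤ t → U t x 0 = 0
  V_wall : ∀ t x, 0 ≤ t → V t x 0 = 0
  U_far : ∀ t x, 0 ≤ t → Tendsto (fun y => U t x y) atTop (𝓝 (ue t x))
  defect_integrable : ∀ t x, 0 ≤ t → IntegrableOn (fun y => ue t x - U t x y) (Ioi 0)

/-- `g = DN f` for continuous `2π`-periodic zero-mean functions: the Dirichlet-to-Neumann
operator of the half-space, which is the Fourier multiplier `|n|`. -/
def IsDirichletToNeumann (f g : ℝ → ℂ) : Prop :=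
  Continuous f ∧ Continuous g ∧
    Function.Periodic f (2 * Real.pi) ∧ Function.Periodic g (2 * Real.pi) ∧
    fourierCoeffOn Real.two_pi_pos f 0 = 0 ∧
    ∀ n : ℤ, fourierCoeffOn Real.two_pi_pos g n
      = ((|n| : ℤ) : ℂ) * fourierCoeffOn Real.two_pi_pos f n

/-- The linearized interactive boundary layer system:
`ue = √ν DN ∫₀^∞ (ue - U) dy`. -/
def SolvesIBL (Us : ℝ → ℝ) (ν : ℝ) (U V : ℝ → ℝ → ℝ → ℂ) (ue : ℝ → ℝ → ℂ) : Prop :=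
  SolvesLinearizedBL Us U V ue ∧
    ∀ t, 0 ≤ t → IsDirichletToNeumann
      (fun x => (Real.sqrt ν : ℂ) * ∫ y in Ioi (0 : ℝ), (ue t x - U t x y)) (ue t)

/-- The linearized boundary layer system with prescribed displacement thickness:
`∫₀^∞ (ue - U) dy = Δ_s ue`. -/
def SolvesPDT (Us : ℝ → ℝ) (U V : ℝ → ℝ → ℝ → ℂ) (ue : ℝ → ℝ → ℂ) : Prop :=
  SolvesLinearizedBL Us U V ue ∧
    ∀ t x, 0 ≤ t → ∫ y in Ioi (0 : ℝ), (ue t x - U t x y) = (displacement Us : ℂ) * ue t x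

/-- The system `S` displays a `(lam, k)` instability: `k ≥ 1`, `Re lam > 0`, and there are smooth
`𝒰, 𝒱 : [0, ∞) → ℂ` such that `e^{lam t} e^{i k x} (𝒰(y), 𝒱(y), 1)` solves `S`. -/
def DisplaysInstability (S : (ℝ → ℝ → ℝ → ℂ) → (ℝ → ℝ → ℝ → ℂ) → (ℝ → ℝ → ℂ) → Prop)
    (lam : ℂ) (k : ℕ) : Prop :=
  1 ≤ k ∧ 0 < lam.re ∧ ∃ 𝒰 𝒱 : ℝ → ℂ,
    ContDiffOn ℝ ∞ 𝒰 (Ici 0) ∧ ContDiffOn ℝ ∞ 𝒱 (Ici 0) ∧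
    S (fun t x y => Complex.exp (lam * t) * Complex.exp (Complex.I * k * x) * 𝒰 y)
      (fun t x y => Complex.exp (lam * t) * Complex.exp (Complex.I * k * x) * 𝒱 y)
      (fun t x => Complex.exp (lam * t) * Complex.exp (Complex.I * k * x))

/-! ### Spectral domains -/

/-- The spectral domain `Γ₁`. -/
def Gamma1 : Set ℂ :=
  {z | 0 < z.re ∧ z.re < 1 ∧ 0 < z.im ∧
    z.im < Real.sqrt (3 * z.re * (1 - z.re) ^ 2 / (4 - 3 * z.re))}

/-- The spectral domain `Γ₂`. -/
def Gamma2 : Set ℂ :=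
  {z | 0 < z.re ∧ z.re < 2 / 3 ∧ 0 < z.im ∧
    z.im < Real.sqrt (z.re * (2 - 3 * z.re) / 3)}

/-- The spectral domain `Γ₃`. -/
def Gamma3 : Set ℂ :=
  {z | 0 < z.re ∧ z.re < 1 ∧ 0 < z.im ∧ z.im < Real.sqrt (z.re * (1 - z.re))}

end BoundaryLayer

end

/-! Take a normal mode with λ = -ikc and stream function φ. In the inviscid limit (φ/(U - c))' = (1
- c)/(U - c)², so (1 - c)(φ/(U - c))' - 1 = (1 - U) E_c(U), where E_c is `velocityKernel c`, and the
displacement ∫(1 - φ') equals -∫(1 - U) E_c(U) dy. Choose the flow by U' = (1 - U)/M(U) with M > 0.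
Then (1 - U) dy = M du and the displacement becomes -∫₀¹ M E_c du, linear in M. PDT asks for ∫ M (1
+ E_c) = 0, since Δ_s = ∫ M. IBL asks for ∫ M E_c = -(√ν k)⁻¹, which is close to 0 in the second
statement and to -γ in the third.

Design of the flow: for c = μ, such an M exists once the target lies in the open convex cone of
values of κ + E_μ on (0,1), with κ = 1 for PDT and κ = 0 for IBL. The domains Γ₁, Γ₂, Γ₃ supply this
cone condition. Polynomial peaks at two or three velocities, added to a small constant δ, realise
the moment exactly (`exists_polynomial_moment`). Small δ makes U converge fast enough for any
admissible weight (`exists_shearFlow`).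

Viscosity: the unknown w, equal to (1 - U) E_c(U) in the limit, solves a singularly perturbed
problem with w(0) = -1. Write it through h = w - w''/σ² with σ² = mk. After division by U - c the
leading operator is multiplication by 1 - (i/m)(U - c), a strict contraction because Im c > 0,
composed with a resolvent of norm close to 1. A Neumann series solves it for all large σ,
holomorphically in c (`exists_reduced_solution`, `exists_viscousSolution`), and ∫ w differs from the
inviscid integral by O(1/σ) (`ViscousSolution.norm_integral_sub_le`).

Conclusion: the inviscid integral is a nonconstant holomorphic function of c, so a quantitative open
mapping argument gives, for every large k and every target near the inviscid value, an exact viscous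
mode with c near μ (`exists_isMode_near`). -/

noncomputable section

/-! ### Geometry of the inviscid kernel as a curve in the complex plane. -/

namespace BoundaryLayer

/-- The kernel of the inviscid displacement functional in the velocity variable. -/
def velocityKernel (c : ℂ) (u : ℝ) : ℂ := (1 + u - 2 * c) / ((u : ℂ) - c) ^ 2

lemma sub_ne_zero_of_im_pos {c : ℂ} (hc : 0 < c.im) (u : ℝ) : (u : ℂ) - c ≠ 0 := by
  intro h
  have := congrArg Complex.im h
  simp at this
  exact hc.ne' this

lemma continuous_velocityKernel {c : ℂ} (hc : 0 < c.im) : Continuous (velocityKernel c) := by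
  unfold velocityKernel
  refine Continuous.div (by fun_prop) (by fun_prop) fun u => pow_ne_zero 2 (sub_ne_zero_of_im_pos hc u)

lemma velocityKernel_eq {c : ℂ} (hc : 0 < c.im) (u : ℝ) :
    velocityKernel c u = (((((u - c.re) ^ 2 + c.im ^ 2) ^ 2)⁻¹ : ℝ) : ℂ) *
      (((u - c.re) * ((u - c.re) ^ 2 + c.im ^ 2) + (1 - c.re) * ((u - c.re) ^ 2 - c.im ^ 2)
          + 2 * c.im ^ 2 * (u - c.re) : ℝ)
        + ((2 * c.im * (c.im ^ 2 + (1 - c.re) * (u - c.re)) : ℝ) : ℂ) * Complex.I) := by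
  have h0 : ((((u - c.re) ^ 2 + c.im ^ 2) ^ 2 : ℝ) : ℂ) ≠ 0 := by
    norm_cast
    have : 0 < c.im ^ 2 := by positivity
    positivity
  unfold velocityKernel
  rw [Complex.ofReal_inv, div_eq_iff (pow_ne_zero 2 (sub_ne_zero_of_im_pos hc u)), mul_assoc,
    eq_inv_mul_iff_mul_eq₀ h0]
  obtain ⟨a, b⟩ := c
  apply Complex.ext <;> simp [pow_succ] <;> ring

/-- The sign is that of an affine function of u, so for Re c < 1 the kernel crosses the real axis at
a single velocity, upwards. -/
lemma velocityKernel_im {c : ℂ} (hc : 0 < c.im) (u : ℝ) :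
    (velocityKernel c u).im = (((u - c.re) ^ 2 + c.im ^ 2) ^ 2)⁻¹ *
      (2 * c.im * (c.im ^ 2 + (1 - c.re) * (u - c.re))) := by
  rw [velocityKernel_eq hc, Complex.im_ofReal_mul]
  simp only [Complex.add_im, Complex.ofReal_im, Complex.mul_im, Complex.ofReal_re, Complex.I_re,
    Complex.I_im]
  ring

/-- The crossing happens on the negative real axis. The crossing velocity is below 1, and it is
positive exactly when (Im c)² < Re c (1 - Re c), which is the condition defining Γ₃. -/
lemma velocityKernel_crossing {c : ℂ} (hc : 0 < c.im) (h1 : c.re < 1) :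
    velocityKernel c (c.re - c.im ^ 2 / (1 - c.re)) = ((-((1 - c.re) / c.im ^ 2) : ℝ) : ℂ) := by
  have h1' : (0 : ℝ) < 1 - c.re := by linarith
  rw [velocityKernel_eq hc]
  have e1 : 2 * c.im * (c.im ^ 2 + (1 - c.re) * (c.re - c.im ^ 2 / (1 - c.re) - c.re)) = 0 := by
    field_simp
    ring
  rw [e1, Complex.ofReal_zero, zero_mul, add_zero, ← Complex.ofReal_mul]
  congr 1
  rw [inv_mul_eq_iff_eq_mul₀ (by positivity)]
  field_simp
  ring

/-- Three velocities at which the shifted kernel surrounds the origin. -/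
lemma exists_velocities_surrounding {c : ℂ} (κ : ℝ) (h0 : 0 < c.re) (h1 : c.re < 1)
    (hc : 0 < c.im) (hab : c.im ^ 2 < c.re * (1 - c.re)) (hκ : κ ≤ 1)
    (hneg : ((κ + velocityKernel c 0) * (starRingEnd ℂ) (κ + velocityKernel c 1)).im < 0) :
    ∃ u₁ ∈ Ioo (0 : ℝ) 1, ∃ u₂ ∈ Ioo (0 : ℝ) 1, ∃ u₃ ∈ Ioo (0 : ℝ) 1,
      (κ + velocityKernel c u₁).im < 0 ∧ 0 < (κ + velocityKernel c u₃).im ∧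
      (κ + velocityKernel c u₂).im = 0 ∧ (κ + velocityKernel c u₂).re < 0 ∧
      ((κ + velocityKernel c u₁) * (starRingEnd ℂ) (κ + velocityKernel c u₃)).im < 0 := by
  have he : (0 : ℝ) < 1 - c.re := by linarith
  have hcont := continuous_velocityKernel hc
  -- The three strict inequalities hold at the endpoint velocities 0 and 1, and continuity carries
  -- them to η and 1 - η.
  have hev : ∀ᶠ η in 𝓝[>] (0 : ℝ), (κ + velocityKernel c η).im < 0 ∧
      0 < (κ + velocityKernel c (1 - η)).im ∧
      ((κ + velocityKernel c η) * (starRingEnd ℂ) (κ + velocityKernel c (1 - η))).im < 0 := by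
    apply eventually_nhdsWithin_of_eventually_nhds
    have c1 : Continuous fun η : ℝ => (κ + velocityKernel c η).im := by fun_prop
    have c2 : Continuous fun η : ℝ => (κ + velocityKernel c (1 - η)).im := by fun_prop
    have c3 : Continuous fun η : ℝ =>
        ((κ + velocityKernel c η) * (starRingEnd ℂ) (κ + velocityKernel c (1 - η))).im :=
      Complex.continuous_im.comp ((by fun_prop : Continuous fun η : ℝ =>
        (κ + velocityKernel c η)).mul (Complex.continuous_conj.comp (by fun_prop)))
    refine (c1.continuousAt.eventually_lt continuousAt_const ?_).and
      ((continuousAt_const.eventually_lt c2.continuousAt ?_).and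
        (c3.continuousAt.eventually_lt continuousAt_const ?_))
    · simp only [Complex.add_im, Complex.ofReal_im, zero_add, velocityKernel_im hc]
      have : 0 < ((0 - c.re) ^ 2 + c.im ^ 2) ^ 2 := by positivity
      refine mul_neg_of_pos_of_neg (by positivity) (mul_neg_of_pos_of_neg (by positivity) ?_)
      nlinarith
    · simp only [Complex.add_im, Complex.ofReal_im, zero_add, velocityKernel_im hc, sub_zero]
      positivity
    · simpa using hneg
  obtain ⟨η, ⟨g1, g2, g3⟩, g4⟩ := (hev.and (Ioo_mem_nhdsGT (show (0:ℝ) < 1 by norm_num))).exists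
  refine ⟨η, g4, c.re - c.im ^ 2 / (1 - c.re), ⟨?_, ?_⟩, 1 - η, ⟨by linarith [g4.2], by linarith [g4.1]⟩,
    g1, g2, ?_, ?_, g3⟩
  · rw [sub_pos, div_lt_iff₀ he]; exact hab
  · have : 0 < c.im ^ 2 / (1 - c.re) := by positivity
    linarith
  · rw [velocityKernel_crossing hc h1]; simp only [Complex.add_im, Complex.ofReal_im, add_zero]
  · rw [velocityKernel_crossing hc h1]
    simp only [Complex.add_re, Complex.ofReal_re]
    -- Indeed (Im c)² < Re c (1 - Re c) < 1 - Re c, so a shift by κ ≤ 1 leaves the crossing value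
    -- negative.
    have : 1 < (1 - c.re) / c.im ^ 2 := by
      rw [lt_div_iff₀ (by positivity)]; nlinarith
    linarith

/-- Extracts a positive real factor, so that signs of imaginary parts reduce to signs of polynomials
in Re c and Im c. -/
lemma mul_conj_sq_div {c : ℂ} (hc : c ≠ 0) (z : ℂ) :
    z / c ^ 2 = ((((Complex.normSq c) ^ 2)⁻¹ : ℝ) : ℂ) * (z * (starRingEnd ℂ) c ^ 2) := by
  have h : (starRingEnd ℂ) c ≠ 0 := by simpa using hc
  push_cast
  rw [Complex.normSq_eq_conj_mul_self]
  field_simp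

/-- For κ = 1 the sign is that of (4 - 3a)b² - 3a(1 - a)², with c = a + ib. The curved boundary of
Γ₁ is where the endpoint values 1 + E(0) and 1 + E(1) become aligned with the origin. -/
lemma Gamma1.surrounding {c : ℂ} (hc : c ∈ Gamma1) : c.im ^ 2 < c.re * (1 - c.re) ∧
    (((1 : ℝ) + velocityKernel c 0) * (starRingEnd ℂ) ((1 : ℝ) + velocityKernel c 1)).im < 0 := by
  obtain ⟨h0, h1, h2, h3⟩ := hc
  have he : (0 : ℝ) < 1 - c.re := by linarith
  have hd : (0 : ℝ) < 4 - 3 * c.re := by linarith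
  rw [Real.lt_sqrt h2.le, lt_div_iff₀ hd] at h3
  constructor
  · by_contra! h
    have : c.re * (1 - c.re) * (4 - 3 * c.re) ≤ c.im ^ 2 * (4 - 3 * c.re) := by gcongr
    nlinarith [mul_pos h0 he]
  · have c0 : c ≠ 0 := by rintro rfl; simp at h2
    have c1 : 1 - c ≠ 0 := by simpa using sub_ne_zero_of_im_pos h2 1
    have k0 : (1 : ℝ) + velocityKernel c 0 = (1 - c) ^ 2 / c ^ 2 := by
      simp only [velocityKernel, Complex.ofReal_zero, Complex.ofReal_one]
      field_simp
      ring
    have k1 : (1 : ℝ) + velocityKernel c 1 = (3 - c) * (1 - c) / (1 - c) ^ 2 := by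
      simp only [velocityKernel, Complex.ofReal_one]
      field_simp
      ring
    rw [k0, k1, mul_conj_sq_div c0, mul_conj_sq_div c1, map_mul, Complex.conj_ofReal,
      mul_mul_mul_comm, ← Complex.ofReal_mul, Complex.im_ofReal_mul]
    refine mul_neg_of_pos_of_neg (by have := Complex.normSq_pos.2 c0; have := Complex.normSq_pos.2 c1; positivity) ?_
    have key : ((1 - c) ^ 2 * (starRingEnd ℂ) c ^ 2 * (starRingEnd ℂ) ((3 - c) * (1 - c) * (starRingEnd ℂ) (1 - c) ^ 2)).im
        = ((1 - c.re) ^ 2 + c.im ^ 2) * (2 * c.im * ((4 - 3 * c.re) * c.im ^ 2 - 3 * c.re * (1 - c.re) ^ 2)) := by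
      simp [pow_succ]
      ring
    rw [key]
    refine mul_neg_of_pos_of_neg (by positivity) (mul_neg_of_pos_of_neg (by positivity) ?_)
    linarith

/-- For κ = 0 the sign is that of 3|c|² - 2 Re c, which is negative exactly on the half-disc Γ₂. -/
lemma Gamma2.surrounding {c : ℂ} (hc : c ∈ Gamma2) : c.im ^ 2 < c.re * (1 - c.re) ∧
    (((0 : ℝ) + velocityKernel c 0) * (starRingEnd ℂ) ((0 : ℝ) + velocityKernel c 1)).im < 0 := by
  obtain ⟨h0, h1, h2, h3⟩ := hc
  rw [Real.lt_sqrt h2.le] at h3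
  constructor
  · nlinarith
  · have c0 : c ≠ 0 := by rintro rfl; simp at h2
    have c1 : 1 - c ≠ 0 := by simpa using sub_ne_zero_of_im_pos h2 1
    have k0 : (0 : ℝ) + velocityKernel c 0 = (1 - 2 * c) / c ^ 2 := by
      simp [velocityKernel]
    have k1 : (0 : ℝ) + velocityKernel c 1 = 2 * (1 - c) / (1 - c) ^ 2 := by
      simp only [velocityKernel, Complex.ofReal_one, Complex.ofReal_zero]
      ring
    rw [k0, k1, mul_conj_sq_div c0, mul_conj_sq_div c1, map_mul, Complex.conj_ofReal,
      mul_mul_mul_comm, ← Complex.ofReal_mul, Complex.im_ofReal_mul]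
    refine mul_neg_of_pos_of_neg (by have := Complex.normSq_pos.2 c0; have := Complex.normSq_pos.2 c1; positivity) ?_
    have key : ((1 - 2 * c) * (starRingEnd ℂ) c ^ 2 * (starRingEnd ℂ) (2 * (1 - c) * (starRingEnd ℂ) (1 - c) ^ 2)).im
        = ((1 - c.re) ^ 2 + c.im ^ 2) * (2 * c.im * (3 * (c.re ^ 2 + c.im ^ 2) - 2 * c.re)) := by
      simp [pow_succ]
      ring
    rw [key]
    refine mul_neg_of_pos_of_neg (by have : 0 < c.im ^ 2 := by positivity
                                     positivity) (mul_neg_of_pos_of_neg (by positivity) ?_)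
    linarith

/-- Nearby velocities on both sides of the crossing point. -/
lemma exists_velocities_around_crossing {c : ℂ} (h1 : c.re < 1)
    (hc : 0 < c.im) (hab : c.im ^ 2 < c.re * (1 - c.re)) :
    ∃ u₁ ∈ Ioo (0 : ℝ) 1, ∃ u₃ ∈ Ioo (0 : ℝ) 1,
      (velocityKernel c u₁).im < 0 ∧ 0 < (velocityKernel c u₃).im ∧
      0 < ((velocityKernel c u₁) * (starRingEnd ℂ) (velocityKernel c u₃)).im := by
  have he : (0 : ℝ) < 1 - c.re := by linarith
  have hcont := continuous_velocityKernel hc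
  set us := c.re - c.im ^ 2 / (1 - c.re) with hus
  have hs0 : 0 < us := by rw [hus, sub_pos, div_lt_iff₀ he]; exact hab
  have hs1 : us < 1 := by
    have : 0 < c.im ^ 2 / (1 - c.re) := by positivity
    linarith
  have hsneg : (velocityKernel c us).re < 0 := by
    rw [velocityKernel_crossing hc h1, Complex.ofReal_re]
    have : 0 < (1 - c.re) / c.im ^ 2 := by positivity
    linarith
  have hev : ∀ᶠ η in 𝓝[>] (0 : ℝ), (velocityKernel c (us - η)).re < 0 ∧
      (velocityKernel c (us + η)).re < 0 ∧ 0 < us - η ∧ us + η < 1 := by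
    apply eventually_nhdsWithin_of_eventually_nhds
    have c1 : Continuous fun η : ℝ => (velocityKernel c (us - η)).re := by fun_prop
    have c2 : Continuous fun η : ℝ => (velocityKernel c (us + η)).re := by fun_prop
    have c3 : Continuous fun η : ℝ => us - η := by fun_prop
    have c4 : Continuous fun η : ℝ => us + η := by fun_prop
    refine (c1.continuousAt.eventually_lt continuousAt_const ?_).and
      ((c2.continuousAt.eventually_lt continuousAt_const ?_).and
        ((continuousAt_const.eventually_lt c3.continuousAt ?_).and
        (c4.continuousAt.eventually_lt continuousAt_const ?_))) <;> simpa
  obtain ⟨η, ⟨g1, g2, g3, g4⟩, g5⟩ := (hev.and self_mem_nhdsWithin).exists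
  have g5 : 0 < η := g5
  have i1 : (velocityKernel c (us - η)).im < 0 := by
    rw [velocityKernel_im hc]
    have : c.im ^ 2 + (1 - c.re) * (us - η - c.re) = - ((1 - c.re) * η) := by
      rw [hus]; field_simp; ring
    rw [this]
    refine mul_neg_of_pos_of_neg (by positivity) (mul_neg_of_pos_of_neg (by positivity) ?_)
    have := mul_pos he g5
    linarith
  have i2 : 0 < (velocityKernel c (us + η)).im := by
    rw [velocityKernel_im hc]
    have : c.im ^ 2 + (1 - c.re) * (us + η - c.re) = (1 - c.re) * η := by
      rw [hus]; field_simp; ring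
    rw [this]
    positivity
  -- Both values are close to a negative real number and lie on opposite sides of the axis, so their
  -- cone contains the negative half-axis. This is what the positive last sign encodes.
  refine ⟨us - η, ⟨g3, by linarith⟩, us + η, ⟨by linarith, g4⟩, i1, i2, ?_⟩
  simp only [Complex.mul_im, Complex.conj_re, Complex.conj_im]
  nlinarith [mul_pos_of_neg_of_neg i1 g2, mul_pos_of_neg_of_neg g1 (neg_neg_of_pos i2)]

/-! ### Positive polynomial densities with a prescribed moment. -/

open Polynomial in
/-- Nonnegative polynomials concentrating at an interior velocity. -/
lemma exists_peak_polynomials {E : ℝ → ℂ} (hE : Continuous E) {u₀ : ℝ} (hu : u₀ ∈ Ioo (0 : ℝ) 1) :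
    ∃ p : ℕ → ℝ[X], (∀ n u, 0 ≤ (p n).eval u) ∧
      Tendsto (fun n => ∫ u in (0 : ℝ)..1, ((u ^ 2 * (1 - u) ^ 2 * (p n).eval u : ℝ) : ℂ) * E u)
        atTop (𝓝 (E u₀)) := by
  -- The normalised powers of 1 - (u - u₀)² form an approximate identity at u₀. Dividing u²(1 - u)²
  -- by its value at u₀ makes the limit E u₀ itself.
  have hT := tendsto_setIntegral_pow_smul_of_unique_maximum_of_isCompact_of_continuousOn
    (μ := (volume : Measure ℝ)) (s := Icc (0 : ℝ) 1) (x₀ := u₀) (c := fun u => 1 - (u - u₀) ^ 2)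
    (g := fun u => (((u ^ 2 * (1 - u) ^ 2) / (u₀ ^ 2 * (1 - u₀) ^ 2) : ℝ) : ℂ) * E u)
    isCompact_Icc (by fun_prop)
    (fun y _ hy => by
      have : 0 < (y - u₀) ^ 2 := by have := sub_ne_zero.2 hy; positivity
      simpa using this)
    (fun x hx => by
      have h1 : |x - u₀| ≤ 1 := by rw [abs_le]; constructor <;> linarith [hx.1, hx.2, hu.1, hu.2]
      have := sq_le_one_iff_abs_le_one (x - u₀) |>.2 h1
      simpa using this)
    (by simp) (by simpa using! ⟨hu.1.le, hu.2.le⟩)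
    (by fun_prop)
  have hne : u₀ ^ 2 * (1 - u₀) ^ 2 ≠ 0 := by
    have h1 := hu.1.ne'
    have h2 : 1 - u₀ ≠ 0 := by linarith [hu.2]
    positivity
  -- Even exponents make the polynomials nonnegative on all of ℝ, and not only on [0,1].
  have hT2 := hT.comp (tendsto_id.const_mul_atTop' (show 0 < 2 by norm_num) : Tendsto (fun n : ℕ => 2 * n) atTop atTop)
  rw [div_self hne, Complex.ofReal_one, one_mul] at hT2
  refine ⟨fun n => C ((∫ x in Icc (0 : ℝ) 1, (1 - (x - u₀) ^ 2) ^ (2 * n))⁻¹ / (u₀ ^ 2 * (1 - u₀) ^ 2)) *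
    (1 - (X - C u₀) ^ 2) ^ (2 * n), fun n u => ?_, ?_⟩
  · have : 0 ≤ ∫ x in Icc (0 : ℝ) 1, (1 - (x - u₀) ^ 2) ^ (2 * n) :=
      integral_nonneg fun x => by simp only [pow_mul]; positivity
    simp only [eval_mul, eval_C, eval_pow, eval_sub, eval_one, eval_X, pow_mul]
    positivity
  · refine hT2.congr fun n => ?_
    simp only [Function.comp, eval_mul, eval_C, eval_pow, eval_sub, eval_one, eval_X]
    rw [intervalIntegral.integral_of_le zero_le_one, ← integral_Icc_eq_integral_Ioc,
      ← integral_smul]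
    congr 1
    ext u
    simp only [Complex.real_smul]
    push_cast
    ring

open Polynomial in
/-- A positive polynomial density with a prescribed moment against `E`. -/
lemma exists_polynomial_moment {E : ℝ → ℂ} (hE : Continuous E) {u₁ u₂ u₃ β τ : ℝ}
    (h1 : u₁ ∈ Ioo (0 : ℝ) 1) (h2 : u₂ ∈ Ioo (0 : ℝ) 1) (h3 : u₃ ∈ Ioo (0 : ℝ) 1) (hβ : 0 ≤ β)
    (hE1 : (E u₁).im < 0) (hE3 : 0 < (E u₃).im) (hE2 : (E u₂).im = 0)
    (ht : (τ - β * (E u₂).re) * (E u₁ * (starRingEnd ℂ) (E u₃)).im < 0) {δ₀ : ℝ} (hδ : 0 < δ₀) :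
    ∃ δ : ℝ, 0 < δ ∧ δ < δ₀ ∧ ∃ Q : ℝ[X], (∀ u, 0 ≤ Q.eval u) ∧
      ∫ u in (0 : ℝ)..1, ((δ + u ^ 2 * (1 - u) ^ 2 * Q.eval u : ℝ) : ℂ) * E u = τ := by
  obtain ⟨p1, p1n, p1t⟩ := exists_peak_polynomials hE h1
  obtain ⟨p2, p2n, p2t⟩ := exists_peak_polynomials hE h2
  obtain ⟨p3, p3n, p3t⟩ := exists_peak_polynomials hE h3
  set z1 := fun n => ∫ u in (0 : ℝ)..1, ((u ^ 2 * (1 - u) ^ 2 * (p1 n).eval u : ℝ) : ℂ) * E u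
  set z2 := fun n => ∫ u in (0 : ℝ)..1, ((u ^ 2 * (1 - u) ^ 2 * (p2 n).eval u : ℝ) : ℂ) * E u
  set z3 := fun n => ∫ u in (0 : ℝ)..1, ((u ^ 2 * (1 - u) ^ 2 * (p3 n).eval u : ℝ) : ℂ) * E u
  set I0 := ∫ u in (0 : ℝ)..1, E u
  -- What remains for the peaks at u₁ and u₃ once the constant density δ = 1/(n+1) and the peak of
  -- mass β at u₂ are accounted for. Its limit is real.
  set t : ℕ → ℂ := fun n => τ - ((1 / ((n : ℝ) + 1) : ℝ) : ℂ) * I0 - β * z2 n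
  have hd : Tendsto (fun n : ℕ => (1 / ((n : ℝ) + 1) : ℝ)) atTop (𝓝 0) :=
    tendsto_one_div_add_atTop_nhds_zero_nat
  have htt : Tendsto t atTop (𝓝 (((τ - β * (E u₂).re : ℝ)) : ℂ)) := by
    have e : ((τ - β * (E u₂).re : ℝ) : ℂ) = τ - ((0 : ℝ) : ℂ) * I0 - β * E u₂ := by
      apply Complex.ext <;> simp [hE2]
    rw [e]
    exact ((tendsto_const_nhds.sub ((Complex.continuous_ofReal.tendsto 0 |>.comp hd).mul_const I0))).sub
      (p2t.const_mul (β : ℂ))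
  set T := τ - β * (E u₂).re
  have cim : ∀ {f g : ℕ → ℂ} {a b : ℂ}, Tendsto f atTop (𝓝 a) → Tendsto g atTop (𝓝 b) →
      Tendsto (fun n => (f n * (starRingEnd ℂ) (g n)).im) atTop (𝓝 (a * (starRingEnd ℂ) b).im) :=
    fun hf hg => (Complex.continuous_im.tendsto _).comp
      (hf.mul ((Complex.continuous_conj.tendsto _).comp hg))
  have hD := cim p1t p3t
  have hDne : (E u₁ * (starRingEnd ℂ) (E u₃)).im ≠ 0 := by
    intro h; rw [h, mul_zero] at ht; exact lt_irrefl _ ht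
  -- Cramer's rule for writing `t n` in the basis `z1 n`, `z3 n`. By `ht` the limiting coefficients
  -- are positive, hence so are those for large n.
  have ha1 := (cim htt p3t).div hD hDne
  have ha3 := (cim p1t htt).div hD hDne
  have pos1 : 0 < ((T : ℂ) * (starRingEnd ℂ) (E u₃)).im / (E u₁ * (starRingEnd ℂ) (E u₃)).im := by
    have : ((T : ℂ) * (starRingEnd ℂ) (E u₃)).im = - (T * (E u₃).im) := by simp
    rw [this]
    rcases lt_or_gt_of_ne hDne with h | h
    · have : 0 < T := by by_contra! hT; nlinarith
      exact div_pos_of_neg_of_neg (by nlinarith) h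
    · have : T < 0 := by by_contra! hT; nlinarith
      exact div_pos (by nlinarith) h
  have pos3 : 0 < (E u₁ * (starRingEnd ℂ) (T : ℂ)).im / (E u₁ * (starRingEnd ℂ) (E u₃)).im := by
    have : (E u₁ * (starRingEnd ℂ) (T : ℂ)).im = T * (E u₁).im := by simp [mul_comm]
    rw [this]
    rcases lt_or_gt_of_ne hDne with h | h
    · have : 0 < T := by by_contra! hT; nlinarith
      exact div_pos_of_neg_of_neg (by nlinarith) h
    · have : T < 0 := by by_contra! hT; nlinarith
      exact div_pos (by nlinarith) h
  obtain ⟨n, ⟨⟨hn1, hn3⟩, hnD⟩, hnδ⟩ := ((((ha1.eventually (lt_mem_nhds pos1)).and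
    (ha3.eventually (lt_mem_nhds pos3))).and (hD.eventually_ne hDne)).and
    (hd.eventually (gt_mem_nhds hδ))).exists
  set α1 := (t n * (starRingEnd ℂ) (z3 n)).im / (z1 n * (starRingEnd ℂ) (z3 n)).im
  set α3 := (z1 n * (starRingEnd ℂ) (t n)).im / (z1 n * (starRingEnd ℂ) (z3 n)).im
  have hsolve : (α1 : ℂ) * z1 n + α3 * z3 n = t n := by
    have hc : ∀ x y s : ℂ, (x * (starRingEnd ℂ) y).im ≠ 0 →
        (((s * (starRingEnd ℂ) y).im / (x * (starRingEnd ℂ) y).im : ℝ) : ℂ) * x +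
        (((x * (starRingEnd ℂ) s).im / (x * (starRingEnd ℂ) y).im : ℝ) : ℂ) * y = s := by
      intro x y s h
      have e1 := div_mul_cancel₀ (s * (starRingEnd ℂ) y).im h
      have e3 := div_mul_cancel₀ (x * (starRingEnd ℂ) s).im h
      simp only [Complex.mul_im, Complex.conj_re, Complex.conj_im] at e1 e3 h ⊢
      apply Complex.ext
      · rw [Complex.add_re, Complex.re_ofReal_mul, Complex.re_ofReal_mul]
        refine mul_right_cancel₀ h ?_
        linear_combination x.re * e1 + y.re * e3
      · rw [Complex.add_im, Complex.im_ofReal_mul, Complex.im_ofReal_mul]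
        refine mul_right_cancel₀ h ?_
        linear_combination x.im * e1 + y.im * e3
    exact hc _ _ _ hnD
  refine ⟨1 / ((n : ℝ) + 1), by positivity, hnδ, C α1 * p1 n + C β * p2 n + C α3 * p3 n, ?_, ?_⟩
  · intro u
    have := p1n n u; have := p2n n u; have := p3n n u
    have h1' : 0 ≤ α1 := le_of_lt hn1
    have h3' : 0 ≤ α3 := le_of_lt hn3
    simp only [eval_add, eval_mul, eval_C]
    positivity
  · have i1 : ∀ p : ℝ[X], IntervalIntegrable
        (fun u => ((u ^ 2 * (1 - u) ^ 2 * p.eval u : ℝ) : ℂ) * E u) volume 0 1 := fun p =>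
      Continuous.intervalIntegrable ((Complex.continuous_ofReal.comp
        ((by fun_prop : Continuous fun u : ℝ => u ^ 2 * (1 - u) ^ 2).mul p.continuous)).mul hE) _ _
    have e : ∀ u : ℝ, (((1 / ((n : ℝ) + 1) + u ^ 2 * (1 - u) ^ 2 *
        (C α1 * p1 n + C β * p2 n + C α3 * p3 n).eval u : ℝ)) : ℂ) * E u =
        ((1 / ((n : ℝ) + 1) : ℝ) : ℂ) * E u + (α1 * (((u ^ 2 * (1 - u) ^ 2 * (p1 n).eval u : ℝ) : ℂ) * E u)
         + β * (((u ^ 2 * (1 - u) ^ 2 * (p2 n).eval u : ℝ) : ℂ) * E u)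
         + α3 * (((u ^ 2 * (1 - u) ^ 2 * (p3 n).eval u : ℝ) : ℂ) * E u)) := by
      intro u
      simp only [eval_add, eval_mul, eval_C]
      push_cast
      ring
    simp_rw [e]
    rw [intervalIntegral.integral_add ((hE.intervalIntegrable _ _).const_mul _)
      ((((i1 _).const_mul _).add ((i1 _).const_mul _)).add ((i1 _).const_mul _)),
      intervalIntegral.integral_add (((i1 _).const_mul _).add ((i1 _).const_mul _))
      ((i1 _).const_mul _), intervalIntegral.integral_add ((i1 _).const_mul _) ((i1 _).const_mul _)]
    simp only [intervalIntegral.integral_const_mul]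
    change _ * I0 + ((α1 : ℂ) * z1 n + β * z2 n + α3 * z3 n) = τ
    have : t n = τ - ((1 / ((n : ℝ) + 1) : ℝ) : ℂ) * I0 - β * z2 n := rfl
    linear_combination hsolve + this

end BoundaryLayer

/-! ### Shear flows generated by U' = (1 - U)/M(U). -/

namespace BoundaryLayer

/-- A smooth monotone profile on `[0, ∞)` approaching `1` at the rate `exp (-2 y)` together with
its first three derivatives. -/
structure DecayingProfile (U U₁ U₂ U₃ : ℝ → ℝ) (C : ℝ) : Prop where
  smooth : ContDiff ℝ ∞ U
  hasDerivAt : ∀ y, HasDerivAt U (U₁ y) y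
  hasDerivAt₁ : ∀ y, HasDerivAt U₁ (U₂ y) y
  hasDerivAt₂ : ∀ y, HasDerivAt U₂ (U₃ y) y
  zero : U 0 = 0
  nonneg : ∀ y, 0 ≤ y → 0 ≤ U y
  lt_one : ∀ y, U y < 1
  defect_le : ∀ y, 0 ≤ y → 1 - U y ≤ C * Real.exp (-(2 * y))
  bound₁ : ∀ y, 0 ≤ y → |U₁ y| ≤ C * Real.exp (-(2 * y))
  bound₂ : ∀ y, 0 ≤ y → |U₂ y| ≤ C * Real.exp (-(2 * y))
  bound₃ : ∀ y, 0 ≤ y → |U₃ y| ≤ C * Real.exp (-(2 * y))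

lemma IsWeight.exists_exp_bound {w : ℝ → ℝ} (hw : IsWeight w) :
    ∃ C : ℝ, 0 ≤ C ∧ ∀ y, 0 ≤ y → w y ≤ Real.exp (C * (1 + y)) := by
  obtain ⟨C, hC⟩ := hw.log_bounded
  refine ⟨C, (abs_nonneg _).trans (hC 0 le_rfl), fun y hy => ?_⟩
  have h1 := (abs_le.1 (hC y hy)).2
  rw [div_le_iff₀ (by linarith)] at h1
  exact (Real.log_le_iff_le_exp (by linarith [hw.one_le y hy])).1 h1

/-- Bootstrap: if U is Cⁿ then so is U' = N ∘ U. -/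
lemma contDiff_of_autonomous {U N : ℝ → ℝ} (hN : ContDiff ℝ ∞ N)
    (h : ∀ y, HasDerivAt U (N (U y)) y) : ContDiff ℝ ∞ U := by
  rw [contDiff_infty]
  intro n
  induction n with
  | zero => exact contDiff_zero.2 (continuous_iff_continuousAt.2 fun y => (h y).continuousAt)
  | succ n ih =>
    rw [Nat.cast_succ, contDiff_succ_iff_deriv]
    refine ⟨fun y => (h y).differentiableAt, by simp, ?_⟩
    rw [show deriv U = N ∘ U from funext fun y => (h y).deriv]
    exact (hN.of_le (by exact_mod_cast le_top)).comp ih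

/-- The velocity profile whose shear, as a function of the velocity `u`, is `(1 - u) / M u`. -/
lemma exists_profile_of_density {M : ℝ → ℝ} (hM : Continuous M) {δ C : ℝ} (hδ : 0 < δ)
    (hMδ : ∀ u, δ ≤ M u) (hMC : ∀ u ∈ Icc (0 : ℝ) 1, M u ≤ δ + C * (1 - u)) :
    ∃ U : ℝ → ℝ, U 0 = 0 ∧ (∀ y, U y < 1) ∧ (∀ y, HasDerivAt U ((1 - U y) / M (U y)) y) ∧
      ∀ y, 0 ≤ y → 0 ≤ U y ∧ 1 - U y ≤ Real.exp (C / δ) * Real.exp (-(y / δ)) := by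
  -- With θ = -log(1 - U) the equation becomes θ' = 1/m(θ), so y = Y(θ) and the profile comes from
  -- inverting Y. The bound m ≥ δ makes Y a bijection of ℝ.
  set m : ℝ → ℝ := fun s => M (1 - Real.exp (-s)) with hm
  have hmc : Continuous m := by fun_prop
  set Y : ℝ → ℝ := fun θ => ∫ s in (0 : ℝ)..θ, m s with hY
  have hYd : ∀ θ, HasDerivAt Y (m θ) θ := fun θ =>
    intervalIntegral.integral_hasDerivAt_right (hmc.intervalIntegrable _ _)
      hmc.stronglyMeasurable.stronglyMeasurableAtFilter hmc.continuousAt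
  have hY0 : Y 0 = 0 := by simp [hY]
  have hYc : Continuous Y := continuous_iff_continuousAt.2 fun θ => (hYd θ).continuousAt
  have hmp : ∀ s, 0 < m s := fun s => hδ.trans_le (hMδ _)
  have hmono : StrictMono Y := strictMono_of_deriv_pos fun θ => by rw [(hYd θ).deriv]; exact hmp θ
  have hmono2 : Monotone fun θ => Y θ - δ * θ := by
    refine monotone_of_deriv_nonneg (fun θ => ((hYd θ).sub ((hasDerivAt_id θ).const_mul δ)).differentiableAt)
      fun θ => ?_
    rw [((hYd θ).fun_sub ((hasDerivAt_id' θ).const_mul δ)).deriv]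
    have := hMδ (1 - Real.exp (-θ))
    simpa [hm] using this
  have htop : Tendsto Y atTop atTop := by
    refine tendsto_atTop_mono' _ ?_ (tendsto_id.const_mul_atTop hδ)
    filter_upwards [eventually_ge_atTop 0] with θ hθ
    have := hmono2 hθ
    simp only [hY0] at this
    simp only [id]
    linarith
  have hbot : Tendsto Y atBot atBot := by
    refine tendsto_atBot_mono' _ ?_ (tendsto_id.const_mul_atBot hδ)
    filter_upwards [eventually_le_atBot 0] with θ hθ
    have := hmono2 hθ
    simp only [hY0] at this
    simp only [id]
    linarith
  have hsurj : Function.Surjective Y := hYc.surjective htop hbot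
  set e := hmono.orderIsoOfSurjective Y hsurj with he
  have heY : ∀ y, Y (e.symm y) = y := fun y => e.apply_symm_apply y
  have hΘ : ∀ y, HasDerivAt (fun y => e.symm y) (m (e.symm y))⁻¹ y := fun y =>
    (hYd (e.symm y)).of_local_left_inverse e.symm.continuous.continuousAt (hmp _).ne'
      (Eventually.of_forall heY)
  have hΘ0 : e.symm 0 = 0 := hmono.injective (by rw [heY, hY0])
  have hΘn : ∀ y, 0 ≤ y → 0 ≤ e.symm y := fun y hy => by
    rw [← hΘ0]; exact e.symm.monotone hy
  refine ⟨fun y => 1 - Real.exp (-(e.symm y)), by simp [hΘ0], fun y => by simp [Real.exp_pos],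
    fun y => ?_, fun y hy => ⟨?_, ?_⟩⟩
  · have := ((hΘ y).fun_neg.exp).const_sub 1
    refine this.congr_deriv ?_
    simp [hm, div_eq_mul_inv]
  · simpa using hΘn y hy
  · set θ := e.symm y
    have hθ : 0 ≤ θ := hΘn y hy
    -- Since M exceeds δ by at most C(1 - u), the excess of y over δθ stays bounded by C. Hence 1 -
    -- U = exp(-θ) decays at the full rate 1/δ.
    have hle : y ≤ δ * θ + C * (1 - Real.exp (-θ)) := by
      have hd : ∀ x, HasDerivAt (fun θ => δ * θ + C * (1 - Real.exp (-θ)) - Y θ)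
          (δ + C * Real.exp (-x) - m x) x := fun x => by
        have := (((hasDerivAt_id' x).const_mul δ).fun_add
          (((hasDerivAt_id' x).fun_neg.exp.const_sub 1).const_mul C)).fun_sub (hYd x)
        exact this.congr_deriv (by ring)
      have hmon : MonotoneOn (fun θ => δ * θ + C * (1 - Real.exp (-θ)) - Y θ) (Ici 0) := by
        refine monotoneOn_of_deriv_nonneg (convex_Ici 0)
          (fun x _ => (hd x).continuousAt.continuousWithinAt)
          (fun x _ => (hd x).differentiableAt.differentiableWithinAt) fun x hx => ?_
        rw [interior_Ici] at hx
        rw [(hd x).deriv]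
        have hx0 : (0 : ℝ) < x := hx
        have := hMC (1 - Real.exp (-x)) ⟨by simpa using hx0.le, by simp [Real.exp_nonneg]⟩
        simp only [sub_sub_cancel] at this
        simpa [hm] using this
      have := hmon (mem_Ici.2 le_rfl) (mem_Ici.2 hθ) hθ
      simp only [hY0, θ, heY] at this
      simp at this
      linarith
    have hC : 0 ≤ C := by
      have := hMC 0 ⟨le_rfl, zero_le_one⟩
      have := hMδ 0
      linarith
    have hle2 : y ≤ δ * θ + C := by
      have := mul_nonneg hC (Real.exp_nonneg (-θ))
      linarith
    rw [sub_sub_cancel, ← Real.exp_add]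
    apply Real.exp_le_exp.2
    rw [← sub_eq_add_neg, ← sub_div, le_div_iff₀ hδ]
    linarith

/-- Derivative along the profile of `(1 - u) k(u)`. -/
lemma hasDerivAt_defect_mul {U M k k' : ℝ → ℝ} (hU : ∀ y, HasDerivAt U ((1 - U y) / M (U y)) y)
    (hk : ∀ u, HasDerivAt k (k' u) u) (y : ℝ) :
    HasDerivAt (fun y => (1 - U y) * k (U y))
      ((1 - U y) * ((-k (U y) + (1 - U y) * k' (U y)) / M (U y))) y := by
  have := ((hU y).const_sub 1).fun_mul ((hk (U y)).comp y (hU y))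
  refine this.congr_deriv ?_
  simp only [Function.comp]
  ring

/-- Change of variables u = U(y), under which (1 - U) dy = M du; carried out with an antiderivative
composed with U. -/
lemma integral_defect_mul_comp {U M : ℝ → ℝ} (hMc : Continuous M) (hMp : ∀ u, 0 < M u)
    (hU : ∀ y, HasDerivAt U ((1 - U y) / M (U y)) y)
    (h0 : U 0 = 0) (ht : Tendsto U atTop (𝓝 1)) {H : ℝ → ℂ} (hH : Continuous H)
    (hint : IntegrableOn (fun y => ((1 - U y : ℝ) : ℂ) * H (U y)) (Ioi 0)) :
    ∫ y in Ioi (0 : ℝ), ((1 - U y : ℝ) : ℂ) * H (U y) = ∫ u in (0 : ℝ)..1, (M u : ℂ) * H u := by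
  have hc : Continuous fun u => (M u : ℂ) * H u := by fun_prop
  set G : ℝ → ℂ := fun v => ∫ u in (0 : ℝ)..v, (M u : ℂ) * H u with hG
  have hGd : ∀ v, HasDerivAt G ((M v : ℂ) * H v) v := fun v =>
    intervalIntegral.integral_hasDerivAt_right (hc.intervalIntegrable _ _)
      hc.stronglyMeasurable.stronglyMeasurableAtFilter hc.continuousAt
  have hd : ∀ y ∈ Ici (0 : ℝ), HasDerivAt (fun y => G (U y)) (((1 - U y : ℝ) : ℂ) * H (U y)) y := by
    intro y _
    have := (hGd (U y)).scomp y (hU y)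
    refine this.congr_deriv ?_
    have hne : (M (U y) : ℂ) ≠ 0 := by exact_mod_cast (hMp _).ne'
    simp only [Complex.real_smul]
    push_cast
    field_simp
  have := integral_Ioi_of_hasDerivAt_of_tendsto' hd hint (((hGd 1).continuousAt.tendsto).comp ht)
  rw [this, h0]
  simp [hG]


lemma halfDeriv_eq_of_hasDerivAt {U U₁ U₂ U₃ : ℝ → ℝ} (h₁ : ∀ y, HasDerivAt U (U₁ y) y)
    (h₂ : ∀ y, HasDerivAt U₁ (U₂ y) y) (h₃ : ∀ y, HasDerivAt U₂ (U₃ y) y) {y : ℝ} (hy : 0 ≤ y) :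
    halfDeriv 1 U y = U₁ y ∧ halfDeriv 2 U y = U₂ y ∧ halfDeriv 3 U y = U₃ y := by
  have key : ∀ (n : ℕ) (f g : ℝ → ℝ), (∀ z ∈ Ici (0 : ℝ), halfDeriv n U z = f z) →
      (∀ z, HasDerivAt f (g z) z) → ∀ z ∈ Ici (0 : ℝ), halfDeriv (n + 1) U z = g z := by
    intro n f g hf hg z hz
    unfold halfDeriv at *
    rw [iteratedDerivWithin_succ, derivWithin_congr hf (hf z hz)]
    exact (hg z).hasDerivWithinAt.derivWithin (uniqueDiffOn_Ici 0 z hz)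
  have k1 := key 0 U U₁ (fun z _ => by simp [halfDeriv]) h₁
  have k2 := key 1 U₁ U₂ k1 h₂
  have k3 := key 2 U₂ U₃ k2 h₃
  exact ⟨k1 y hy, k2 y hy, k3 y hy⟩

lemma integrableOn_exp_neg_const_mul {a : ℝ} (ha : 0 < a) (K : ℝ) :
    IntegrableOn (fun y : ℝ => K * Real.exp (-(a * y))) (Ioi 0) := by
  have := (exp_neg_integrableOn_Ioi 0 ha).const_mul K
  simpa [neg_mul, IntegrableOn] using this

lemma integrableOn_of_norm_le_exp {E : Type*} [NormedAddCommGroup E] {f : ℝ → E}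
    (hf : ContinuousOn f (Ioi 0)) {a K : ℝ} (ha : 0 < a)
    (h : ∀ y, 0 < y → ‖f y‖ ≤ K * Real.exp (-(a * y))) : IntegrableOn f (Ioi 0) := by
  refine Integrable.mono' (integrableOn_exp_neg_const_mul ha K)
    (hf.aestronglyMeasurable measurableSet_Ioi) ?_
  filter_upwards [self_mem_ae_restrict measurableSet_Ioi] with y hy using h y hy

lemma exists_bound_comp {U k : ℝ → ℝ} (hk : Continuous k) (h0 : ∀ y, 0 ≤ y → 0 ≤ U y)
    (h1 : ∀ y, U y < 1) : ∃ K : ℝ, 0 < K ∧ ∀ y, 0 ≤ y → |(1 - U y) * k (U y)| ≤ K * (1 - U y) := by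
  obtain ⟨K, hK⟩ := (isCompact_Icc (a := (0 : ℝ)) (b := 1)).exists_bound_of_continuousOn hk.continuousOn
  refine ⟨|K| + 1, by positivity, fun y hy => ?_⟩
  have hp : 0 < 1 - U y := by linarith [h1 y]
  rw [abs_mul, abs_of_pos hp, mul_comm]
  have := hK (U y) ⟨h0 y hy, (h1 y).le⟩
  rw [Real.norm_eq_abs] at this
  gcongr
  linarith [le_abs_self K]

open Polynomial in
/-- Shear flows with prescribed inverse shear density. -/
theorem exists_shearFlow {w : ℝ → ℝ} (hw : IsWeight w) :
    ∃ δ₀ : ℝ, 0 < δ₀ ∧ ∀ δ, 0 < δ → δ < δ₀ → ∀ Q : ℝ[X], (∀ u, 0 ≤ Q.eval u) →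
      ∃ (U U₁ U₂ U₃ : ℝ → ℝ) (C : ℝ), DecayingProfile U U₁ U₂ U₃ C ∧ IsShearFlow w U ∧
        ∀ H : ℝ → ℂ, Continuous H →
          IntegrableOn (fun y => ((1 - U y : ℝ) : ℂ) * H (U y)) (Ioi 0) ∧
          ∫ y in Ioi (0 : ℝ), ((1 - U y : ℝ) : ℂ) * H (U y) =
            ∫ u in (0 : ℝ)..1, ((δ + u ^ 2 * (1 - u) ^ 2 * Q.eval u : ℝ) : ℂ) * H u := by
  obtain ⟨Cw, hCw, hwe⟩ := hw.exists_exp_bound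
  -- The decay rate 1/δ must beat the growth exp(Cw(1 + y)) of the weight together with the factor
  -- (1 + y)², and still exceed the rate 2 of `DecayingProfile`.
  refine ⟨1 / (Cw + 3), by positivity, fun δ hδ hδ0 Q hQ => ?_⟩
  have hA : Cw + 3 ≤ 1 / δ := by
    rw [le_div_iff₀ hδ]
    rw [lt_div_iff₀ (by positivity)] at hδ0
    linarith
  set A := 1 / δ with hAdef
  set P : ℝ[X] := C δ + X ^ 2 * (1 - X) ^ 2 * Q with hP
  set M : ℝ → ℝ := fun u => P.eval u with hM
  have hMe : ∀ u, M u = δ + u ^ 2 * (1 - u) ^ 2 * Q.eval u := fun u => by simp [hM, hP]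
  have hMδ : ∀ u, δ ≤ M u := fun u => by
    rw [hMe]; have := hQ u; have : 0 ≤ u ^ 2 * (1 - u) ^ 2 * Q.eval u := by positivity
    linarith
  have hMp : ∀ u, 0 < M u := fun u => hδ.trans_le (hMδ u)
  have hMs : ContDiff ℝ ∞ M := by
    simpa only [Polynomial.coe_aeval_eq_eval] using P.contDiff_aeval (𝕜 := ℝ) ∞
  have hMc : Continuous M := hMs.continuous
  obtain ⟨CM, hCM⟩ : ∃ CM, ∀ u ∈ Icc (0 : ℝ) 1, M u ≤ δ + CM * (1 - u) := by
    obtain ⟨K, hK⟩ := (isCompact_Icc (a := (0 : ℝ)) (b := 1)).exists_bound_of_continuousOn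
      (f := fun u => u ^ 2 * (1 - u) * Q.eval u) (by
        have := Q.continuous
        fun_prop)
    refine ⟨K, fun u hu => ?_⟩
    have h1 := (le_abs_self _).trans (hK u hu)
    have h2 : 0 ≤ 1 - u := by linarith [hu.2]
    rw [hMe]
    nlinarith [mul_le_mul_of_nonneg_right h1 h2]
  obtain ⟨U, hU0, hU1, hUd, hUb⟩ := exists_profile_of_density hMc hδ hMδ hCM
  have hUn : ∀ y, 0 ≤ y → 0 ≤ U y := fun y hy => (hUb y hy).1
  set C₀ := Real.exp (CM / δ) with hC₀
  have hC₀p : 0 < C₀ := Real.exp_pos _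
  have hV : ∀ y, 0 ≤ y → 1 - U y ≤ C₀ * Real.exp (-(A * y)) := fun y hy => by
    have := (hUb y hy).2
    rwa [show y / δ = A * y by rw [hAdef]; ring] at this
  have hVp : ∀ y, 0 < 1 - U y := fun y => by linarith [hU1 y]
  have hexp : ∀ y : ℝ, 0 ≤ y → ∀ a, a ≤ A → C₀ * Real.exp (-(A * y)) ≤ C₀ * Real.exp (-(a * y)) :=
    fun y hy a ha => by gcongr
  have hUt : Tendsto U atTop (𝓝 1) := by
    have h0 : Tendsto (fun y : ℝ => C₀ * Real.exp (-(1 * y))) atTop (𝓝 0) := by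
      have := (Real.tendsto_exp_neg_atTop_nhds_zero).const_mul C₀
      simpa using this
    have : Tendsto (fun y => 1 - U y) atTop (𝓝 0) := by
      refine squeeze_zero' (Eventually.of_forall fun y => (hVp y).le) ?_ h0
      filter_upwards [eventually_ge_atTop 0] with y hy
      exact (hV y hy).trans (hexp y hy 1 (by linarith))
    simpa using this.const_sub 1
  -- derivatives of the profile
  set k₁ : ℝ → ℝ := fun u => 1 / M u with hk₁
  have hk₁s : ContDiff ℝ ∞ k₁ := contDiff_const.div hMs fun u => (hMp u).ne'
  -- Differentiation in y preserves the form (1 - U) k(U) and acts on k by T. So every derivative of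
  -- U needed here is O(1 - U).
  set T : (ℝ → ℝ) → ℝ → ℝ := fun k u => (-k u + (1 - u) * deriv k u) / M u with hT
  have hTs : ∀ k, ContDiff ℝ ∞ k → ContDiff ℝ ∞ (T k) := fun k hk =>
    ((hk.neg).add ((contDiff_const.sub contDiff_id).mul
      ((contDiff_infty_iff_deriv.1 hk).2))).div hMs fun u => (hMp u).ne'
  have hTd : ∀ k, ContDiff ℝ ∞ k → ∀ y, HasDerivAt (fun y => (1 - U y) * k (U y))
      ((1 - U y) * T k (U y)) y := fun k hk =>
    hasDerivAt_defect_mul hUd fun u => ((hk.differentiable (by simp)) u).hasDerivAt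
  set k₂ := T k₁ with hk₂
  set k₃ := T k₂ with hk₃
  have hk₂s := hTs _ hk₁s
  have hk₃s := hTs _ hk₂s
  have hd1 : ∀ y, HasDerivAt U ((1 - U y) * k₁ (U y)) y := fun y =>
    (hUd y).congr_deriv (by simp only [hk₁]; ring)
  have hd2 := hTd _ hk₁s
  have hd3 := hTd _ hk₂s
  have hUs : ContDiff ℝ ∞ U := contDiff_of_autonomous
    (N := fun u => (1 - u) / M u) ((contDiff_const.sub contDiff_id).div hMs fun u => (hMp u).ne') hUd
  have hUc := hUs.continuous
  have hhalf := fun (y : ℝ) (hy : 0 ≤ y) => halfDeriv_eq_of_hasDerivAt hd1 hd2 hd3 hy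
  obtain ⟨K₁, hK₁p, hK₁⟩ := exists_bound_comp hk₁s.continuous hUn hU1
  obtain ⟨K₂, hK₂p, hK₂⟩ := exists_bound_comp hk₂s.continuous hUn hU1
  obtain ⟨K₃, hK₃p, hK₃⟩ := exists_bound_comp hk₃s.continuous hUn hU1
  have hint : ∀ {E : Type} [NormedAddCommGroup E] (f : ℝ → E), ContinuousOn f (Ioi 0) → ∀ K : ℝ,
      0 ≤ K → (∀ y, 0 < y → ‖f y‖ ≤ K * (1 - U y)) → IntegrableOn f (Ioi 0) := by
    intro E _ f hf K hK h
    refine integrableOn_of_norm_le_exp hf (a := A) (K := K * C₀) (by positivity) fun y hy => ?_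
    rw [mul_assoc]
    exact (h y hy).trans (mul_le_mul_of_nonneg_left (hV y hy.le) hK)
  have hwc : ContinuousOn w (Ioi 0) := hw.differentiableOn.continuousOn.mono Ioi_subset_Ici_self
  have hmem : ∀ f : ℝ → ℝ, ContinuousOn f (Ioi 0) → ∀ K : ℝ, 0 ≤ K →
      (∀ y, 0 < y → |f y| ≤ K * ((1 + y) * (1 - U y))) → MemWeightedL2 w f := by
    intro f hf K hK h
    refine ⟨hf.aestronglyMeasurable measurableSet_Ioi, integrableOn_of_norm_le_exp
      ((hf.pow 2).mul hwc) one_pos (K := (K * C₀) ^ 2 * Real.exp Cw) fun y hy => ?_⟩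
    have hwy : 0 ≤ w y := by linarith [hw.one_le y hy.le]
    have hy1 : 1 + y ≤ Real.exp y := by linarith [Real.add_one_le_exp y]
    have e1 : |f y| ≤ K * (Real.exp y * (C₀ * Real.exp (-(A * y)))) :=
      (h y hy).trans (by have := (hVp y).le; have := hV y hy.le; gcongr)
    have e2 : (K * (Real.exp y * (C₀ * Real.exp (-(A * y))))) ^ 2 * Real.exp (Cw * (1 + y)) =
        (K * C₀) ^ 2 * (Real.exp y * Real.exp y * (Real.exp (-(A * y)) * Real.exp (-(A * y)))
          * Real.exp (Cw * (1 + y))) := by ring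
    rw [norm_mul, norm_pow, Real.norm_eq_abs, Real.norm_of_nonneg hwy]
    refine (mul_le_mul (pow_le_pow_left₀ (abs_nonneg _) e1 2) (hwe y hy.le) hwy
      (by positivity)).trans ?_
    rw [e2, mul_assoc _ (Real.exp Cw)]
    refine mul_le_mul_of_nonneg_left ?_ (by positivity)
    simp only [← Real.exp_add]
    apply Real.exp_le_exp.2
    nlinarith
  have hVd : ∀ j, 1 ≤ j → j ≤ 3 → ∃ k : ℝ → ℝ, Continuous k ∧ ∃ K : ℝ, 0 ≤ K ∧ ∀ y, 0 ≤ y →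
      halfDeriv j U y = (1 - U y) * k (U y) ∧ |(1 - U y) * k (U y)| ≤ K * (1 - U y) := by
    intro j h1 h3
    interval_cases j
    · exact ⟨k₁, hk₁s.continuous, K₁, hK₁p.le, fun y hy => ⟨(hhalf y hy).1, hK₁ y hy⟩⟩
    · exact ⟨k₂, hk₂s.continuous, K₂, hK₂p.le, fun y hy => ⟨(hhalf y hy).2.1, hK₂ y hy⟩⟩
    · exact ⟨k₃, hk₃s.continuous, K₃, hK₃p.le, fun y hy => ⟨(hhalf y hy).2.2, hK₃ y hy⟩⟩
  -- U'' = -(1 - U) Z(U)/M(U)³, so zeros of U'' come from roots of a polynomial. The factor u²(1 -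
  -- u)² in M forces Z(0) = Z(1) = δ, whence U''(0) ≠ 0 and U'' < 0 near infinity.
  set Z : ℝ[X] := P + (1 - X) * derivative P with hZ
  have hk₂Z : ∀ u, k₂ u = -(Z.eval u) / M u ^ 3 := by
    intro u
    have : deriv k₁ u = -(P.derivative.eval u) / M u ^ 2 := by
      have h := (P.hasDerivAt u).fun_inv (hMp u).ne'
      simp only [hk₁, one_div]
      exact h.deriv
    have hne := (hMp u).ne'
    have hZe : Z.eval u = M u + (1 - u) * P.derivative.eval u := by simp [hZ, hM]
    simp only [hk₂, hT]
    rw [this, hZe]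
    simp only [hk₁]
    field_simp
    ring
  have hZ0 : Z.eval 0 = δ := by
    simp [hZ, hP, derivative_mul, derivative_pow]
  have hZ1 : Z.eval 1 = δ := by
    simp [hZ, hP]
  refine ⟨U, fun y => (1 - U y) * k₁ (U y), fun y => (1 - U y) * k₂ (U y),
    fun y => (1 - U y) * k₃ (U y), (1 + K₁ + K₂ + K₃) * C₀, ?_, ?_, ?_⟩
  · have hb : ∀ K y, 0 ≤ y → 0 ≤ K → K ≤ 1 + K₁ + K₂ + K₃ →
        K * (1 - U y) ≤ (1 + K₁ + K₂ + K₃) * C₀ * Real.exp (-(2 * y)) := fun K y hy hK hK' => by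
      rw [mul_assoc]
      have := (hV y hy).trans (hexp y hy 2 (by linarith))
      have := (hVp y).le
      gcongr
    exact
    { smooth := hUs
      hasDerivAt := hd1
      hasDerivAt₁ := hd2
      hasDerivAt₂ := hd3
      zero := hU0
      nonneg := hUn
      lt_one := hU1
      defect_le := fun y hy => by simpa using hb 1 y hy zero_le_one (by linarith)
      bound₁ := fun y hy => (hK₁ y hy).trans (hb _ y hy hK₁p.le (by linarith))
      bound₂ := fun y hy => (hK₂ y hy).trans (hb _ y hy hK₂p.le (by linarith))
      bound₃ := fun y hy => (hK₃ y hy).trans (hb _ y hy hK₃p.le (by linarith)) }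
  · have hmono : StrictMono U := strictMono_of_deriv_pos fun y => by
      rw [(hd1 y).deriv]
      exact mul_pos (hVp y) (by simp only [hk₁]; exact one_div_pos.2 (hMp _))
    exact
    { smooth := hUs.contDiffOn
      mapsTo := fun y hy => ⟨hUn y hy, hU1 y⟩
      at_zero := hU0
      at_top := hUt
      deriv_pos := fun y hy => by
        rw [(hhalf y hy).1]
        exact mul_pos (hVp y) (by simp only [hk₁]; exact one_div_pos.2 (hMp _))
      deriv2_zero_ne := by
        rw [(hhalf 0 le_rfl).2.1, hU0, ← hk₂, hk₂Z, hZ0]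
        have := (hMp 0).ne'
        have := hδ.ne'
        simp
        tauto
      deriv2_finite_zeros := by
        have hZne : Z ≠ 0 := by
          intro h
          rw [h] at hZ1
          simp at hZ1
          exact hδ.ne hZ1
        refine ((Z.rootSet_finite ℝ).preimage hmono.injective.injOn).subset ?_
        rintro y ⟨hy, h⟩
        rw [(hhalf y hy).2.1, ← hk₂, hk₂Z] at h
        have h1 := (hVp y).ne'
        have h2 := (hMp (U y)).ne'
        rw [mem_preimage, mem_rootSet_of_ne hZne]
        simpa [h1, h2] using h
      displacement_finite := hint _ (by fun_prop) 1 zero_le_one fun y _ => by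
        rw [Real.norm_of_nonneg (hVp y).le, one_mul]
      deriv_bounded := fun j h1 h3 => by
        obtain ⟨k, -, K, hK, hj⟩ := hVd j h1 h3
        refine ⟨K, fun y hy => ?_⟩
        rw [(hj y hy).1]
        refine ((hj y hy).2).trans ?_
        nlinarith [hUn y hy]
      defect_memL2 := hmem _ (by fun_prop) 1 zero_le_one fun y hy => by
        rw [abs_of_pos (hVp y), one_mul]
        nlinarith [hVp y]
      deriv_memL2 := fun j h1 h3 => by
        obtain ⟨k, hk, K, hK, hj⟩ := hVd j h1 h3
        refine hmem _ ?_ K hK fun y hy => ?_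
        · have hc : Continuous fun y => (1 + y) * ((1 - U y) * k (U y)) := by fun_prop
          exact hc.continuousOn.congr fun y hy => by
            simp only [(hj y (le_of_lt hy)).1]
        · rw [(hj y hy.le).1, abs_mul, abs_of_pos (by linarith : 0 < 1 + y)]
          have := (hj y hy.le).2
          rw [mul_left_comm]
          gcongr
      ratio1 := by
        have : Tendsto (fun y => (1 - U y) * M (U y)) atTop (𝓝 ((1 - 1) * M 1)) :=
          (hUt.const_sub 1).mul ((hMc.tendsto 1).comp hUt)
        rw [sub_self, zero_mul] at this
        refine this.congr' ?_
        filter_upwards [eventually_ge_atTop 0] with y hy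
        rw [(hhalf y hy).1]
        have h1 := (hVp y).ne'
        have h2 := (hMp (U y)).ne'
        simp only [hk₁]
        field_simp
      ratio2 := by
        have h0 : Tendsto (fun y : ℝ => C₀ * Real.exp (-y)) atTop (𝓝 0) := by
          simpa using (Real.tendsto_exp_neg_atTop_nhds_zero).const_mul C₀
        refine squeeze_zero' ?_ ?_ h0
        · filter_upwards [eventually_ge_atTop 0] with y hy
          exact mul_nonneg (hVp y).le hy
        · filter_upwards [eventually_ge_atTop 0] with y hy
          have h1 := (hV y hy).trans (hexp y hy 2 (by linarith))
          have h2 : y ≤ Real.exp y := by linarith [Real.add_one_le_exp y]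
          calc (1 - U y) * y ≤ C₀ * Real.exp (-(2 * y)) * Real.exp y :=
                mul_le_mul h1 h2 hy (by positivity)
            _ = C₀ * Real.exp (-y) := by
                rw [mul_assoc, ← Real.exp_add]; ring_nf
      ratio3 := by
        obtain ⟨K, hKp, hK⟩ := exists_bound_comp (k := fun u => -(Z.eval u) / M u)
          ((Z.continuous.neg).div hMc fun u => (hMp u).ne') hUn hU1
        have hc : Continuous fun y => (1 - U y) * (-(Z.eval (U y)) / M (U y)) :=
          ((continuous_const.sub hUc).mul (((Z.continuous.comp hUc).neg).div (hMc.comp hUc) fun y => (hMp _).ne'))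
        refine (hint _ hc.continuousOn K hKp.le fun y hy => hK y hy.le).congr_fun (fun y hy => ?_)
          measurableSet_Ioi
        simp only [(hhalf y (le_of_lt hy)).1, (hhalf y (le_of_lt hy)).2.1, ← hk₂, hk₂Z]
        have h1 := (hVp y).ne'
        have h2 := (hMp (U y)).ne'
        simp only [hk₁]
        field_simp
      kappa := by
        have hZt : Tendsto (fun y => Z.eval (U y)) atTop (𝓝 δ) := by
          rw [← hZ1]; exact (Z.continuous.tendsto 1).comp hUt
        obtain ⟨y₀, hy₀⟩ := eventually_atTop.1 (hZt.eventually (lt_mem_nhds (half_lt_self hδ)))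
        -- Beyond y₀ one has Z(U) ≥ δ/2. As 0 < 1 - U ≤ 1, the exponent 2 - 1/4 only enlarges (1 -
        -- U)² and the inequality reduces to this bound.
        refine ⟨1 / 4, max y₀ 1, δ / 2, by norm_num, by norm_num, by positivity, by positivity,
          fun y hy => ?_⟩
        have hy0 : 0 ≤ y := zero_le_one.trans ((le_max_right _ _).trans hy)
        have hZy := (hy₀ y ((le_max_left _ _).trans hy)).le
        rw [(hhalf y hy0).1, (hhalf y hy0).2.1, ← hk₂, hk₂Z]
        simp only [hk₁]
        have h2 := hMp (U y)
        have hv : (1 - U y) ^ (2 : ℕ) ≤ (1 - U y) ^ ((2 : ℝ) - 1 / 4) := by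
          rw [← Real.rpow_natCast]
          exact Real.rpow_le_rpow_of_exponent_ge (hVp y) (by linarith [hUn y hy0]) (by norm_num)
        have hv' := hVp y
        have e1 : (1 - U y) ^ ((2 : ℝ) - 1 / 4) * ((1 - U y) * (-(Z.eval (U y)) / M (U y) ^ 3)) =
          -((1 - U y) ^ ((2 : ℝ) - 1 / 4) * Z.eval (U y) * ((1 - U y) / M (U y) ^ 3)) := by ring
        have e2 : -(δ / 2) * ((1 - U y) * (1 / M (U y))) ^ 3 =
          -((1 - U y) ^ 2 * (δ / 2) * ((1 - U y) / M (U y) ^ 3)) := by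
            field_simp
        rw [e1, e2]
        apply neg_le_neg
        gcongr }
  · intro H hH
    obtain ⟨K, hK⟩ := (isCompact_Icc (a := (0 : ℝ)) (b := 1)).exists_bound_of_continuousOn
      hH.continuousOn
    have hI : IntegrableOn (fun y => ((1 - U y : ℝ) : ℂ) * H (U y)) (Ioi 0) := by
      refine hint _ (by fun_prop) |K| (abs_nonneg _) fun y hy => ?_
      rw [norm_mul, Complex.norm_real, Real.norm_of_nonneg (hVp y).le, mul_comm]
      have := hK (U y) ⟨hUn y hy.le, (hU1 y).le⟩
      have := (hVp y).le
      gcongr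
      linarith [le_abs_self K]
    refine ⟨hI, ?_⟩
    rw [integral_defect_mul_comp hMc hMp hUd hU0 hUt hH hI]
    simp only [hMe]

end BoundaryLayer

/-! ### First-order solution operators in the weight exp(-y). -/

namespace BoundaryLayer
open scoped BoundedContinuousFunction

/-- A bounded operator on bounded continuous functions from a pointwise formula. -/
def boundedOperator (T : (ℝ →ᵇ ℂ) → ℝ → ℂ) (hadd : ∀ p q y, T (p + q) y = T p y + T q y)
    (hsmul : ∀ (a : ℂ) q y, T (a • q) y = a * T q y) (hcont : ∀ q, Continuous (T q)) (C : ℝ)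
    (hC : 0 ≤ C) (hb : ∀ q y, ‖T q y‖ ≤ C * ‖q‖) : (ℝ →ᵇ ℂ) →L[ℂ] (ℝ →ᵇ ℂ) :=
  LinearMap.mkContinuous
    { toFun := fun q => BoundedContinuousFunction.ofNormedAddCommGroup (T q) (hcont q) (C * ‖q‖) (hb q)
      map_add' := fun p q => by ext y; exact hadd p q y
      map_smul' := fun a q => by ext y; exact hsmul a q y } C
    fun q => BoundedContinuousFunction.norm_ofNormedAddCommGroup_le (hcont q) (by positivity) (hb q)

lemma norm_boundedOperator_le {T : (ℝ →ᵇ ℂ) → ℝ → ℂ} {hadd hsmul hcont C hC hb} :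
    ‖boundedOperator T hadd hsmul hcont C hC hb‖ ≤ C :=
  LinearMap.mkContinuous_norm_le _ hC
    fun q => BoundedContinuousFunction.norm_ofNormedAddCommGroup_le (hcont q) (by positivity) (hb q)

lemma integrableOn_exp_mul_bounded {a : ℝ} (ha : a < 0) (q : ℝ →ᵇ ℂ) (y : ℝ) :
    IntegrableOn (fun z : ℝ => (Real.exp (a * z) : ℂ) * q z) (Ioi y) := by
  refine Integrable.mono' (g := fun z => Real.exp (a * z) * ‖q‖)
    ((integrableOn_exp_mul_Ioi ha y).mul_const _)
    (by fun_prop : Continuous _).aestronglyMeasurable (Eventually.of_forall fun z => ?_)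
  rw [norm_mul, Complex.norm_real, Real.norm_of_nonneg (Real.exp_nonneg _)]
  gcongr
  exact q.norm_coe_le_norm z

lemma norm_integral_exp_mul_bounded_le {a : ℝ} (ha : a < 0) (q : ℝ →ᵇ ℂ) (y : ℝ) :
    ‖∫ z in Ioi y, (Real.exp (a * z) : ℂ) * q z‖ ≤ (-Real.exp (a * y) / a) * ‖q‖ := by
  rw [← integral_exp_mul_Ioi ha, ← integral_mul_const]
  refine norm_integral_le_of_norm_le ((integrableOn_exp_mul_Ioi ha y).mul_const _)
    (Eventually.of_forall fun z => ?_)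
  rw [norm_mul, Complex.norm_real, Real.norm_of_nonneg (Real.exp_nonneg _)]
  gcongr
  exact q.norm_coe_le_norm z

lemma norm_intervalIntegral_exp_mul_bounded_le {a : ℝ} (ha : a ≠ 0) (q : ℝ →ᵇ ℂ) {y : ℝ}
    (hy : 0 ≤ y) :
    ‖∫ z in (0 : ℝ)..y, (Real.exp (a * z) : ℂ) * q z‖ ≤ ((Real.exp (a * y) - 1) / a) * ‖q‖ := by
  have h1 : ∫ z in (0 : ℝ)..y, Real.exp (a * z) * ‖q‖ = ((Real.exp (a * y) - 1) / a) * ‖q‖ := by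
    rw [intervalIntegral.integral_mul_const, intervalIntegral.integral_comp_mul_left _ ha, integral_exp]
    simp [div_eq_inv_mul]
  rw [← h1]
  refine intervalIntegral.norm_integral_le_of_norm_le hy (Eventually.of_forall fun z _ => ?_)
    ((by fun_prop : Continuous fun z : ℝ => Real.exp (a * z) * ‖q‖).intervalIntegrable _ _)
  rw [norm_mul, Complex.norm_real, Real.norm_of_nonneg (Real.exp_nonneg _)]
  gcongr
  exact q.norm_coe_le_norm z

lemma hasDerivAt_integral_Ioi {g : ℝ → ℂ} (hg : Continuous g) (hi : ∀ y, IntegrableOn g (Ioi y))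
    (y : ℝ) : HasDerivAt (fun y => ∫ z in Ioi y, g z) (-g y) y := by
  have h : (fun y => ∫ z in Ioi y, g z) = fun y => (∫ z in Ioi 0, g z) - ∫ z in (0 : ℝ)..y, g z := by
    ext y
    rw [← intervalIntegral.integral_Ioi_sub_Ioi' (hi 0) (hi y)]
    ring
  rw [h]
  exact (intervalIntegral.integral_hasDerivAt_right (hg.intervalIntegrable _ _)
      hg.stronglyMeasurable.stronglyMeasurableAtFilter hg.continuousAt).const_sub _

lemma hasDerivAt_primitive {g : ℝ → ℂ} (hg : Continuous g) (y : ℝ) :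
    HasDerivAt (fun y => ∫ z in (0 : ℝ)..y, g z) (g y) y :=
  intervalIntegral.integral_hasDerivAt_right (hg.intervalIntegrable _ _)
      hg.stronglyMeasurable.stronglyMeasurableAtFilter hg.continuousAt

lemma continuous_exp_mul_bounded (a : ℝ) (q : ℝ →ᵇ ℂ) :
    Continuous fun z : ℝ => (Real.exp (a * z) : ℂ) * q z := by fun_prop

lemma continuous_primitive_exp_mul_bounded (a : ℝ) (q : ℝ →ᵇ ℂ) :
    Continuous fun y : ℝ => ∫ z in (0 : ℝ)..y, (Real.exp (a * z) : ℂ) * q z :=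
  continuous_iff_continuousAt.2 fun y =>
    (hasDerivAt_primitive (continuous_exp_mul_bounded a q) y).continuousAt

/-- The solution operator of `-b' + σ b = σ h`, bounded at infinity, conjugated by `exp (-y)`. -/
def backwardOp (σ : ℝ) (hσ : 1 < σ) : (ℝ →ᵇ ℂ) →L[ℂ] (ℝ →ᵇ ℂ) :=
  boundedOperator
    (fun q y => (σ * Real.exp ((σ + 1) * y) : ℝ) * ∫ z in Ioi y, (Real.exp (-(σ + 1) * z) : ℂ) * q z)
    (fun p q y => by
      rw [← mul_add, ← integral_add (integrableOn_exp_mul_bounded (by linarith) p y)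
        (integrableOn_exp_mul_bounded (by linarith) q y)]
      simp only [BoundedContinuousFunction.coe_add, Pi.add_apply, mul_add])
    (fun a q y => by
      simp only [BoundedContinuousFunction.coe_smul, smul_eq_mul, mul_left_comm _ a,
        integral_const_mul])
    (fun q => by
      refine Continuous.mul (by fun_prop) (continuous_iff_continuousAt.2 fun y => ?_)
      exact (hasDerivAt_integral_Ioi (continuous_exp_mul_bounded _ q)
        (integrableOn_exp_mul_bounded (by linarith) q) y).continuousAt)
    1 zero_le_one
    (fun q y => by
      rw [norm_mul, Complex.norm_real, Real.norm_of_nonneg (by positivity)]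
      refine (mul_le_mul_of_nonneg_left (norm_integral_exp_mul_bounded_le (by linarith) q y)
        (by positivity)).trans ?_
      rw [← mul_assoc]
      refine mul_le_mul_of_nonneg_right ?_ (norm_nonneg _)
      have h1 : Real.exp ((σ + 1) * y) * Real.exp (-(σ + 1) * y) = 1 := by
        rw [← Real.exp_add, ← Real.exp_zero]; congr 1; ring
      have h2 : σ * Real.exp ((σ + 1) * y) * (-Real.exp (-(σ + 1) * y) / -(σ + 1)) = σ / (σ + 1) := by
        rw [neg_div_neg_eq, ← mul_div_assoc, mul_assoc, h1, mul_one]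
      rw [h2, div_le_one (by linarith)]
      linarith)

lemma backwardOp_apply (σ : ℝ) (hσ : 1 < σ) (q : ℝ →ᵇ ℂ) (y : ℝ) : backwardOp σ hσ q y =
    (σ * Real.exp ((σ + 1) * y) : ℝ) * ∫ z in Ioi y, (Real.exp (-(σ + 1) * z) : ℂ) * q z := rfl

lemma norm_backwardOp_le (σ : ℝ) (hσ : 1 < σ) : ‖backwardOp σ hσ‖ ≤ 1 := norm_boundedOperator_le

/-- The solution operator of `a' + σ a = σ h`, `a 0 = 0`, conjugated by `exp (-y)`. -/
def forwardOp (σ : ℝ) (hσ : 1 < σ) : (ℝ →ᵇ ℂ) →L[ℂ] (ℝ →ᵇ ℂ) :=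
  boundedOperator
    -- Freezing the value for y < 0 extends the half-line formula to a bounded continuous function
    -- on ℝ.
    (fun q y => (σ * Real.exp (-(σ - 1) * max y 0) : ℝ) *
      ∫ z in (0 : ℝ)..max y 0, (Real.exp ((σ - 1) * z) : ℂ) * q z)
    (fun p q y => by
      rw [← mul_add, ← intervalIntegral.integral_add
        ((continuous_exp_mul_bounded _ p).intervalIntegrable _ _)
        ((continuous_exp_mul_bounded _ q).intervalIntegrable _ _)]
      simp only [BoundedContinuousFunction.coe_add, Pi.add_apply, mul_add])
    (fun a q y => by
      simp only [BoundedContinuousFunction.coe_smul, smul_eq_mul, mul_left_comm _ a,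
        intervalIntegral.integral_const_mul])
    (fun q => Continuous.mul (by fun_prop)
      ((continuous_primitive_exp_mul_bounded (σ - 1) q).comp (by fun_prop : Continuous fun y : ℝ => max y 0)))
    -- The weight lowers the decay rate from σ to σ - 1. The resulting norm bound still tends to 1
    -- as σ → ∞, as the later contraction requires.
    (σ / (σ - 1)) (div_nonneg (by linarith) (by linarith))
    (fun q y => by
      have hs : 0 < σ - 1 := by linarith
      rw [norm_mul, Complex.norm_real, Real.norm_of_nonneg (by positivity)]
      refine (mul_le_mul_of_nonneg_left (norm_intervalIntegral_exp_mul_bounded_le hs.ne' q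
        (le_max_right y 0)) (by positivity)).trans ?_
      rw [← mul_assoc]
      refine mul_le_mul_of_nonneg_right ?_ (norm_nonneg _)
      have h1 : Real.exp (-(σ - 1) * max y 0) * Real.exp ((σ - 1) * max y 0) = 1 := by
        rw [← Real.exp_add, ← Real.exp_zero]; congr 1; ring
      rw [← mul_div_assoc]
      have := Real.exp_pos (-(σ - 1) * max y 0)
      gcongr
      nlinarith)

lemma forwardOp_apply (σ : ℝ) (hσ : 1 < σ) (q : ℝ →ᵇ ℂ) {y : ℝ} (hy : 0 ≤ y) : forwardOp σ hσ q y =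
    (σ * Real.exp (-(σ - 1) * y) : ℝ) * ∫ z in (0 : ℝ)..y, (Real.exp ((σ - 1) * z) : ℂ) * q z := by
  change (σ * Real.exp (-(σ - 1) * max y 0) : ℝ) * (∫ z in (0 : ℝ)..max y 0, (Real.exp ((σ - 1) * z) : ℂ) * q z) = _
  rw [max_eq_left hy]

lemma norm_forwardOp_le (σ : ℝ) (hσ : 1 < σ) : ‖forwardOp σ hσ‖ ≤ σ / (σ - 1) :=
  norm_boundedOperator_le

/-- Integration from the wall against `exp (-z)`. -/
def primitiveOp : (ℝ →ᵇ ℂ) →L[ℂ] (ℝ →ᵇ ℂ) :=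
  boundedOperator
    (fun q y => ∫ z in (0 : ℝ)..max y 0, (Real.exp (-1 * z) : ℂ) * q z)
    (fun p q y => by
      rw [← intervalIntegral.integral_add
        ((continuous_exp_mul_bounded _ p).intervalIntegrable _ _)
        ((continuous_exp_mul_bounded _ q).intervalIntegrable _ _)]
      simp only [BoundedContinuousFunction.coe_add, Pi.add_apply, mul_add])
    (fun a q y => by
      rw [← intervalIntegral.integral_const_mul]
      simp only [BoundedContinuousFunction.coe_smul, smul_eq_mul, mul_left_comm])
    (fun q => (continuous_primitive_exp_mul_bounded (-1) q).comp
      (by fun_prop : Continuous fun y : ℝ => max y 0))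
    1 zero_le_one
    (fun q y => by
      refine (norm_intervalIntegral_exp_mul_bounded_le (by norm_num) q (le_max_right y 0)).trans ?_
      refine mul_le_mul_of_nonneg_right ?_ (norm_nonneg _)
      have := Real.exp_pos (-1 * max y 0)
      rw [div_neg, div_one]
      linarith)

lemma primitiveOp_apply (q : ℝ →ᵇ ℂ) {y : ℝ} (hy : 0 ≤ y) : primitiveOp q y =
    ∫ z in (0 : ℝ)..y, (Real.exp (-1 * z) : ℂ) * q z := by
  change (∫ z in (0 : ℝ)..max y 0, (Real.exp (-1 * z) : ℂ) * q z) = _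
  rw [max_eq_left hy]

lemma norm_primitiveOp_le : ‖primitiveOp‖ ≤ 1 := norm_boundedOperator_le

/-- Integration over the half-line against `exp (-z)`. -/
def totalFunctional : (ℝ →ᵇ ℂ) →L[ℂ] ℂ :=
  LinearMap.mkContinuous
    { toFun := fun q => ∫ z in Ioi (0 : ℝ), (Real.exp (-1 * z) : ℂ) * q z
      map_add' := fun p q => by
        rw [← integral_add (integrableOn_exp_mul_bounded (by norm_num) p 0)
          (integrableOn_exp_mul_bounded (by norm_num) q 0)]
        simp only [BoundedContinuousFunction.coe_add, Pi.add_apply, mul_add]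
      map_smul' := fun a q => by
        rw [RingHom.id_apply, smul_eq_mul, ← integral_const_mul]
        simp only [BoundedContinuousFunction.coe_smul, smul_eq_mul, mul_left_comm] } 1
    fun q => by
      refine (norm_integral_exp_mul_bounded_le (by norm_num) q 0).trans ?_
      simp

lemma totalFunctional_apply (q : ℝ →ᵇ ℂ) :
    totalFunctional q = ∫ z in Ioi (0 : ℝ), (Real.exp (-1 * z) : ℂ) * q z := rfl

/-- A bounded continuous function from a function bounded on `[0, ∞)`. -/
def clampedFunction (f : ℝ → ℂ) (hf : Continuous f) (K : ℝ) (hb : ∀ y, 0 ≤ y → ‖f y‖ ≤ K) : ℝ →ᵇ ℂ :=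
  BoundedContinuousFunction.ofNormedAddCommGroup (fun y => f (max y 0))
    (hf.comp (by fun_prop : Continuous fun y : ℝ => max y 0)) K fun y => hb _ (le_max_right y 0)

lemma clampedFunction_apply {f : ℝ → ℂ} {hf : Continuous f} {K : ℝ} {hb : ∀ y, 0 ≤ y → ‖f y‖ ≤ K}
    {y : ℝ} (hy : 0 ≤ y) : clampedFunction f hf K hb y = f y := by
  change f (max y 0) = f y
  rw [max_eq_left hy]

lemma norm_clampedFunction_le {f : ℝ → ℂ} {hf : Continuous f} {K : ℝ} {hb : ∀ y, 0 ≤ y → ‖f y‖ ≤ K}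
    (hK : 0 ≤ K) : ‖clampedFunction f hf K hb‖ ≤ K :=
  BoundedContinuousFunction.norm_ofNormedAddCommGroup_le _ hK fun y => hb _ (le_max_right y 0)

end BoundaryLayer

/-! ### Uniform inversion of the reduced viscous problem. -/

namespace BoundaryLayer
open scoped BoundedContinuousFunction
open Metric

/-- Composite of the two first-order solution operators. -/
def resolventOp (σ : ℝ) (hσ : 1 < σ) : (ℝ →ᵇ ℂ) →L[ℂ] (ℝ →ᵇ ℂ) := forwardOp σ hσ * backwardOp σ hσ

lemma norm_resolventOp_le (σ : ℝ) (hσ : 1 < σ) : ‖resolventOp σ hσ‖ ≤ σ / (σ - 1) := by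
  refine (norm_mul_le _ _).trans ?_
  have := norm_forwardOp_le σ hσ
  have := norm_backwardOp_le σ hσ
  have : 0 ≤ σ / (σ - 1) := div_nonneg (by linarith) (by linarith)
  calc _ ≤ σ / (σ - 1) * 1 := by gcongr
    _ = _ := mul_one _

/-- The right-hand side operator of the reduced viscous problem. -/
def viscousOp (σ : ℝ) (hσ : 1 < σ) (m : ℝ) (u a₁ a₂ a₃ : ℝ →ᵇ ℂ) (c : ℂ) :
    (ℝ →ᵇ ℂ) →L[ℂ] (ℝ →ᵇ ℂ) :=
  ContinuousLinearMap.mul ℂ (ℝ →ᵇ ℂ)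
      ((u - c • 1) - (Complex.I / m) • ((u - c • 1) * (u - c • 1))) * resolventOp σ hσ
    + ((σ : ℂ) ^ 2)⁻¹ • (ContinuousLinearMap.mul ℂ (ℝ →ᵇ ℂ) ((σ : ℂ) • a₁)
          * (backwardOp σ hσ - resolventOp σ hσ)
        + ContinuousLinearMap.mul ℂ (ℝ →ᵇ ℂ) a₂ * resolventOp σ hσ
        + ContinuousLinearMap.mul ℂ (ℝ →ᵇ ℂ) a₃ * (primitiveOp * resolventOp σ hσ))

lemma norm_mul_left_le (a : ℝ →ᵇ ℂ) : ‖ContinuousLinearMap.mul ℂ (ℝ →ᵇ ℂ) a‖ ≤ ‖a‖ :=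
  ContinuousLinearMap.opNorm_mul_apply_le ℂ (ℝ →ᵇ ℂ) a

lemma im_le_norm_ofReal_sub {c : ℂ} (r : ℝ) : c.im ≤ ‖(r : ℂ) - c‖ := by
  have := Complex.abs_im_le_norm ((r : ℂ) - c)
  simp only [Complex.sub_im, Complex.ofReal_im, zero_sub, abs_neg] at this
  exact (le_abs_self _).trans this

/-- Put s = r - c. Then Re(is) = Im c ≥ b and |s| ≤ R, so |1 - (b/R²) is|² ≤ 1 - 2b²/R² + b²/R².
Instability (Im c > 0) is what yields a strict contraction. -/
lemma norm_one_sub_rotated_le {c : ℂ} {r b R : ℝ} (hb : 0 < b) (hbc : b ≤ c.im)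
    (hR : ‖(r : ℂ) - c‖ ≤ R) :
    ‖1 - (Complex.I / (R ^ 2 / b : ℝ)) * ((r : ℂ) - c)‖ ≤ Real.sqrt (1 - b ^ 2 / R ^ 2) := by
  have hbR : b ≤ R := hbc.trans ((im_le_norm_ofReal_sub r).trans hR)
  have hRp : 0 < R := hb.trans_le hbR
  apply Real.le_sqrt_of_sq_le
  set s : ℂ := (r : ℂ) - c with hs
  have hsi : s.im = -c.im := by simp [hs]
  have e : (1 - (Complex.I / (R ^ 2 / b : ℝ)) * s) = 1 - ((b / R ^ 2 : ℝ) : ℂ) * (Complex.I * s) := by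
    have : (R : ℂ) ≠ 0 := by exact_mod_cast hRp.ne'
    have : (b : ℂ) ≠ 0 := by exact_mod_cast hb.ne'
    push_cast
    field_simp
  have h2 : s.re ^ 2 + s.im ^ 2 ≤ R ^ 2 := by
    have := pow_le_pow_left₀ (norm_nonneg _) hR 2
    rw [← Complex.normSq_eq_norm_sq, Complex.normSq_apply] at this
    linarith
  rw [e, ← Complex.normSq_eq_norm_sq, Complex.normSq_apply]
  simp only [Complex.sub_re, Complex.sub_im, Complex.one_re, Complex.one_im, Complex.re_ofReal_mul,
    Complex.im_ofReal_mul, Complex.I_mul_re, Complex.I_mul_im, hsi]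
  rw [hsi] at h2
  have h3 : (b / R ^ 2) ^ 2 * (s.re ^ 2 + (-c.im) ^ 2) ≤ (b / R ^ 2) ^ 2 * R ^ 2 := by gcongr
  have h4 : (b / R ^ 2) ^ 2 * R ^ 2 = b ^ 2 / R ^ 2 := by field_simp
  have h5 : b / R ^ 2 * b ≤ b / R ^ 2 * c.im := by gcongr
  have h6 : b / R ^ 2 * b = b ^ 2 / R ^ 2 := by ring
  nlinarith

/-- Division by U - c, whose modulus is at least Im c ≥ b, turns the leading part of `viscousOp`
into a multiplier of norm at most q₀ after the resolvent. The rest is O(1/σ), so half of the gap 1 -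
q₀ survives. -/
lemma exists_reduced_factor {u a₁ a₂ a₃ : ℝ →ᵇ ℂ} (hu : ∀ y, ∃ r : ℝ, 0 ≤ r ∧ r ≤ 1 ∧ u y = r)
    {K : ℝ} (hK : 0 ≤ K) (h₁ : ‖a₁‖ ≤ K) (h₂ : ‖a₂‖ ≤ K) (h₃ : ‖a₃‖ ≤ K) {c : ℂ} {b R m q₀ : ℝ}
    (hb : 0 < b) (hbc : b ≤ c.im) (hsR : ∀ r : ℝ, 0 ≤ r → r ≤ 1 → ‖(r : ℂ) - c‖ ≤ R)
    (hm : m = R ^ 2 / b) (hq₀ : q₀ = Real.sqrt (1 - b ^ 2 / R ^ 2)) (hq₀1 : q₀ < 1) {σ : ℝ}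
    (hσ : 1 < σ) (hσ2 : 2 ≤ σ) (hσL : 2 * (2 + 7 * K / b) ≤ σ * (1 - q₀)) :
    ∃ r : ℝ →ᵇ ℂ, ‖r‖ ≤ b⁻¹ ∧ r * (u - c • 1) = 1 ∧
      ‖ContinuousLinearMap.mul ℂ (ℝ →ᵇ ℂ) r * viscousOp σ hσ m u a₁ a₂ a₃ c‖ ≤ (1 + q₀) / 2 := by
  have hq₀0 : 0 ≤ q₀ := by rw [hq₀]; exact Real.sqrt_nonneg _
  set L : ℝ := 2 + 7 * K / b with hL
  have hne : ∀ y, u y - c ≠ 0 := fun y => by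
    obtain ⟨s, -, -, hs⟩ := hu y
    rw [hs]; exact sub_ne_zero_of_im_pos (hb.trans_le hbc) s
  set r : ℝ →ᵇ ℂ := BoundedContinuousFunction.ofNormedAddCommGroup (fun y => (u y - c)⁻¹)
    (Continuous.inv₀ (by fun_prop) hne) b⁻¹ (fun y => by
      obtain ⟨s, -, -, hs⟩ := hu y
      rw [hs, norm_inv]
      exact inv_anti₀ hb (hbc.trans (im_le_norm_ofReal_sub s))) with hr
  have hrn : ‖r‖ ≤ b⁻¹ := BoundedContinuousFunction.norm_ofNormedAddCommGroup_le _ (by positivity) _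
  have hr1 : r * (u - c • 1) = 1 := by
    ext y
    simp [hr, hne y]
  refine ⟨r, hrn, hr1, ?_⟩
  have e1 : r * ((u - c • 1) - (Complex.I / m) • ((u - c • 1) * (u - c • 1))) =
      1 - (Complex.I / m) • (u - c • 1) := by
    rw [mul_sub, hr1, mul_smul_comm, ← mul_assoc, hr1, one_mul]
  have n1 : ‖(1 : ℝ →ᵇ ℂ) - (Complex.I / m) • (u - c • 1)‖ ≤ q₀ := by
    rw [BoundedContinuousFunction.norm_le hq₀0]
    intro y
    obtain ⟨s, hs0, hs1, hs⟩ := hu y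
    have := norm_one_sub_rotated_le hb hbc (hsR s hs0 hs1)
    simpa [hs, smul_eq_mul, hm, hq₀] using this
  have hJ := norm_resolventOp_le σ hσ
  have hB := norm_backwardOp_le σ hσ
  have hI := norm_primitiveOp_le
  have hσ1 : 0 < σ - 1 := by linarith
  have hJ2 : σ / (σ - 1) ≤ 1 + 2 / σ := by
    rw [div_le_iff₀ hσ1]
    field_simp
    nlinarith
  have hJ3 : σ / (σ - 1) ≤ 2 := by
    rw [div_le_iff₀ hσ1]; linarith
  have hσp : 0 < σ := by linarith
  have e2 : ContinuousLinearMap.mul ℂ (ℝ →ᵇ ℂ) r * viscousOp σ hσ m u a₁ a₂ a₃ c =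
      ContinuousLinearMap.mul ℂ (ℝ →ᵇ ℂ) (1 - (Complex.I / m) • (u - c • 1)) * resolventOp σ hσ
      + ContinuousLinearMap.mul ℂ (ℝ →ᵇ ℂ) r * (((σ : ℂ) ^ 2)⁻¹ •
      (ContinuousLinearMap.mul ℂ (ℝ →ᵇ ℂ) ((σ : ℂ) • a₁)
        * (backwardOp σ hσ - resolventOp σ hσ)
      + ContinuousLinearMap.mul ℂ (ℝ →ᵇ ℂ) a₂ * resolventOp σ hσ
      + ContinuousLinearMap.mul ℂ (ℝ →ᵇ ℂ) a₃ * (primitiveOp * resolventOp σ hσ))) := by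
    rw [viscousOp, mul_add, ← e1]
    congr 1
    ext1 q
    simp only [ContinuousLinearMap.mul_apply', mul_apply_eq_comp]
    rw [mul_assoc]
  rw [e2]
  have t1 : ‖ContinuousLinearMap.mul ℂ (ℝ →ᵇ ℂ) (1 - (Complex.I / m) • (u - c • 1)) *
      resolventOp σ hσ‖ ≤ q₀ * (1 + 2 / σ) :=
    (norm_mul_le _ _).trans (mul_le_mul ((norm_mul_left_le _).trans n1) (hJ.trans hJ2)
      (norm_nonneg _) hq₀0)
  have t2 : ‖ContinuousLinearMap.mul ℂ (ℝ →ᵇ ℂ) ((σ : ℂ) • a₁)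
        * (backwardOp σ hσ - resolventOp σ hσ)‖ ≤ (σ * K) * 3 := by
    refine (norm_mul_le _ _).trans (mul_le_mul ((norm_mul_left_le _).trans ?_)
      ((norm_sub_le _ _).trans (by linarith)) (norm_nonneg _) (by positivity))
    rw [norm_smul, Complex.norm_real, Real.norm_of_nonneg hσp.le]
    gcongr
  have t3 : ‖ContinuousLinearMap.mul ℂ (ℝ →ᵇ ℂ) a₂ * resolventOp σ hσ‖ ≤ K * 2 :=
    (norm_mul_le _ _).trans (mul_le_mul ((norm_mul_left_le _).trans h₂) (hJ.trans hJ3)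
      (norm_nonneg _) hK)
  have t4 : ‖ContinuousLinearMap.mul ℂ (ℝ →ᵇ ℂ) a₃ * (primitiveOp * resolventOp σ hσ)‖ ≤ K * (1 * 2) :=
    (norm_mul_le _ _).trans (mul_le_mul ((norm_mul_left_le _).trans h₃)
      ((norm_mul_le _ _).trans (mul_le_mul hI (hJ.trans hJ3) (norm_nonneg _) zero_le_one))
      (norm_nonneg _) hK)
  have t5 : ‖ContinuousLinearMap.mul ℂ (ℝ →ᵇ ℂ) r * (((σ : ℂ) ^ 2)⁻¹ •
      (ContinuousLinearMap.mul ℂ (ℝ →ᵇ ℂ) ((σ : ℂ) • a₁)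
        * (backwardOp σ hσ - resolventOp σ hσ)
      + ContinuousLinearMap.mul ℂ (ℝ →ᵇ ℂ) a₂ * resolventOp σ hσ
      + ContinuousLinearMap.mul ℂ (ℝ →ᵇ ℂ) a₃ * (primitiveOp * resolventOp σ hσ)))‖ ≤
      b⁻¹ * ((σ ^ 2)⁻¹ * ((σ * K) * 3 + K * 2 + K * (1 * 2))) := by
    refine (norm_mul_le _ _).trans (mul_le_mul ((norm_mul_left_le _).trans hrn) ?_ (norm_nonneg _)
      (by positivity))
    rw [norm_smul, norm_inv, norm_pow, Complex.norm_real, Real.norm_of_nonneg hσp.le]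
    gcongr
    exact (norm_add₃_le).trans (by gcongr)
  refine (norm_add_le _ _).trans ((add_le_add t1 t5).trans ?_)
  -- The lower-order terms total 3σK + 4K ≤ 7σK. With the excess 2/σ of the resolvent norm they
  -- amount to L/σ.
  have h7 : b⁻¹ * ((σ ^ 2)⁻¹ * ((σ * K) * 3 + K * 2 + K * (1 * 2))) ≤ (7 * K / b) / σ := by
    have : (σ * K) * 3 + K * 2 + K * (1 * 2) ≤ σ * (7 * K) := by nlinarith
    calc b⁻¹ * ((σ ^ 2)⁻¹ * ((σ * K) * 3 + K * 2 + K * (1 * 2)))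
        ≤ b⁻¹ * ((σ ^ 2)⁻¹ * (σ * (7 * K))) := by gcongr
      _ = _ := by field_simp
  have h8 : q₀ * (1 + 2 / σ) ≤ q₀ + 2 / σ := by
    have : 0 ≤ 2 / σ := by positivity
    nlinarith
  have h9 : L / σ ≤ (1 - q₀) / 2 := by
    rw [div_le_iff₀ hσp]; linarith
  have h10 : L / σ = 2 / σ + (7 * K / b) / σ := by rw [hL]; ring
  linarith

/-- Uniform invertibility of the reduced viscous problem, holomorphically in the phase speed. -/
theorem exists_reduced_solution {u a₁ a₂ a₃ : ℝ →ᵇ ℂ} (hu : ∀ y, ∃ r : ℝ, 0 ≤ r ∧ r ≤ 1 ∧ u y = r)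
    {K : ℝ} (h₁ : ‖a₁‖ ≤ K) (h₂ : ‖a₂‖ ≤ K) (h₃ : ‖a₃‖ ≤ K) {c₀ : ℂ} {b : ℝ} (hb : 0 < b)
    (hc₀ : c₀.im = 2 * b) :
    ∃ m : ℝ, 0 < m ∧ ∃ σ₀ K' : ℝ, 2 ≤ σ₀ ∧ 0 ≤ K' ∧ ∀ (σ : ℝ) (hσ : 1 < σ), σ₀ ≤ σ →
      ∀ (g : ℂ → (ℝ →ᵇ ℂ)) (G : ℝ), DifferentiableOn ℂ g (ball c₀ b) →
        (∀ c ∈ ball c₀ b, ‖g c‖ ≤ G) →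
        ∃ q : ℂ → (ℝ →ᵇ ℂ), DifferentiableOn ℂ q (ball c₀ b) ∧ ∀ c ∈ ball c₀ b,
          ‖q c‖ ≤ K' * G ∧ (u - c • 1) * q c = g c + viscousOp σ hσ m u a₁ a₂ a₃ c (q c) := by
  have hK : 0 ≤ K := (norm_nonneg _).trans h₁
  set R : ℝ := 1 + ‖c₀‖ + b with hR
  have hRp : 0 < R := by positivity
  have hbR : b < R := by
    have : 0 ≤ ‖c₀‖ := norm_nonneg _
    rw [hR]; linarith
  set q₀ := Real.sqrt (1 - b ^ 2 / R ^ 2) with hq₀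
  have hq₀1 : q₀ < 1 := by
    rw [hq₀, Real.sqrt_lt' one_pos]
    have : 0 < b ^ 2 / R ^ 2 := by positivity
    linarith
  have hq₀0 : 0 ≤ q₀ := Real.sqrt_nonneg _
  -- This value minimises 1 - 2b/m + R²/m², the bound for |1 - (i/m)(r - c)|².
  set m : ℝ := R ^ 2 / b with hm
  have hmp : 0 < m := by positivity
  set L : ℝ := 2 + 7 * K / b with hL
  have hLp : 0 < L := by positivity
  refine ⟨m, hmp, max 2 (2 * L / (1 - q₀)), (1 - (1 + q₀) / 2)⁻¹ * b⁻¹, le_max_left _ _, ?_, ?_⟩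
  · have : 0 < 1 - (1 + q₀) / 2 := by linarith
    positivity
  intro σ hσ hσ0 g G hg hG
  have hσ2 : 2 ≤ σ := (le_max_left _ _).trans hσ0
  have hσL : 2 * L ≤ σ * (1 - q₀) := by
    have := (le_max_right _ _).trans hσ0
    rwa [div_le_iff₀ (by linarith)] at this
  have him : ∀ c ∈ ball c₀ b, b ≤ c.im := by
    intro c hc
    have h1 := Complex.abs_im_le_norm (c - c₀)
    have h2 : ‖c - c₀‖ < b := by simpa [dist_eq_norm] using hc
    rw [Complex.sub_im, hc₀, abs_le] at h1
    linarith [h1.1]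
  have hsR : ∀ c ∈ ball c₀ b, ∀ r : ℝ, 0 ≤ r → r ≤ 1 → ‖(r : ℂ) - c‖ ≤ R := by
    intro c hc r h0 h1
    have h2 : ‖c - c₀‖ < b := by simpa [dist_eq_norm] using hc
    have h3 : ‖(r : ℂ)‖ ≤ 1 := by rw [Complex.norm_real, Real.norm_of_nonneg h0]; exact h1
    calc ‖(r : ℂ) - c‖ = ‖(r : ℂ) - c₀ - (c - c₀)‖ := by congr 1; ring
      _ ≤ ‖(r : ℂ)‖ + ‖c₀‖ + ‖c - c₀‖ := (norm_sub_le _ _).trans (by gcongr; exact norm_sub_le _ _)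
      _ ≤ R := by rw [hR]; linarith
  set 𝓛 : ℂ → (ℝ →ᵇ ℂ) →L[ℂ] (ℝ →ᵇ ℂ) := fun c =>
    ContinuousLinearMap.mul ℂ (ℝ →ᵇ ℂ) (u - c • 1) - viscousOp σ hσ m u a₁ a₂ a₃ c with h𝓛
  have h𝓛d : Differentiable ℂ 𝓛 := by
    intro c
    simp only [h𝓛, viscousOp]
    fun_prop
  have hfac : ∀ c ∈ ball c₀ b, ∃ r : ℝ →ᵇ ℂ, ‖r‖ ≤ b⁻¹ ∧ r * (u - c • 1) = 1 ∧
      ‖ContinuousLinearMap.mul ℂ (ℝ →ᵇ ℂ) r * viscousOp σ hσ m u a₁ a₂ a₃ c‖ ≤ (1 + q₀) / 2 :=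
    fun c hc => exists_reduced_factor hu hK h₁ h₂ h₃ hb (him c hc) (hsR c hc) hm hq₀ hq₀1 hσ hσ2 hσL
  have hunit : ∀ c ∈ ball c₀ b, IsUnit (𝓛 c) := by
    intro c hc
    obtain ⟨r, -, hr1, hrn⟩ := hfac c hc
    have f : 𝓛 c = ContinuousLinearMap.mul ℂ (ℝ →ᵇ ℂ) (u - c • 1) *
        (1 - ContinuousLinearMap.mul ℂ (ℝ →ᵇ ℂ) r * viscousOp σ hσ m u a₁ a₂ a₃ c) := by
      rw [mul_sub, mul_one]
      simp only [h𝓛]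
      congr 1
      ext1 q
      simp only [ContinuousLinearMap.mul_apply', mul_apply_eq_comp]
      rw [← mul_assoc, mul_comm _ r, hr1, one_mul]
    rw [f]
    refine IsUnit.mul ?_ (isUnit_one_sub_of_norm_lt_one (hrn.trans_lt (by linarith)))
    refine ⟨⟨_, ContinuousLinearMap.mul ℂ (ℝ →ᵇ ℂ) r, ?_, ?_⟩, rfl⟩
    · ext1 q
      simp only [ContinuousLinearMap.mul_apply', mul_apply_eq_comp]
      rw [← mul_assoc, mul_comm _ r, hr1, one_mul]; rfl
    · ext1 q
      simp only [ContinuousLinearMap.mul_apply', mul_apply_eq_comp]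
      rw [← mul_assoc, hr1, one_mul]; rfl
  -- 𝓛 is polynomial in c and invertible on the ball, so its inverse is holomorphic there. The norm
  -- bound comes from the contraction and does not depend on σ.
  refine ⟨fun c => Ring.inverse (𝓛 c) (g c), fun c hc => ?_, fun c hc => ?_⟩
  · exact ((h𝓛d c).inverse (hunit c hc)).differentiableWithinAt.clm_apply (hg c hc)
  · obtain ⟨r, hrb, hr1, hrn⟩ := hfac c hc
    set q := Ring.inverse (𝓛 c) (g c) with hq
    have heq : 𝓛 c q = g c := by
      rw [hq, ← mul_apply_eq_comp, Ring.mul_inverse_cancel _ (hunit c hc)]; rfl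
    have heq2 : (u - c • 1) * q = g c + viscousOp σ hσ m u a₁ a₂ a₃ c q := by
      rw [← heq]
      exact (sub_add_cancel ((u - c • 1) * q) (viscousOp σ hσ m u a₁ a₂ a₃ c q)).symm
    refine ⟨?_, heq2⟩
    have h5 : q = r * g c + (ContinuousLinearMap.mul ℂ (ℝ →ᵇ ℂ) r * viscousOp σ hσ m u a₁ a₂ a₃ c) q := by
      have := congrArg (fun z => r * z) heq2
      simp only [← mul_assoc, hr1, one_mul] at this
      rw [mul_add] at this
      exact this
    have h6 : ‖q‖ ≤ b⁻¹ * G + (1 + q₀) / 2 * ‖q‖ := by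
      conv_lhs => rw [h5]
      refine (norm_add_le _ _).trans (add_le_add ((norm_mul_le _ _).trans ?_)
        ((ContinuousLinearMap.le_opNorm _ _).trans (by gcongr)))
      have := hG c hc
      gcongr
    have h7 : 0 < 1 - (1 + q₀) / 2 := by linarith
    rw [mul_assoc, ← div_eq_inv_mul, le_div_iff₀ h7]
    linarith

end BoundaryLayer

/-! ### The viscous problem for w, with its boundary condition. -/

namespace BoundaryLayer
open scoped BoundedContinuousFunction
open Metric

/-- A solution of the viscous mode problem in the variable `w = (φ / (U - c))' - const`, together
with its first-order factor `p` and its resolvent datum `h`. -/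
structure ViscousSolution (U U₁ U₂ U₃ : ℝ → ℝ) (σ m : ℝ) (c : ℂ) (K : ℝ) (w p h W : ℝ → ℂ) : Prop where
  continuous_h : Continuous h
  hasDerivAt_w : ∀ y, HasDerivAt w (σ * (p y - w y)) y
  hasDerivAt_p : ∀ y, HasDerivAt p (σ * (p y - h y)) y
  hasDerivAt_W : ∀ y, HasDerivAt W (w y) y
  w_zero : w 0 = -1
  W_zero : W 0 = 0
  -- Here w' = σ(p - w) and w'' = σ²(w - h). With φ = (U - c)(y + W)/(1 - c) and σ² = mk, this is
  -- the mode equation multiplied by (1 - c) i/m; the inviscid terms U₁(y + W) cancel.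
  equation : ∀ y, 0 ≤ y → ((U y : ℂ) - c) * h y =
    ((U y : ℂ) - c) * w y - (Complex.I / m) * ((U y : ℂ) - c) ^ 2 * w y
      + ((σ : ℂ) ^ 2)⁻¹ * (3 * U₁ y * (σ * (p y - w y)) + 3 * U₂ y * w y + U₃ y * W y)
      + (Complex.I / m) * ((1 - U y) * (1 + U y - 2 * c)
          - (Complex.I * m / (σ : ℂ) ^ 2) * (3 * U₂ y + y * U₃ y))
  bound_w : ∀ y, 0 ≤ y → ‖w y‖ ≤ K * Real.exp (-y)
  bound_p : ∀ y, 0 ≤ y → ‖p y‖ ≤ K * Real.exp (-y)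
  bound_W : ∀ y, 0 ≤ y → ‖W y‖ ≤ K

lemma DecayingProfile.nonneg_const {U U₁ U₂ U₃ : ℝ → ℝ} {C : ℝ} (hU : DecayingProfile U U₁ U₂ U₃ C) :
    0 ≤ C := by
  have := (abs_nonneg _).trans (hU.bound₁ 0 le_rfl)
  simpa using this

lemma DecayingProfile.contDiff {U U₁ U₂ U₃ : ℝ → ℝ} {C : ℝ} (hU : DecayingProfile U U₁ U₂ U₃ C) :
    ContDiff ℝ ∞ U ∧ ContDiff ℝ ∞ U₁ ∧ ContDiff ℝ ∞ U₂ ∧ ContDiff ℝ ∞ U₃ := by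
  have h1 : ContDiff ℝ ∞ U₁ := by
    rw [← funext fun y => (hU.hasDerivAt y).deriv]; exact (contDiff_infty_iff_deriv.1 hU.smooth).2
  have h2 : ContDiff ℝ ∞ U₂ := by
    rw [← funext fun y => (hU.hasDerivAt₁ y).deriv]; exact (contDiff_infty_iff_deriv.1 h1).2
  have h3 : ContDiff ℝ ∞ U₃ := by
    rw [← funext fun y => (hU.hasDerivAt₂ y).deriv]; exact (contDiff_infty_iff_deriv.1 h2).2
  exact ⟨hU.smooth, h1, h2, h3⟩

lemma DecayingProfile.continuous {U U₁ U₂ U₃ : ℝ → ℝ} {C : ℝ} (hU : DecayingProfile U U₁ U₂ U₃ C) :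
    Continuous U ∧ Continuous U₁ ∧ Continuous U₂ ∧ Continuous U₃ :=
  ⟨hU.contDiff.1.continuous, hU.contDiff.2.1.continuous, hU.contDiff.2.2.1.continuous,
    hU.contDiff.2.2.2.continuous⟩

/-- Reconstruction of the physical solution from the reduced unknown. -/
lemma viscousSolution_of_reduced {U U₁ U₂ U₃ : ℝ → ℝ} {σ m : ℝ} {c : ℂ} (hσ : 1 < σ)
    (q e₀ : ℝ →ᵇ ℂ) (he₀ : ∀ y, 0 ≤ y → e₀ y = Real.exp (-(σ - 1) * y)) {K : ℝ}
    (hK : ‖resolventOp σ hσ q - e₀‖ ≤ K) (hK' : ‖backwardOp σ hσ q‖ ≤ K)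
    (heq : ∀ y, 0 ≤ y → ((U y : ℂ) - c) * q y =
      ((U y : ℂ) - c) * (resolventOp σ hσ q - e₀) y
        - (Complex.I / m) * ((U y : ℂ) - c) ^ 2 * (resolventOp σ hσ q - e₀) y
      + ((σ : ℂ) ^ 2)⁻¹ * (3 * U₁ y * (σ * (backwardOp σ hσ q y - (resolventOp σ hσ q - e₀) y))
        + 3 * U₂ y * (resolventOp σ hσ q - e₀) y
        + (Real.exp y * U₃ y : ℝ) * primitiveOp (resolventOp σ hσ q - e₀) y)
      + (Complex.I / m) * (Real.exp y : ℂ) * ((1 - U y) * (1 + U y - 2 * c)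
          - (Complex.I * m / (σ : ℂ) ^ 2) * (3 * U₂ y + y * U₃ y))) :
    ∃ w p h W, ViscousSolution U U₁ U₂ U₃ σ m c K w p h W ∧
      ∫ y in Ioi (0 : ℝ), w y = totalFunctional (resolventOp σ hσ q - e₀) := by
  set v := resolventOp σ hσ q - e₀ with hv
  set P := backwardOp σ hσ q with hP
  have ee : ∀ a b : ℝ, (Real.exp a : ℂ) * (Real.exp b : ℂ) = (Real.exp (a + b) : ℂ) := fun a b => by
    rw [Real.exp_add, Complex.ofReal_mul]
  -- The integrated formula is differentiable on all of ℝ and agrees with exp(-y) v for y ≥ 0. The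
  -- constant -1 gives w(0) = -1.
  set w : ℝ → ℂ := fun y => (Real.exp (-σ * y) : ℂ) *
    (σ * (∫ z in (0 : ℝ)..y, (Real.exp ((σ - 1) * z) : ℂ) * P z) - 1) with hw
  set p : ℝ → ℂ := fun y => (Real.exp (-y) : ℂ) * P y with hp
  set h : ℝ → ℂ := fun y => (Real.exp (-y) : ℂ) * q y with hh
  have hexpd : ∀ a y : ℝ, HasDerivAt (fun y : ℝ => (Real.exp (a * y) : ℂ)) (a * Real.exp (a * y) : ℝ) y :=
    fun a y => by
      have := (((hasDerivAt_id' y).const_mul a).exp).ofReal_comp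
      exact this.congr_deriv (by push_cast; ring)
  have hwv : ∀ y, 0 ≤ y → w y = (Real.exp (-y) : ℂ) * v y := by
    intro y hy
    have hv' : v y = forwardOp σ hσ P y - e₀ y := rfl
    rw [hv', forwardOp_apply σ hσ _ hy, he₀ y hy, mul_sub, Complex.ofReal_mul, ee, mul_assoc,
      mul_left_comm (Real.exp (-y) : ℂ), ← mul_assoc (Real.exp (-y) : ℂ), ee]
    simp only [hw]
    have : -y + -(σ - 1) * y = -σ * y := by ring
    rw [this]
    ring
  have hwd : ∀ y, HasDerivAt w (σ * (p y - w y)) y := by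
    intro y
    have := (hexpd (-σ) y).fun_mul (((hasDerivAt_primitive (continuous_exp_mul_bounded (σ - 1) P) y).const_mul
      (σ : ℂ)).sub_const 1)
    refine this.congr_deriv ?_
    have e : (Real.exp (-y) : ℂ) = (Real.exp (-σ * y) : ℂ) * (Real.exp ((σ - 1) * y) : ℂ) := by
      rw [ee]; congr 2; ring
    simp only [hw, hp, e]
    push_cast
    ring
  have hpd : ∀ y, HasDerivAt p (σ * (p y - h y)) y := by
    intro y
    have h1 : p = fun y => (σ : ℂ) * ((Real.exp (σ * y) : ℂ) *
        ∫ z in Ioi y, (Real.exp (-(σ + 1) * z) : ℂ) * q z) := by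
      ext y
      simp only [hp, hP]
      rw [backwardOp_apply, Complex.ofReal_mul, mul_assoc, mul_left_comm (Real.exp (-y) : ℂ),
        ← mul_assoc (Real.exp (-y) : ℂ), ee, show -y + (σ + 1) * y = σ * y by ring]
    have h2 := ((hexpd σ y).fun_mul (hasDerivAt_integral_Ioi (continuous_exp_mul_bounded (-(σ + 1)) q)
      (integrableOn_exp_mul_bounded (by linarith) q) y)).const_mul (σ : ℂ)
    rw [← h1] at h2
    refine h2.congr_deriv ?_
    rw [h1]
    have e : (Real.exp (-y) : ℂ) = (Real.exp (σ * y) : ℂ) * (Real.exp (-(σ + 1) * y) : ℂ) := by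
      rw [ee]; congr 2; ring
    simp only [hh, e]
    push_cast
    ring
  have hwc : Continuous w := continuous_iff_continuousAt.2 fun y => (hwd y).continuousAt
  set W : ℝ → ℂ := fun y => ∫ z in (0 : ℝ)..y, w z with hW
  have hWI : ∀ y, 0 ≤ y → W y = primitiveOp v y := by
    intro y hy
    rw [primitiveOp_apply _ hy]
    refine intervalIntegral.integral_congr fun z hz => ?_
    rw [uIcc_of_le hy] at hz
    simp only [hwv z hz.1, neg_mul, one_mul]
  have hexp0 : ∀ y : ℝ, ‖(Real.exp (-y) : ℂ)‖ = Real.exp (-y) := fun y => by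
    rw [Complex.norm_real, Real.norm_of_nonneg (Real.exp_nonneg _)]
  refine ⟨w, p, h, W,
    { continuous_h := by simp only [hh]; fun_prop
      hasDerivAt_w := hwd
      hasDerivAt_p := hpd
      hasDerivAt_W := fun y => hasDerivAt_primitive hwc y
      w_zero := by simp [hw]
      W_zero := by simp [hW]
      equation := fun y hy => ?_
      bound_w := fun y hy => ?_
      bound_p := fun y hy => ?_
      bound_W := fun y hy => ?_ }, ?_⟩
  · have h1 := heq y hy
    have e1 : (Real.exp (-y) : ℂ) * (Real.exp y : ℂ) = 1 := by rw [ee]; simp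
    rw [hwv y hy, hWI y hy]
    simp only [hh, hp]
    set E := (Real.exp (-y) : ℂ)
    rw [Complex.ofReal_mul] at h1
    linear_combination E * h1 + ((σ : ℂ) ^ 2)⁻¹ * (U₃ y * primitiveOp v y) * e1 +
      (Complex.I / m) * ((1 - U y) * (1 + U y - 2 * c)
          - (Complex.I * m / (σ : ℂ) ^ 2) * (3 * U₂ y + y * U₃ y)) * e1
  · rw [hwv y hy, norm_mul, hexp0, mul_comm]
    gcongr
    exact (v.norm_coe_le_norm y).trans hK
  · simp only [hp]
    rw [norm_mul, hexp0, mul_comm]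
    gcongr
    exact (P.norm_coe_le_norm y).trans hK'
  · rw [hWI y hy]
    refine ((primitiveOp v).norm_coe_le_norm y).trans ((ContinuousLinearMap.le_opNorm _ _).trans ?_)
    have := norm_primitiveOp_le
    nlinarith [norm_nonneg v]
  · rw [totalFunctional_apply]
    refine setIntegral_congr_fun measurableSet_Ioi fun y hy => ?_
    simp only [hwv y (le_of_lt hy), neg_mul, one_mul]

/-- Solvability of the viscous mode problem, holomorphic in the phase speed and uniform for small
viscosity. -/
theorem exists_viscousSolution {U U₁ U₂ U₃ : ℝ → ℝ} {C : ℝ} (hU : DecayingProfile U U₁ U₂ U₃ C)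
    {c₀ : ℂ} {b : ℝ} (hb : 0 < b) (hc₀ : c₀.im = 2 * b) :
    ∃ m : ℝ, 0 < m ∧ ∃ σ₀ K : ℝ, 2 ≤ σ₀ ∧ 0 ≤ K ∧ ∀ σ : ℝ, σ₀ ≤ σ →
      ∃ F : ℂ → ℂ, DifferentiableOn ℂ F (ball c₀ b) ∧ ∀ c ∈ ball c₀ b,
        ∃ w p h W, ViscousSolution U U₁ U₂ U₃ σ m c K w p h W ∧ ∫ y in Ioi (0 : ℝ), w y = F c := by
  obtain ⟨hc, hc1, hc2, hc3⟩ := hU.continuous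
  have hC := hU.nonneg_const
  have hexp2 : ∀ y : ℝ, 0 ≤ y → Real.exp y * (C * Real.exp (-(2 * y))) = C * Real.exp (-y) := by
    intro y _
    rw [mul_left_comm, ← Real.exp_add]; congr 2; ring
  have hexp1 : ∀ y : ℝ, 0 ≤ y → Real.exp (-y) ≤ 1 := fun y hy => by simpa using hy
  have hexp3 : ∀ y : ℝ, 0 ≤ y → Real.exp (-(2 * y)) ≤ 1 := fun y hy => by simpa using hy
  have hVn : ∀ y, 0 ≤ y → |1 - U y| ≤ C * Real.exp (-(2 * y)) := fun y hy => by
    rw [abs_of_pos (by linarith [hU.lt_one y])]; exact hU.defect_le y hy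
  -- weighted coefficients
  have cw : ∀ f : ℝ → ℝ, (∀ y, 0 ≤ y → |f y| ≤ C * Real.exp (-(2 * y))) → ∀ y, 0 ≤ y →
      |Real.exp y * f y| ≤ C * Real.exp (-y) := by
    intro f hf y hy
    rw [abs_mul, abs_of_pos (Real.exp_pos _), ← hexp2 y hy]
    exact mul_le_mul_of_nonneg_left (hf y hy) (Real.exp_nonneg _)
  set u := clampedFunction (fun y => (U y : ℂ)) (by fun_prop) 1 (fun y hy => by
    rw [Complex.norm_real, Real.norm_of_nonneg (hU.nonneg y hy)]; exact (hU.lt_one y).le) with hu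
  set a₁ := clampedFunction (fun y => ((3 * U₁ y : ℝ) : ℂ)) (by fun_prop) (4 * C) (fun y hy => by
    rw [Complex.norm_real, Real.norm_eq_abs, abs_mul, abs_of_pos (by norm_num : (0:ℝ) < 3)]
    have := (hU.bound₁ y hy).trans (mul_le_of_le_one_right hC (hexp3 y hy))
    linarith) with ha₁
  set a₂ := clampedFunction (fun y => ((3 * U₂ y : ℝ) : ℂ)) (by fun_prop) (4 * C) (fun y hy => by
    rw [Complex.norm_real, Real.norm_eq_abs, abs_mul, abs_of_pos (by norm_num : (0:ℝ) < 3)]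
    have := (hU.bound₂ y hy).trans (mul_le_of_le_one_right hC (hexp3 y hy))
    linarith) with ha₂
  -- W is bounded but does not decay, so U₃ alone must absorb the weight exp(y). Decay of the
  -- profile faster than exp(-y) is used here.
  set a₃ := clampedFunction (fun y => ((Real.exp y * U₃ y : ℝ) : ℂ)) (by fun_prop) (4 * C)
    (fun y hy => by
      rw [Complex.norm_real, Real.norm_eq_abs]
      have := (cw U₃ hU.bound₃ y hy).trans (mul_le_of_le_one_right hC (hexp1 y hy))
      linarith) with ha₃
  set p₀ := clampedFunction (fun y => ((Real.exp y * (1 - U y) * (1 + U y) : ℝ) : ℂ)) (by fun_prop)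
    (4 * C) (fun y hy => by
      rw [Complex.norm_real, Real.norm_eq_abs, abs_mul]
      have h1 := (cw _ hVn y hy).trans (mul_le_of_le_one_right hC (hexp1 y hy))
      have h2 : |1 + U y| ≤ 2 := by
        rw [abs_le]; constructor <;> linarith [hU.nonneg y hy, hU.lt_one y]
      have := mul_le_mul h1 h2 (abs_nonneg _) hC
      linarith) with hp₀
  set p₁ := clampedFunction (fun y => ((2 * (Real.exp y * (1 - U y)) : ℝ) : ℂ)) (by fun_prop)
    (4 * C) (fun y hy => by
      rw [Complex.norm_real, Real.norm_eq_abs, abs_mul, abs_of_pos (by norm_num : (0:ℝ) < 2)]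
      have h1 := (cw _ hVn y hy).trans (mul_le_of_le_one_right hC (hexp1 y hy))
      linarith) with hp₁
  set p₂ := clampedFunction (fun y => ((Real.exp y * (3 * U₂ y + y * U₃ y) : ℝ) : ℂ)) (by fun_prop)
    (4 * C) (fun y hy => by
      rw [Complex.norm_real, Real.norm_eq_abs, mul_add]
      have h2 := (cw U₂ hU.bound₂ y hy).trans (mul_le_of_le_one_right hC (hexp1 y hy))
      have h3 := cw U₃ hU.bound₃ y hy
      have h4 : y * Real.exp (-y) ≤ 1 := by
        have : y ≤ Real.exp y := by linarith [Real.add_one_le_exp y]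
        calc y * Real.exp (-y) ≤ Real.exp y * Real.exp (-y) := by gcongr
          _ = 1 := by rw [← Real.exp_add]; simp
      have h5 : |Real.exp y * (3 * U₂ y)| = 3 * |Real.exp y * U₂ y| := by
        rw [mul_left_comm, abs_mul, abs_of_pos (by norm_num : (0:ℝ) < 3)]
      have h6 : |Real.exp y * (y * U₃ y)| = y * |Real.exp y * U₃ y| := by
        rw [mul_left_comm, abs_mul, abs_of_nonneg hy]
      refine (abs_add_le _ _).trans ?_
      rw [h5, h6]
      have h7 : y * |Real.exp y * U₃ y| ≤ C := by
        calc y * |Real.exp y * U₃ y| ≤ y * (C * Real.exp (-y)) := by gcongr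
          _ = C * (y * Real.exp (-y)) := by ring
          _ ≤ C := mul_le_of_le_one_right hC h4
      linarith) with hp₂
  have n4 : (0 : ℝ) ≤ 4 * C := by positivity
  have nu : ‖u‖ ≤ 1 := norm_clampedFunction_le zero_le_one
  have n1 : ‖a₁‖ ≤ 4 * C := norm_clampedFunction_le n4
  have n2 : ‖a₂‖ ≤ 4 * C := norm_clampedFunction_le n4
  have n3 : ‖a₃‖ ≤ 4 * C := norm_clampedFunction_le n4
  have np0 : ‖p₀‖ ≤ 4 * C := norm_clampedFunction_le n4
  have np1 : ‖p₁‖ ≤ 4 * C := norm_clampedFunction_le n4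
  have np2 : ‖p₂‖ ≤ 4 * C := norm_clampedFunction_le n4
  obtain ⟨m, hm, σ₀, K', hσ₀, hK', hsol⟩ := exists_reduced_solution (u := u) (a₁ := a₁) (a₂ := a₂)
    (a₃ := a₃) (fun y => ⟨U (max y 0), hU.nonneg _ (le_max_right y 0), (hU.lt_one _).le, rfl⟩)
    n1 n2 n3 hb hc₀
  set R := 1 + (‖c₀‖ + b) with hR
  have hRn : 0 ≤ R := by positivity
  set G := 1 / m * (4 * C + R * (4 * C) + m * (4 * C)) + (R + 1 / m * (R * R)) +
    (4 * C + 4 * C + 4 * C) with hG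
  have hGn : 0 ≤ G := by positivity
  refine ⟨m, hm, σ₀, 2 * (K' * G) + 1, hσ₀, by positivity, fun σ hσ => ?_⟩
  have hσ1 : 1 < σ := by linarith
  have hσp : 0 < σ := by linarith
  -- This is exp(-σy) in the weighted variable. It is annihilated by 1 - σ⁻²∂², so subtracting it
  -- fixes w(0) = -1 without changing h.
  set e₀ := clampedFunction (fun y => (Real.exp (-(σ - 1) * y) : ℂ)) (by fun_prop) 1 (fun y hy => by
    rw [Complex.norm_real, Real.norm_of_nonneg (Real.exp_nonneg _), Real.exp_le_one_iff]
    nlinarith) with he₀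
  have ne : ‖e₀‖ ≤ 1 := norm_clampedFunction_le zero_le_one
  -- The source term together with what `viscousOp` would produce from -e₀. The factor p does not
  -- see e₀, whence the term σ a₁ e₀ with a plus sign.
  set g : ℂ → (ℝ →ᵇ ℂ) := fun c =>
    (Complex.I / m) • (p₀ - c • p₁ - (Complex.I * m / (σ : ℂ) ^ 2) • p₂)
    - ((u - c • 1) - (Complex.I / m) • ((u - c • 1) * (u - c • 1))) * e₀
    + ((σ : ℂ) ^ 2)⁻¹ • (((σ : ℂ) • a₁) * e₀ - a₂ * e₀ - a₃ * primitiveOp e₀) with hg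
  have hgd : Differentiable ℂ g := by
    intro c
    simp only [hg]
    fun_prop
  have nI : ‖Complex.I / (m : ℂ)‖ = 1 / m := by
    rw [norm_div, Complex.norm_I, Complex.norm_real, Real.norm_of_nonneg hm.le]
  have nσ2 : ‖((σ : ℂ) ^ 2)⁻¹‖ ≤ 1 := by
    rw [norm_inv, norm_pow, Complex.norm_real, Real.norm_of_nonneg hσp.le]
    exact inv_le_one_of_one_le₀ (by nlinarith)
  have hgb : ∀ c ∈ ball c₀ b, ‖g c‖ ≤ G := by
    intro c hcb
    have h2 : ‖c - c₀‖ < b := by simpa [dist_eq_norm] using hcb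
    have hcn : ‖c‖ ≤ ‖c₀‖ + b := by
      have := norm_le_norm_add_norm_sub' c c₀
      linarith
    have hcR : ‖c‖ ≤ R := by linarith
    have huc : ‖u - c • 1‖ ≤ R := by
      refine (norm_sub_le _ _).trans ?_
      rw [norm_smul, norm_one, mul_one]
      linarith
    have b1 : ‖p₀ - c • p₁ - (Complex.I * m / (σ : ℂ) ^ 2) • p₂‖ ≤ 4 * C + R * (4 * C) + m * (4 * C) := by
      refine (norm_sub_le _ _).trans (add_le_add ((norm_sub_le _ _).trans (add_le_add np0 ?_)) ?_)
      · rw [norm_smul]; gcongr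
      · rw [norm_smul]
        have : ‖Complex.I * m / (σ : ℂ) ^ 2‖ ≤ m := by
          rw [div_eq_mul_inv, norm_mul, norm_mul, Complex.norm_I, Complex.norm_real,
            Real.norm_of_nonneg hm.le, one_mul]
          exact mul_le_of_le_one_right hm.le nσ2
        gcongr
    have b2 : ‖((u - c • 1) - (Complex.I / m) • ((u - c • 1) * (u - c • 1))) * e₀‖ ≤ R + 1 / m * (R * R) := by
      refine (norm_mul_le _ _).trans ?_
      have : ‖(u - c • 1) - (Complex.I / m) • ((u - c • 1) * (u - c • 1))‖ ≤ R + 1 / m * (R * R) := by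
        refine (norm_sub_le _ _).trans (add_le_add huc ?_)
        rw [norm_smul, nI]
        have := (norm_mul_le (u - c • 1) (u - c • 1)).trans (mul_le_mul huc huc (norm_nonneg _) hRn)
        gcongr
      calc _ ≤ (R + 1 / m * (R * R)) * 1 := mul_le_mul this ne (norm_nonneg _) (by positivity)
        _ = _ := mul_one _
    have b3 : ‖((σ : ℂ) ^ 2)⁻¹ • (((σ : ℂ) • a₁) * e₀ - a₂ * e₀ - a₃ * primitiveOp e₀)‖ ≤
        4 * C + 4 * C + 4 * C := by
      have i1 : ‖primitiveOp e₀‖ ≤ 1 := (ContinuousLinearMap.le_opNorm _ _).trans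
        (mul_le_one₀ norm_primitiveOp_le (norm_nonneg _) ne)
      have hmul : ∀ a b : ℝ →ᵇ ℂ, ‖a‖ ≤ 4 * C → ‖b‖ ≤ 1 → ‖a * b‖ ≤ 4 * C := fun a b h1 h2 =>
        (norm_mul_le _ _).trans ((mul_le_mul h1 h2 (norm_nonneg _) n4).trans (mul_one _).le)
      have r1 : ((σ : ℂ) ^ 2)⁻¹ • (((σ : ℂ) • a₁) * e₀ - a₂ * e₀ - a₃ * primitiveOp e₀) =
          (((σ : ℂ) ^ 2)⁻¹ * σ) • (a₁ * e₀) - ((σ : ℂ) ^ 2)⁻¹ • (a₂ * e₀) -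
            ((σ : ℂ) ^ 2)⁻¹ • (a₃ * primitiveOp e₀) := by
        rw [smul_sub, smul_sub, smul_mul_assoc, smul_smul]
      have hs : ‖((σ : ℂ) ^ 2)⁻¹ * σ‖ ≤ 1 := by
        rw [norm_mul, norm_inv, norm_pow, Complex.norm_real, Real.norm_of_nonneg hσp.le,
          inv_mul_le_iff₀ (by positivity)]
        nlinarith
      have hsm : ∀ (s : ℂ) (x : ℝ →ᵇ ℂ), ‖s‖ ≤ 1 → ‖x‖ ≤ 4 * C → ‖s • x‖ ≤ 4 * C := fun s x h1 h2 => by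
        rw [norm_smul]
        exact (mul_le_mul h1 h2 (norm_nonneg _) zero_le_one).trans (one_mul _).le
      rw [r1]
      exact (norm_sub_le _ _).trans (add_le_add ((norm_sub_le _ _).trans
        (add_le_add (hsm _ _ hs (hmul _ _ n1 ne)) (hsm _ _ nσ2 (hmul _ _ n2 ne))))
        (hsm _ _ nσ2 (hmul _ _ n3 i1)))
    refine (norm_add_le _ _).trans (add_le_add ((norm_sub_le _ _).trans (add_le_add ?_ b2)) b3)
    rw [norm_smul, nI]
    gcongr
  obtain ⟨q, hqd, hq⟩ := hsol σ hσ1 hσ g G hgd.differentiableOn hgb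
  refine ⟨fun c => totalFunctional (resolventOp σ hσ1 (q c) - e₀), ?_, fun c hcb => ?_⟩
  · intro c hcb
    have := hqd c hcb
    fun_prop
  · obtain ⟨hqn, hqe⟩ := hq c hcb
    have hJ3 : σ / (σ - 1) ≤ 2 := by
      rw [div_le_iff₀ (by linarith)]; linarith
    have hKG : 0 ≤ K' * G := by positivity
    refine viscousSolution_of_reduced hσ1 (q c) e₀ (fun y hy => clampedFunction_apply hy) ?_ ?_ ?_
    · refine (norm_sub_le _ _).trans (add_le_add ((ContinuousLinearMap.le_opNorm _ _).trans ?_) ne)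
      exact mul_le_mul ((norm_resolventOp_le σ hσ1).trans hJ3) hqn (norm_nonneg _) zero_le_two
    · refine (ContinuousLinearMap.le_opNorm _ _).trans ?_
      have := mul_le_mul (norm_backwardOp_le σ hσ1) hqn (norm_nonneg _) zero_le_one
      linarith
    · intro y hy
      have h1 := congrArg (fun f : ℝ →ᵇ ℂ => f y) hqe
      have eu : u y = U y := clampedFunction_apply hy
      have ea1 : a₁ y = ((3 * U₁ y : ℝ) : ℂ) := clampedFunction_apply hy
      have ea2 : a₂ y = ((3 * U₂ y : ℝ) : ℂ) := clampedFunction_apply hy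
      have ea3 : a₃ y = ((Real.exp y * U₃ y : ℝ) : ℂ) := clampedFunction_apply hy
      have ep0 : p₀ y = ((Real.exp y * (1 - U y) * (1 + U y) : ℝ) : ℂ) := clampedFunction_apply hy
      have ep1 : p₁ y = ((2 * (Real.exp y * (1 - U y)) : ℝ) : ℂ) := clampedFunction_apply hy
      have ep2 : p₂ y = ((Real.exp y * (3 * U₂ y + y * U₃ y) : ℝ) : ℂ) := clampedFunction_apply hy
      rw [map_sub]
      simp only [hg, viscousOp, add_apply, BoundedContinuousFunction.coe_add, BoundedContinuousFunction.coe_sub,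
        BoundedContinuousFunction.coe_mul, BoundedContinuousFunction.coe_smul, Pi.add_apply, Pi.sub_apply,
        Pi.mul_apply, smul_eq_mul, BoundedContinuousFunction.coe_one, Pi.one_apply, mul_one,
        sub_apply, smul_apply,
        ContinuousLinearMap.mul_apply', mul_apply_eq_comp, eu, ea1, ea2, ea3, ep0, ep1, ep2] at h1 ⊢
      push_cast at h1 ⊢
      linear_combination h1

end BoundaryLayer

/-! ### The vanishing viscosity limit of the displacement. -/

namespace BoundaryLayer
open Metric

variable {U U₁ U₂ U₃ : ℝ → ℝ} {C : ℝ}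

lemma ViscousSolution.hasDerivAt_shear {σ m : ℝ} {c : ℂ} {K : ℝ} {w p h W : ℝ → ℂ}
    (hv : ViscousSolution U U₁ U₂ U₃ σ m c K w p h W) (y : ℝ) :
    HasDerivAt (fun y => (σ : ℂ) * (p y - w y)) ((σ : ℂ) ^ 2 * (w y - h y)) y :=
  (((hv.hasDerivAt_p y).fun_sub (hv.hasDerivAt_w y)).const_mul (σ : ℂ)).congr_deriv (by ring)

lemma ViscousSolution.continuous {σ m : ℝ} {c : ℂ} {K : ℝ} {w p h W : ℝ → ℂ}
    (hv : ViscousSolution U U₁ U₂ U₃ σ m c K w p h W) : Continuous w ∧ Continuous p ∧ Continuous W :=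
  ⟨continuous_iff_continuousAt.2 fun y => (hv.hasDerivAt_w y).continuousAt,
    continuous_iff_continuousAt.2 fun y => (hv.hasDerivAt_p y).continuousAt,
    continuous_iff_continuousAt.2 fun y => (hv.hasDerivAt_W y).continuousAt⟩

lemma ViscousSolution.integrableOn {σ m : ℝ} {c : ℂ} {K : ℝ} {w p h W : ℝ → ℂ}
    (hv : ViscousSolution U U₁ U₂ U₃ σ m c K w p h W) : IntegrableOn w (Ioi 0) :=
  integrableOn_of_norm_le_exp hv.continuous.1.continuousOn one_pos fun y hy => by
    simpa using hv.bound_w y hy.le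

lemma ViscousSolution.tendsto_W {σ m : ℝ} {c : ℂ} {K : ℝ} {w p h W : ℝ → ℂ}
    (hv : ViscousSolution U U₁ U₂ U₃ σ m c K w p h W) :
    Tendsto W atTop (𝓝 (∫ y in Ioi (0 : ℝ), w y)) := by
  refine (intervalIntegral_tendsto_integral_Ioi 0 hv.integrableOn tendsto_id).congr fun y => ?_
  rw [intervalIntegral.integral_eq_sub_of_hasDerivAt (fun z _ => hv.hasDerivAt_W z)
    (hv.continuous.1.intervalIntegrable _ _), hv.W_zero, sub_zero, id]

lemma DecayingProfile.hasDerivAt_ofReal (hU : DecayingProfile U U₁ U₂ U₃ C) (y : ℝ) :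
    HasDerivAt (fun y => (U y : ℂ)) (U₁ y) y ∧ HasDerivAt (fun y => (U₁ y : ℂ)) (U₂ y) y ∧
      HasDerivAt (fun y => (U₂ y : ℂ)) (U₃ y) y :=
  ⟨(hU.hasDerivAt y).ofReal_comp, (hU.hasDerivAt₁ y).ofReal_comp, (hU.hasDerivAt₂ y).ofReal_comp⟩

lemma mul_exp_neg_two_le {y : ℝ} : y * Real.exp (-(2 * y)) ≤ Real.exp (-y) := by
  have h1 : y ≤ Real.exp y := by linarith [Real.add_one_le_exp y]
  calc y * Real.exp (-(2 * y)) ≤ Real.exp y * Real.exp (-(2 * y)) := by gcongr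
    _ = Real.exp (-y) := by rw [← Real.exp_add]; congr 1; ring

/-- The viscous displacement converges to the inviscid one as the viscosity vanishes. -/
lemma ViscousSolution.norm_integral_sub_le (hU : DecayingProfile U U₁ U₂ U₃ C) {σ m : ℝ} {c : ℂ}
    {K b : ℝ} {w p h W : ℝ → ℂ} (hv : ViscousSolution U U₁ U₂ U₃ σ m c K w p h W) (hK : 0 ≤ K)
    (hb : 0 < b) (hbc : b ≤ c.im) (hm : 0 < m) (hσ : 1 ≤ σ)
    (hint : IntegrableOn (fun y => ((1 - U y : ℝ) : ℂ) * velocityKernel c (U y)) (Ioi 0)) :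
    ‖(∫ y in Ioi (0 : ℝ), w y) - ∫ y in Ioi (0 : ℝ), ((1 - U y : ℝ) : ℂ) * velocityKernel c (U y)‖ ≤
      (2 * K * b⁻¹ + (4 * C + 12 * C * K) * (b⁻¹) ^ 2) * m / σ := by
  have hC := hU.nonneg_const
  obtain ⟨hc0, hc1, hc2, hc3⟩ := hU.continuous
  obtain ⟨hwc, hpc, hWc⟩ := hv.continuous
  have hσp : 0 < σ := by linarith
  have hne : ∀ y, (U y : ℂ) - c ≠ 0 := fun y => sub_ne_zero_of_im_pos (hb.trans_le hbc) _
  have hinv : ∀ y, ‖((U y : ℂ) - c)⁻¹‖ ≤ b⁻¹ := fun y => by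
    rw [norm_inv]; exact inv_anti₀ hb (hbc.trans (im_le_norm_ofReal_sub _))
  set ε : ℝ := m / σ ^ 2 with hε
  have hεp : 0 < ε := by positivity
  set Q : ℝ → ℂ := fun y => ((1 - U y : ℝ) : ℂ) * velocityKernel c (U y) with hQ
  have hQc : Continuous Q := by
    have := continuous_velocityKernel (hb.trans_le hbc)
    simp only [hQ]; fun_prop
  set d : ℝ → ℂ := fun y => (σ : ℂ) * (p y - w y) with hd
  -- In the equation divided by (U - c)², the term iε w''/(U - c) is not small near the wall. Up to
  -- iε U₁w'/(U - c)² it is an exact derivative, so it is moved into Ξ and only first-order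
  -- quantities are left in Ξ'.
  set Ξ : ℝ → ℂ := fun y => W y - (∫ z in (0 : ℝ)..y, Q z) + Complex.I * ε * (d y * ((U y : ℂ) - c)⁻¹) with hΞ
  set Ξ' : ℝ → ℂ := fun y => -(Complex.I * ε) * ((3 * U₂ y + y * U₃ y + 3 * U₁ y * d y + 3 * U₂ y * w y
    + U₃ y * W y + U₁ y * d y) * (((U y : ℂ) - c)⁻¹) ^ 2) with hΞ'
  have hderiv : ∀ y ∈ Ici (0 : ℝ), HasDerivAt Ξ (Ξ' y) y := by
    intro y hy
    have h1 := ((hv.hasDerivAt_W y).fun_sub (hasDerivAt_primitive hQc y)).fun_add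
      (((hv.hasDerivAt_shear y).fun_mul
        (((hU.hasDerivAt_ofReal y).1.sub_const c).fun_inv (hne y))).const_mul (Complex.I * ε))
    refine h1.congr_deriv ?_
    have h2 := hv.equation y hy
    have hs0 : (σ : ℂ) ≠ 0 := by exact_mod_cast hσp.ne'
    have hm0 : (m : ℂ) ≠ 0 := by exact_mod_cast hm.ne'
    have hn := hne y
    have h3 : (((U y : ℂ) - c) ^ 2) * w y + Complex.I * m * ((U y : ℂ) - c) * (w y - h y) +
        Complex.I * ε * (3 * U₁ y * d y + 3 * U₂ y * w y + U₃ y * W y) =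
        (1 - U y) * (1 + U y - 2 * c) - (Complex.I * ε) * (3 * U₂ y + y * U₃ y) := by
      have e1 : (ε : ℂ) = m / (σ : ℂ) ^ 2 := by rw [hε]; push_cast; rfl
      have e2 : Complex.I * m * (Complex.I / m) = -1 := by
        field_simp; exact Complex.I_sq
      simp only [hd]
      rw [e1]
      linear_combination (-(Complex.I * m)) * h2 + (((U y : ℂ) - c) ^ 2 * w y -
        ((1 - U y) * (1 + U y - 2 * c) - (Complex.I * m / (σ : ℂ) ^ 2) * (3 * U₂ y + y * U₃ y))) * e2
    have e3 : Complex.I * ε * (σ : ℂ) ^ 2 = Complex.I * m := by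
      rw [hε]; push_cast; field_simp
    have e4 : Q y = (1 - U y) * (1 + U y - 2 * c) * (((U y : ℂ) - c)⁻¹) ^ 2 := by
      simp only [hQ, velocityKernel]; push_cast; rw [div_eq_mul_inv, inv_pow]; ring
    have e5 : ((U y : ℂ) - c) * ((U y : ℂ) - c)⁻¹ = 1 := mul_inv_cancel₀ hn
    rw [e4]
    simp only [hΞ']
    have e6 : -(U₁ y : ℂ) / ((U y : ℂ) - c) ^ 2 = -(U₁ y : ℂ) * (((U y : ℂ) - c)⁻¹) ^ 2 := by
      rw [div_eq_mul_inv, inv_pow]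
    rw [e6]
    simp only [hd] at h3 ⊢
    generalize ((U y : ℂ) - c)⁻¹ = r at *
    generalize (U y : ℂ) - c = s at *
    linear_combination r ^ 2 * h3 + (w y - h y) * r * e3 - w y * (1 + s * r) * e5 -
      Complex.I * m * (w y - h y) * r * e5
  have hexp : ∀ y : ℝ, 0 ≤ y → Real.exp (-(2 * y)) ≤ Real.exp (-y) := fun y hy =>
    Real.exp_le_exp.2 (by linarith)
  -- The wall layer allows w' to be of size σ, so ε w' with ε = m/σ² is O(1/σ). This fixes the rate
  -- of convergence.
  have hdb : ∀ y, 0 ≤ y → ‖d y‖ ≤ 2 * σ * K * Real.exp (-y) := by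
    intro y hy
    simp only [hd]
    rw [norm_mul, Complex.norm_real, Real.norm_of_nonneg hσp.le]
    have := (norm_sub_le (p y) (w y)).trans (add_le_add (hv.bound_p y hy) (hv.bound_w y hy))
    calc σ * ‖p y - w y‖ ≤ σ * (K * Real.exp (-y) + K * Real.exp (-y)) := by gcongr
      _ = _ := by ring
  set A : ℝ := (4 * C + 12 * C * K) * (b⁻¹) ^ 2 * m / σ with hA
  have hbound : ∀ y, 0 < y → ‖Ξ' y‖ ≤ A * Real.exp (-(1 * y)) := by
    intro y hy
    have x1 := hU.bound₁ y hy.le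
    have x2 := hU.bound₂ y hy.le
    have x3 := hU.bound₃ y hy.le
    have x4 := hexp y hy.le
    have x5 := mul_exp_neg_two_le (y := y)
    have x6 := hv.bound_w y hy.le
    have x7 := hv.bound_W y hy.le
    have x8 := hdb y hy.le
    have E0 := Real.exp_pos (-y)
    have E1 : Real.exp (-y) ≤ 1 := by simpa using hy.le
    have y1 : |U₁ y| ≤ C * Real.exp (-y) := x1.trans (by gcongr)
    have y2 : |U₂ y| ≤ C * Real.exp (-y) := x2.trans (by gcongr)
    have y3 : |U₃ y| ≤ C * Real.exp (-y) := x3.trans (by gcongr)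
    have y4 : y * |U₃ y| ≤ C * Real.exp (-y) := by
      calc y * |U₃ y| ≤ y * (C * Real.exp (-(2 * y))) := by gcongr
        _ = C * (y * Real.exp (-(2 * y))) := by ring
        _ ≤ _ := by gcongr
    have d1 : ‖d y‖ ≤ 2 * σ * K := x8.trans (mul_le_of_le_one_right (by positivity) E1)
    have w1 : ‖w y‖ ≤ K := x6.trans (mul_le_of_le_one_right hK E1)
    have nr : ∀ x : ℝ, ‖(x : ℂ)‖ = |x| := fun x => by rw [Complex.norm_real, Real.norm_eq_abs]
    have n3 : ‖(3 : ℂ)‖ = 3 := by norm_num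
    have tot : ‖(3 * U₂ y + y * U₃ y + 3 * U₁ y * d y + 3 * U₂ y * w y
        + U₃ y * W y + U₁ y * d y : ℂ)‖ ≤ (σ * (4 * C + 12 * C * K)) * Real.exp (-y) := by
      have t1 : ‖(3 * U₂ y : ℂ)‖ ≤ 3 * (C * Real.exp (-y)) := by
        rw [norm_mul, n3, nr]; gcongr
      have t2 : ‖(y * U₃ y : ℂ)‖ ≤ C * Real.exp (-y) := by
        rw [norm_mul, nr, nr, abs_of_pos hy]; exact y4
      have t3 : ‖(3 * U₁ y * d y : ℂ)‖ ≤ 3 * (C * Real.exp (-y)) * (2 * σ * K) := by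
        rw [norm_mul, norm_mul, n3, nr]; gcongr
      have t4 : ‖(3 * U₂ y * w y : ℂ)‖ ≤ 3 * (C * Real.exp (-y)) * K := by
        rw [norm_mul, norm_mul, n3, nr]; gcongr
      have t5 : ‖(U₃ y * W y : ℂ)‖ ≤ (C * Real.exp (-y)) * K := by
        rw [norm_mul, nr]; gcongr
      have t6 : ‖(U₁ y * d y : ℂ)‖ ≤ (C * Real.exp (-y)) * (2 * σ * K) := by
        rw [norm_mul, nr]; gcongr
      have z1 : 4 * C * Real.exp (-y) ≤ σ * (4 * C * Real.exp (-y)) :=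
        le_mul_of_one_le_left (by positivity) hσ
      have z2 : 4 * C * K * Real.exp (-y) ≤ σ * (4 * C * K * Real.exp (-y)) :=
        le_mul_of_one_le_left (by positivity) hσ
      calc _ ≤ 3 * (C * Real.exp (-y)) + C * Real.exp (-y) + 3 * (C * Real.exp (-y)) * (2 * σ * K)
          + 3 * (C * Real.exp (-y)) * K + (C * Real.exp (-y)) * K + (C * Real.exp (-y)) * (2 * σ * K) :=
            (norm_add_le _ _).trans (add_le_add ((norm_add_le _ _).trans (add_le_add
              ((norm_add_le _ _).trans (add_le_add ((norm_add_le _ _).trans (add_le_add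
              ((norm_add_le _ _).trans (add_le_add t1 t2)) t3)) t4)) t5)) t6)
        _ ≤ _ := by linarith
    simp only [hΞ']
    rw [norm_mul, norm_neg, norm_mul, Complex.norm_I, one_mul, Complex.norm_real,
      Real.norm_of_nonneg hεp.le, norm_mul, norm_pow]
    calc ε * (_ * ‖((U y : ℂ) - c)⁻¹‖ ^ 2) ≤ ε * ((σ * (4 * C + 12 * C * K)) * Real.exp (-y) * (b⁻¹) ^ 2) := by
          have := hinv y
          gcongr
      _ = A * Real.exp (-(1 * y)) := by
          rw [hA, hε, one_mul]; field_simp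
  have hΞ'c : Continuous Ξ' := by
    have hdc : Continuous d := by simp only [hd]; fun_prop
    have hic : Continuous fun y => ((U y : ℂ) - c)⁻¹ := Continuous.inv₀ (by fun_prop) hne
    simp only [hΞ']
    fun_prop
  have hΞi : IntegrableOn Ξ' (Ioi 0) := integrableOn_of_norm_le_exp hΞ'c.continuousOn one_pos hbound
  have hlim : Tendsto Ξ atTop (𝓝 ((∫ y in Ioi (0 : ℝ), w y) - (∫ y in Ioi (0 : ℝ), Q y) + 0)) := by
    refine (hv.tendsto_W.sub (intervalIntegral_tendsto_integral_Ioi 0 hint tendsto_id)).add ?_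
    have h0 : Tendsto (fun y : ℝ => ε * (2 * σ * K * Real.exp (-y) * b⁻¹)) atTop (𝓝 0) := by
      simpa using ((Real.tendsto_exp_neg_atTop_nhds_zero.const_mul (2 * σ * K)).mul_const b⁻¹).const_mul ε
    refine squeeze_zero_norm' ?_ h0
    filter_upwards [eventually_ge_atTop 0] with y hy
    rw [norm_mul, norm_mul, Complex.norm_I, one_mul, Complex.norm_real,
      Real.norm_of_nonneg hεp.le, norm_mul]
    have := hdb y hy
    have := hinv y
    gcongr
  have hmain := integral_Ioi_of_hasDerivAt_of_tendsto' hderiv hΞi hlim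
  have hΞ0 : ‖Ξ 0‖ ≤ 2 * K * b⁻¹ * m / σ := by
    simp only [hΞ]
    rw [hv.W_zero, intervalIntegral.integral_same, sub_zero, zero_add, norm_mul, norm_mul, Complex.norm_I,
      one_mul, Complex.norm_real, Real.norm_of_nonneg hεp.le, norm_mul]
    have h1 := hdb 0 le_rfl
    have h2 := hinv 0
    rw [neg_zero, Real.exp_zero, mul_one] at h1
    calc _ ≤ ε * (2 * σ * K * b⁻¹) := by gcongr
      _ = _ := by rw [hε]; field_simp
  have hI : ‖∫ y in Ioi (0 : ℝ), Ξ' y‖ ≤ A := by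
    have h1 : ∫ y in Ioi (0 : ℝ), A * Real.exp (-(1 * y)) = A := by
      simp only [one_mul]
      rw [integral_const_mul, integral_exp_neg_Ioi_zero, mul_one]
    rw [← h1]
    refine norm_integral_le_of_norm_le (integrableOn_exp_neg_const_mul one_pos A) ?_
    filter_upwards [self_mem_ae_restrict measurableSet_Ioi] with y hy using hbound y hy
  have : (∫ y in Ioi (0 : ℝ), w y) - (∫ y in Ioi (0 : ℝ), Q y) = Ξ 0 + ∫ y in Ioi (0 : ℝ), Ξ' y := by
    rw [hmain]; ring
  rw [this]
  refine (norm_add_le _ _).trans ((add_le_add hΞ0 hI).trans (le_of_eq ?_))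
  rw [hA]; ring

end BoundaryLayer

/-! ### From w to a smooth normal mode. -/

namespace BoundaryLayer
open Metric

variable {U U₁ U₂ U₃ : ℝ → ℝ} {C : ℝ}

lemma contDiffOn_succ_of_hasDerivAt {f f' : ℝ → ℂ} {n : ℕ} (h : ∀ y, HasDerivAt f (f' y) y)
    (h' : ContDiffOn ℝ n f' (Ici 0)) : ContDiffOn ℝ (n + 1 : ℕ) f (Ici 0) := by
  rw [Nat.cast_succ, contDiffOn_succ_iff_derivWithin (uniqueDiffOn_Ici 0)]
  refine ⟨fun y _ => (h y).differentiableAt.differentiableWithinAt, by simp, h'.congr fun y hy => ?_⟩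
  exact (h y).hasDerivWithinAt.derivWithin (uniqueDiffOn_Ici 0 y hy)

/-- Bootstrap on the closed half-line: dividing the equation by U - c expresses h through w, p, W,
and the first-order system then gains one derivative. -/
lemma ViscousSolution.contDiffOn (hU : DecayingProfile U U₁ U₂ U₃ C) {σ m : ℝ} {c : ℂ}
    {K : ℝ} {w p h W : ℝ → ℂ} (hv : ViscousSolution U U₁ U₂ U₃ σ m c K w p h W) (hc : 0 < c.im) :
    ContDiffOn ℝ ∞ w (Ici 0) ∧ ContDiffOn ℝ ∞ W (Ici 0) := by
  have hof : ∀ f : ℝ → ℝ, ContDiff ℝ ∞ f → ∀ n : ℕ, ContDiffOn ℝ n (fun y => (f y : ℂ)) (Ici 0) :=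
    fun f hf n => ((Complex.ofRealCLM.contDiff.comp hf).of_le (by exact_mod_cast le_top)).contDiffOn
  obtain ⟨s0, s1, s2, s3⟩ := hU.contDiff
  have key : ∀ n : ℕ, ContDiffOn ℝ n w (Ici 0) ∧ ContDiffOn ℝ n p (Ici 0) ∧ ContDiffOn ℝ n W (Ici 0) := by
    intro n
    induction n with
    | zero =>
      obtain ⟨a, b, d⟩ := hv.continuous
      simp only [Nat.cast_zero, contDiffOn_zero]
      exact ⟨a.continuousOn, b.continuousOn, d.continuousOn⟩
    | succ n ih =>
      obtain ⟨a, b, d⟩ := ih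
      have u0 := hof _ s0 n
      have u1 := hof _ s1 n
      have u2 := hof _ s2 n
      have u3 := hof _ s3 n
      have uy := hof _ contDiff_id n
      have hs : ContDiffOn ℝ n (fun y => ((U y : ℂ) - c)) (Ici 0) := u0.sub contDiffOn_const
      have hh : ContDiffOn ℝ n h (Ici 0) := by
        have e : ContDiffOn ℝ n (fun y => (((U y : ℂ) - c) * w y - (Complex.I / m) * ((U y : ℂ) - c) ^ 2 * w y
          + ((σ : ℂ) ^ 2)⁻¹ * (3 * U₁ y * (σ * (p y - w y)) + 3 * U₂ y * w y + U₃ y * W y)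
          + (Complex.I / m) * ((1 - U y) * (1 + U y - 2 * c)
          - (Complex.I * m / (σ : ℂ) ^ 2) * (3 * U₂ y + y * U₃ y))) * ((U y : ℂ) - c)⁻¹) (Ici 0) := by
          have hi := hs.inv fun y _ => sub_ne_zero_of_im_pos hc (U y)
          have uy' : ContDiffOn ℝ n (fun y : ℝ => (y : ℂ)) (Ici 0) := uy
          refine ContDiffOn.mul ?_ hi
          refine ((((hs.mul a).sub ((contDiffOn_const.mul (hs.pow 2)).mul a)).add
            (contDiffOn_const.mul ((((contDiffOn_const.mul u1).mul (contDiffOn_const.mul (b.sub a))).add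
              ((contDiffOn_const.mul u2).mul a)).add (u3.mul d)))).add
            (contDiffOn_const.mul (((contDiffOn_const.sub u0).mul
              ((contDiffOn_const.add u0).sub contDiffOn_const)).sub (contDiffOn_const.mul
              ((contDiffOn_const.mul u2).add (uy'.mul u3))))))
        refine e.congr fun y hy => ?_
        rw [← hv.equation y hy, mul_right_comm, mul_inv_cancel₀ (sub_ne_zero_of_im_pos hc _), one_mul]
      exact ⟨contDiffOn_succ_of_hasDerivAt hv.hasDerivAt_w (contDiffOn_const.mul (b.sub a)),
        contDiffOn_succ_of_hasDerivAt hv.hasDerivAt_p (contDiffOn_const.mul (b.sub hh)),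
        contDiffOn_succ_of_hasDerivAt hv.hasDerivAt_W a⟩
  exact ⟨contDiffOn_infty.2 fun n => (key n).1, contDiffOn_infty.2 fun n => (key n).2.2⟩

/-- Stream function and velocity of a normal mode with wavenumber `k`, phase speed `c` and
displacement `D`. -/
structure IsMode (U U₁ : ℝ → ℝ) (k : ℝ) (c D : ℂ) (φ u : ℝ → ℂ) : Prop where
  contDiffOn_φ : ContDiffOn ℝ ∞ φ (Ici 0)
  contDiffOn_u : ContDiffOn ℝ ∞ u (Ici 0)
  φ_zero : φ 0 = 0
  u_zero : u 0 = 0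
  hasDerivAt : ∀ y, HasDerivAt φ (u y) y
  equation : ∀ y, 0 < y → ((U y : ℂ) - c) * u y - U₁ y * φ y
    + (Complex.I / k) * iteratedDeriv 2 u y = 1 - c
  tendsto : Tendsto u atTop (𝓝 1)
  integrable : IntegrableOn (fun y => 1 - u y) (Ioi 0)
  integral_eq : ∫ y in Ioi (0 : ℝ), (1 - u y) = D

/-- Take φ = (U - c)(y + W)/(1 - c) and u = φ'. The conditions W(0) = 0 and w(0) = -1 give φ(0) =
u(0) = 0, and division by 1 - c normalises u → 1. -/
theorem ViscousSolution.exists_isMode (hU : DecayingProfile U U₁ U₂ U₃ C) {σ m k : ℝ} {c : ℂ}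
    {K : ℝ} {w p h W : ℝ → ℂ} (hv : ViscousSolution U U₁ U₂ U₃ σ m c K w p h W) (hc : 0 < c.im)
    (hm : 0 < m) (hk : 0 < k) (hσ : σ ^ 2 = m * k) (hK : 0 ≤ K) :
    ∃ φ u, IsMode U U₁ k c (-∫ y in Ioi (0 : ℝ), w y) φ u := by
  have hC := hU.nonneg_const
  obtain ⟨hwc, hpc, hWc⟩ := hv.continuous
  obtain ⟨hc0, hc1, hc2, hc3⟩ := hU.continuous
  have hc1' : (1 : ℂ) - c ≠ 0 := by simpa using sub_ne_zero_of_im_pos hc 1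
  obtain ⟨sw, sW⟩ := hv.contDiffOn hU hc
  obtain ⟨s0, s1, s2, s3⟩ := hU.contDiff
  have hof : ∀ f : ℝ → ℝ, ContDiff ℝ ∞ f → ContDiffOn ℝ ∞ (fun y => (f y : ℂ)) (Ici 0) :=
    fun f hf => (Complex.ofRealCLM.contDiff.comp hf).contDiffOn
  have hy : ∀ y : ℝ, HasDerivAt (fun y : ℝ => (y : ℂ)) 1 y := fun y => (hasDerivAt_id' y).ofReal_comp
  have h0 := fun y => (hU.hasDerivAt_ofReal y).1
  have h1 := fun y => (hU.hasDerivAt_ofReal y).2.1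
  have h2 := fun y => (hU.hasDerivAt_ofReal y).2.2
  have hyW : ∀ y, HasDerivAt (fun y : ℝ => (y : ℂ) + W y) (1 + w y) y := fun y =>
    (hy y).fun_add (hv.hasDerivAt_W y)
  have hw1 : ∀ y, HasDerivAt (fun y : ℝ => 1 + w y) (σ * (p y - w y)) y := fun y =>
    (hv.hasDerivAt_w y).const_add 1
  set φ : ℝ → ℂ := fun y => ((U y : ℂ) - c) * (y + W y) / (1 - c) with hφ
  set u : ℝ → ℂ := fun y => (((U y : ℂ) - c) * (1 + w y) + U₁ y * (y + W y)) / (1 - c) with hu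
  set u' : ℝ → ℂ := fun y => (((U y : ℂ) - c) * (σ * (p y - w y)) + 2 * (U₁ y * (1 + w y))
    + U₂ y * (y + W y)) / (1 - c) with hu'
  set u'' : ℝ → ℂ := fun y => (((U y : ℂ) - c) * ((σ : ℂ) ^ 2 * (w y - h y)) + 3 * (U₁ y * (σ * (p y - w y)))
    + 3 * (U₂ y * (1 + w y)) + U₃ y * (y + W y)) / (1 - c) with hu''
  have hφd : ∀ y, HasDerivAt φ (u y) y := fun y =>
    ((((h0 y).sub_const c).fun_mul (hyW y)).div_const (1 - c)).congr_deriv (by simp only [hu]; ring)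
  have hud : ∀ y, HasDerivAt u (u' y) y := fun y =>
    (((((h0 y).sub_const c).fun_mul (hw1 y)).fun_add ((h1 y).fun_mul (hyW y))).div_const
      (1 - c)).congr_deriv (by simp only [hu']; ring)
  have hud' : ∀ y, HasDerivAt u' (u'' y) y := fun y =>
    ((((((h0 y).sub_const c).fun_mul (hv.hasDerivAt_shear y)).fun_add
      (((h1 y).fun_mul (hw1 y)).const_mul 2)).fun_add ((h2 y).fun_mul (hyW y))).div_const
      (1 - c)).congr_deriv (by simp only [hu'']; ring)
  have hdef : ∀ y, 1 - u y = (1 - U y - ((U y : ℂ) - c) * w y - U₁ y * (y + W y)) / (1 - c) := fun y => by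
    simp only [hu]; field_simp; ring
  have hexp : ∀ y : ℝ, 0 ≤ y → Real.exp (-(2 * y)) ≤ Real.exp (-y) := fun y hy =>
    Real.exp_le_exp.2 (by linarith)
  have hdb : ∀ y, 0 < y → ‖1 - u y‖ ≤
      ((C + (1 + ‖c‖) * K + (C + C * K)) * ‖(1 - c)⁻¹‖) * Real.exp (-(1 * y)) := by
    intro y hy0
    have nr : ∀ x : ℝ, ‖(x : ℂ)‖ = |x| := fun x => by rw [Complex.norm_real, Real.norm_eq_abs]
    have x0 := hU.nonneg y hy0.le
    have x0' := hU.lt_one y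
    have t1 : ‖(1 - U y : ℂ)‖ ≤ C * Real.exp (-y) := by
      rw [← Complex.ofReal_one, ← Complex.ofReal_sub, nr, abs_of_pos (by linarith)]
      exact (hU.defect_le y hy0.le).trans (by have := hexp y hy0.le; gcongr)
    have t2 : ‖((U y : ℂ) - c) * w y‖ ≤ (1 + ‖c‖) * K * Real.exp (-y) := by
      rw [norm_mul, mul_assoc]
      have : ‖(U y : ℂ) - c‖ ≤ 1 + ‖c‖ := (norm_sub_le _ _).trans (by
        rw [nr, abs_of_nonneg x0]; linarith)
      have := hv.bound_w y hy0.le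
      gcongr
    have t3 : ‖(U₁ y : ℂ) * (y + W y)‖ ≤ (C + C * K) * Real.exp (-y) := by
      rw [norm_mul, nr]
      have a1 := hU.bound₁ y hy0.le
      have a2 := mul_exp_neg_two_le (y := y)
      have a3 : ‖(y : ℂ) + W y‖ ≤ y + K := (norm_add_le _ _).trans (by
        rw [nr, abs_of_pos hy0]; have := hv.bound_W y hy0.le; linarith)
      calc |U₁ y| * ‖(y : ℂ) + W y‖ ≤ (C * Real.exp (-(2 * y))) * (y + K) := by gcongr
        _ = C * (y * Real.exp (-(2 * y))) + C * K * Real.exp (-(2 * y)) := by ring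
        _ ≤ C * Real.exp (-y) + C * K * Real.exp (-y) := by
            have := hexp y hy0.le
            gcongr
        _ = _ := by ring
    rw [hdef, div_eq_mul_inv, norm_mul, one_mul, mul_right_comm]
    refine mul_le_mul_of_nonneg_right ?_ (norm_nonneg _)
    refine ((norm_sub_le _ _).trans (add_le_add ((norm_sub_le _ _).trans (add_le_add t1 t2)) t3)).trans
      (le_of_eq (by ring))
  have huc : Continuous u := continuous_iff_continuousAt.2 fun y => (hud y).continuousAt
  have hint : IntegrableOn (fun y => 1 - u y) (Ioi 0) :=
    integrableOn_of_norm_le_exp (by fun_prop) one_pos hdb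
  have hlim1 : Tendsto (fun y => 1 - u y) atTop (𝓝 0) := by
    have z0 : Tendsto (fun y : ℝ => ((C + (1 + ‖c‖) * K + (C + C * K)) * ‖(1 - c)⁻¹‖) *
        Real.exp (-(1 * y))) atTop (𝓝 0) := by
      simpa using Real.tendsto_exp_neg_atTop_nhds_zero.const_mul
        ((C + (1 + ‖c‖) * K + (C + C * K)) * ‖(1 - c)⁻¹‖)
    refine squeeze_zero_norm' ?_ z0
    filter_upwards [eventually_gt_atTop 0] with y hy using hdb y hy
  have hlimexp : Tendsto (fun y : ℝ => C * Real.exp (-y)) atTop (𝓝 0) := by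
    simpa using Real.tendsto_exp_neg_atTop_nhds_zero.const_mul C
  have hUt : Tendsto (fun y => (U y : ℂ)) atTop (𝓝 1) := by
    have : Tendsto (fun y => 1 - U y) atTop (𝓝 0) := by
      refine squeeze_zero' (Eventually.of_forall fun y => by linarith [hU.lt_one y]) ?_ hlimexp
      filter_upwards [eventually_ge_atTop 0] with y hy
      exact (hU.defect_le y hy).trans (by have := hexp y hy; gcongr)
    have h3 : Tendsto U atTop (𝓝 1) := by simpa using this.const_sub 1
    exact (Complex.continuous_ofReal.tendsto 1).comp h3
  have hyU : Tendsto (fun y : ℝ => (y : ℂ) * (1 - U y)) atTop (𝓝 0) := by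
    refine squeeze_zero_norm' ?_ hlimexp
    filter_upwards [eventually_ge_atTop 0] with y hy
    rw [norm_mul, ← Complex.ofReal_one, ← Complex.ofReal_sub, Complex.norm_real, Complex.norm_real,
      Real.norm_of_nonneg hy, Real.norm_of_nonneg (by linarith [hU.lt_one y])]
    calc y * (1 - U y) ≤ y * (C * Real.exp (-(2 * y))) := by have := hU.defect_le y hy; gcongr
      _ = C * (y * Real.exp (-(2 * y))) := by ring
      _ ≤ _ := by have := mul_exp_neg_two_le (y := y); gcongr
  refine ⟨φ, u,
    { contDiffOn_φ := ?_
      contDiffOn_u := ?_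
      φ_zero := by simp [hφ, hv.W_zero]
      u_zero := by simp [hu, hv.W_zero, hv.w_zero]
      hasDerivAt := hφd
      equation := fun y hy0 => ?_
      tendsto := by simpa using hlim1.const_sub 1
      integrable := hint
      integral_eq := ?_ }⟩
  · have uy : ContDiffOn ℝ ∞ (fun y : ℝ => (y : ℂ)) (Ici 0) := hof _ contDiff_id
    exact (((hof _ s0).sub contDiffOn_const).mul (uy.add sW)).div_const _
  · have uy : ContDiffOn ℝ ∞ (fun y : ℝ => (y : ℂ)) (Ici 0) := hof _ contDiff_id
    exact ((((hof _ s0).sub contDiffOn_const).mul (contDiffOn_const.add sw)).add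
      ((hof _ s1).mul (uy.add sW))).div_const _
  · have e2 : iteratedDeriv 2 u y = u'' y := by
      rw [iteratedDeriv_succ, iteratedDeriv_one, show deriv u = u' from funext fun z => (hud z).deriv]
      exact (hud' y).deriv
    rw [e2]
    have hq := hv.equation y hy0.le
    have hm0 : (m : ℂ) ≠ 0 := by exact_mod_cast hm.ne'
    have hk0 : (k : ℂ) ≠ 0 := by exact_mod_cast hk.ne'
    have hσ' : (σ : ℂ) ^ 2 = m * k := by exact_mod_cast hσ
    have hs0 : (σ : ℂ) ^ 2 ≠ 0 := by rw [hσ']; exact mul_ne_zero hm0 hk0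
    have e3 : (Complex.I / k) = Complex.I * m * ((σ : ℂ) ^ 2)⁻¹ := by
      rw [hσ']; field_simp
    have e4 : Complex.I * m * (Complex.I / m) = -1 := by field_simp; exact Complex.I_sq
    have e5 : ((σ : ℂ) ^ 2)⁻¹ * (σ : ℂ) ^ 2 = 1 := inv_mul_cancel₀ hs0
    rw [div_eq_mul_inv (Complex.I * (m : ℂ))] at hq
    rw [e3]
    simp only [hu, hφ, hu'']
    have e6 : (1 - c) * (1 - c)⁻¹ = 1 := mul_inv_cancel₀ hc1'
    simp only [div_eq_mul_inv _ (1 - c)]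
    generalize (1 - c)⁻¹ = d at *
    generalize ((σ : ℂ) ^ 2)⁻¹ = r at *
    linear_combination d * (-(Complex.I * m) * hq + (((U y : ℂ) - c) ^ 2 * w y -
      ((1 - U y) * (1 + U y - 2 * c) - (Complex.I * m * r) * (3 * U₂ y + y * U₃ y))) * e4 +
      Complex.I * m * ((U y : ℂ) - c) * (w y - h y) * e5) + (1 - c) * e6
  · have hd : ∀ y ∈ Ici (0 : ℝ), HasDerivAt (fun y : ℝ => (y : ℂ) - φ y) (1 - u y) y := fun y _ =>
      (hy y).fun_sub (hφd y)
    have hl : Tendsto (fun y : ℝ => (y : ℂ) - φ y) atTop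
        (𝓝 ((0 - (1 - c) * ∫ y in Ioi (0 : ℝ), w y) / (1 - c))) := by
      refine ((hyU.sub ((hUt.sub_const c).mul hv.tendsto_W)).div_const (1 - c)).congr fun y => ?_
      simp only [hφ]; field_simp; ring
    rw [integral_Ioi_of_hasDerivAt_of_tendsto' hd hint hl]
    simp only [hφ, hv.W_zero, Complex.ofReal_zero]
    field_simp
    ring

end BoundaryLayer

/-! ### Normal modes as solutions of the PDT and IBL systems. -/

namespace BoundaryLayer

lemma intervalIntegral_exp_mul_int_eq_zero {n : ℤ} (hn : n ≠ 0) :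
    ∫ x in (0 : ℝ)..(2 * Real.pi), Complex.exp (Complex.I * n * x) = 0 := by
  have h : Complex.I * n ≠ 0 := mul_ne_zero Complex.I_ne_zero (by exact_mod_cast hn)
  rw [integral_exp_mul_complex h]
  have : Complex.exp (Complex.I * n * ((2 * Real.pi : ℝ) : ℂ)) = 1 := by
    rw [Complex.exp_eq_one_iff]
    exact ⟨n, by push_cast; ring⟩
  rw [this]
  simp

lemma fourierCoeffOn_exp_eq_zero {n k : ℤ} (hnk : n ≠ k) (A : ℂ) :
    fourierCoeffOn Real.two_pi_pos (fun x : ℝ => A * Complex.exp (Complex.I * k * x)) n = 0 := by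
  rw [fourierCoeffOn_eq_integral]
  have : ∀ x : ℝ, fourier (-n) (x : AddCircle (2 * Real.pi - 0)) • (A * Complex.exp (Complex.I * k * x)) =
      A * Complex.exp (Complex.I * (k - n : ℤ) * x) := by
    intro x
    rw [fourier_coe_apply, smul_eq_mul, mul_left_comm, ← Complex.exp_add]
    congr 2
    have : (Real.pi : ℂ) ≠ 0 := by exact_mod_cast Real.pi_ne_zero
    push_cast
    field_simp
    ring
  simp_rw [this]
  rw [intervalIntegral.integral_const_mul, intervalIntegral_exp_mul_int_eq_zero (sub_ne_zero.2 hnk.symm)]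
  simp

lemma periodic_exp_nat (k : ℕ) (x : ℝ) :
    Complex.exp (Complex.I * k * ((x + 2 * Real.pi : ℝ) : ℂ)) = Complex.exp (Complex.I * k * x) := by
  have := Complex.exp_periodic.nat_mul k (Complex.I * k * x)
  rw [← this]
  congr 1
  push_cast
  ring

variable {U U₁ U₂ U₃ : ℝ → ℝ} {C : ℝ}

theorem IsMode.solvesLinearizedBL (hU : DecayingProfile U U₁ U₂ U₃ C) {k : ℕ} (hk : 1 ≤ k) {c D : ℂ}
    {φ u : ℝ → ℂ} (h : IsMode U U₁ k c D φ u) :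
    SolvesLinearizedBL U
      (fun t x y => Complex.exp (-(Complex.I * k * c) * t) * Complex.exp (Complex.I * k * x) * u y)
      (fun t x y => Complex.exp (-(Complex.I * k * c) * t) * Complex.exp (Complex.I * k * x) *
        (-(Complex.I * k) * φ y))
      (fun t x => Complex.exp (-(Complex.I * k * c) * t) * Complex.exp (Complex.I * k * x)) := by
  have hk0 : (k : ℂ) ≠ 0 := by exact_mod_cast (by omega : k ≠ 0)
  have hkz : (k : ℤ) ≠ 0 := by exact_mod_cast (by omega : k ≠ 0)
  have hmean : ∫ x in (0 : ℝ)..(2 * Real.pi), Complex.exp (Complex.I * k * x) = 0 := by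
    simpa using intervalIntegral_exp_mul_int_eq_zero hkz
  have hof : ContDiff ℝ ∞ (fun x : ℝ => (x : ℂ)) := Complex.ofRealCLM.contDiff
  have sexp : ContDiff ℝ ∞ (fun p : ℝ × ℝ => Complex.exp (-(Complex.I * k * c) * p.1) *
      Complex.exp (Complex.I * k * p.2)) :=
    ((contDiff_const.mul (hof.comp contDiff_fst)).cexp).mul
      ((contDiff_const.mul (hof.comp contDiff_snd)).cexp)
  have smooth3 : ∀ f : ℝ → ℂ, ContDiffOn ℝ ∞ f (Ici 0) → ContDiffOn ℝ ∞ (fun p : ℝ × ℝ × ℝ =>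
      Complex.exp (-(Complex.I * k * c) * p.1) * Complex.exp (Complex.I * k * p.2.1) * f p.2.2)
      {p | 0 ≤ p.1 ∧ 0 ≤ p.2.2} := by
    intro f hf
    refine ContDiffOn.mul ?_ ?_
    · exact (sexp.comp (contDiff_fst.prodMk (contDiff_fst.comp contDiff_snd))).contDiffOn
    · exact hf.comp (contDiff_snd.comp contDiff_snd).contDiffOn fun p hp => hp.2
  have dt : ∀ (t : ℝ) (a : ℂ), HasDerivAt (fun s : ℝ => Complex.exp (a * s)) (a * Complex.exp (a * t)) t := by
    intro t a
    have := (((hasDerivAt_id' t).ofReal_comp).const_mul a).cexp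
    exact this.congr_deriv (by simp [mul_comm])
  exact
  { smooth_U := smooth3 u h.contDiffOn_u
    smooth_V := smooth3 _ (contDiffOn_const.mul h.contDiffOn_φ)
    smooth_ue := sexp.contDiffOn
    periodic_U := fun t x y _ _ => by rw [periodic_exp_nat]
    periodic_V := fun t x y _ _ => by rw [periodic_exp_nat]
    periodic_ue := fun t x _ => by rw [periodic_exp_nat]
    meanFree_U := fun t y _ _ => by
      rw [intervalIntegral.integral_mul_const, intervalIntegral.integral_const_mul, hmean]; simp
    meanFree_V := fun t y _ _ => by
      rw [intervalIntegral.integral_mul_const, intervalIntegral.integral_const_mul, hmean]; simp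
    meanFree_ue := fun t _ => by rw [intervalIntegral.integral_const_mul, hmean, mul_zero]
    momentum := fun t x y _ hy => by
      set lam : ℂ := -(Complex.I * k * c) with hlam
      set E := Complex.exp (lam * t) * Complex.exp (Complex.I * k * x) with hE
      have d1 : deriv (fun s : ℝ => Complex.exp (lam * s) * Complex.exp (Complex.I * k * x) * u y) t =
          lam * E * u y := by
        rw [(((dt t lam).mul_const _).mul_const _).deriv, hE]; ring
      have d2 : deriv (fun z : ℝ => Complex.exp (lam * t) * Complex.exp (Complex.I * k * z) * u y) x =
          Complex.I * k * E * u y := by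
        rw [(((dt x (Complex.I * k)).const_mul _).mul_const _).deriv, hE]; ring
      have d3 : deriv (fun s : ℝ => Complex.exp (lam * s) * Complex.exp (Complex.I * k * x)) t =
          lam * E := by
        rw [((dt t lam).mul_const _).deriv, hE]; ring
      have d4 : deriv (fun z : ℝ => Complex.exp (lam * t) * Complex.exp (Complex.I * k * z)) x =
          Complex.I * k * E := by
        rw [((dt x (Complex.I * k)).const_mul _).deriv, hE]; ring
      have d5 : iteratedDeriv 2 (fun z => E * u z) y = E * iteratedDeriv 2 u y :=
        iteratedDeriv_const_mul_field E u
      rw [d1, d2, d3, d4, d5, (halfDeriv_eq_of_hasDerivAt hU.hasDerivAt hU.hasDerivAt₁ hU.hasDerivAt₂ hy.le).1]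
      have he := h.equation y hy
      have hI : Complex.I * k * (Complex.I / k) = -1 := by field_simp; exact Complex.I_sq
      push_cast at he
      rw [hlam]
      linear_combination E * Complex.I * k * he - E * iteratedDeriv 2 u y * hI
    divergence := fun t x y _ _ => by
      set E := Complex.exp (-(Complex.I * k * c) * t) * Complex.exp (Complex.I * k * x) with hE
      rw [(((dt x (Complex.I * k)).const_mul _).mul_const _).deriv,
        (((h.hasDerivAt y).const_mul (-(Complex.I * k))).const_mul E).deriv, hE]
      ring
    U_wall := fun t x _ => by rw [h.u_zero, mul_zero]
    V_wall := fun t x _ => by rw [h.φ_zero, mul_zero, mul_zero]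
    U_far := fun t x _ => by
      simpa using h.tendsto.const_mul (Complex.exp (-(Complex.I * k * c) * t) * Complex.exp (Complex.I * k * x))
    defect_integrable := fun t x _ => by
      have := h.integrable.const_mul
        (Complex.exp (-(Complex.I * k * c) * t) * Complex.exp (Complex.I * k * x))
      refine this.congr (Eventually.of_forall fun y => ?_)
      simp only
      ring }

lemma IsMode.integral_defect {k : ℕ} {c D : ℂ} {φ u : ℝ → ℂ} (h : IsMode U U₁ k c D φ u) (E : ℂ) :
    ∫ y in Ioi (0 : ℝ), (E - E * u y) = E * D := by
  rw [← h.integral_eq, ← integral_const_mul]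
  simp only [mul_sub, mul_one]

lemma re_rotated_pos {k : ℕ} (hk : 1 ≤ k) {c : ℂ} (hc : 0 < c.im) : 0 < (-(Complex.I * k * c)).re := by
  have : (0 : ℝ) < k := by exact_mod_cast hk
  simp
  positivity

theorem IsMode.displaysInstability_PDT (hU : DecayingProfile U U₁ U₂ U₃ C) {k : ℕ} (hk : 1 ≤ k) {c : ℂ}
    (hc : 0 < c.im) {φ u : ℝ → ℂ} (h : IsMode U U₁ k c (displacement U) φ u) :
    DisplaysInstability (SolvesPDT U) (-(Complex.I * k * c)) k := by
  refine ⟨hk, re_rotated_pos hk hc, u, fun y => -(Complex.I * k) * φ y, h.contDiffOn_u,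
    contDiffOn_const.mul h.contDiffOn_φ, h.solvesLinearizedBL hU hk, fun t x _ => ?_⟩
  rw [h.integral_defect, mul_comm]

/-- On the single frequency k the operator DN is multiplication by k, so the coupling reads √ν k D =
1 for the displacement D. -/
theorem IsMode.displaysInstability_IBL (hU : DecayingProfile U U₁ U₂ U₃ C) {k : ℕ} (hk : 1 ≤ k) {c : ℂ}
    (hc : 0 < c.im) {ν : ℝ} (hν : 0 < ν) {φ u : ℝ → ℂ}
    (h : IsMode U U₁ k c (((Real.sqrt ν * k)⁻¹ : ℝ) : ℂ) φ u) :
    DisplaysInstability (SolvesIBL U ν) (-(Complex.I * k * c)) k := by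
  refine ⟨hk, re_rotated_pos hk hc, u, fun y => -(Complex.I * k) * φ y, h.contDiffOn_u,
    contDiffOn_const.mul h.contDiffOn_φ, h.solvesLinearizedBL hU hk, fun t _ => ?_⟩
  have hk0 : (k : ℂ) ≠ 0 := by exact_mod_cast (by omega : k ≠ 0)
  have hs0 : (Real.sqrt ν : ℂ) ≠ 0 := by exact_mod_cast (Real.sqrt_pos.2 hν).ne'
  set A := Complex.exp (-(Complex.I * k * c) * t) with hA
  have e1 : (fun x : ℝ => (Real.sqrt ν : ℂ) * ∫ y in Ioi (0 : ℝ), (A * Complex.exp (Complex.I * k * x) -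
      A * Complex.exp (Complex.I * k * x) * u y)) =
      fun x : ℝ => (A / k) * Complex.exp (Complex.I * (k : ℤ) * x) := by
    ext x
    rw [h.integral_defect]
    push_cast
    field_simp
  have e2 : (fun x : ℝ => A * Complex.exp (Complex.I * k * x)) =
      fun x : ℝ => A * Complex.exp (Complex.I * (k : ℤ) * x) := by simp
  have per : ∀ B : ℂ, Function.Periodic (fun x : ℝ => B * Complex.exp (Complex.I * (k : ℤ) * x))
      (2 * Real.pi) := fun B x => by
    have := periodic_exp_nat k x
    simp only [Int.cast_natCast]
    rw [this]
  change IsDirichletToNeumann (fun x : ℝ => (Real.sqrt ν : ℂ) * ∫ y in Ioi (0 : ℝ),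
    (A * Complex.exp (Complex.I * k * x) - A * Complex.exp (Complex.I * k * x) * u y))
    (fun x : ℝ => A * Complex.exp (Complex.I * k * x))
  rw [e1, e2]
  refine ⟨by fun_prop, by fun_prop, per _, per _, fourierCoeffOn_exp_eq_zero (by omega) _, fun n => ?_⟩
  by_cases hn : n = k
  · subst hn
    have : (fun x : ℝ => A * Complex.exp (Complex.I * (k : ℤ) * x)) =
        (k : ℂ) • fun x : ℝ => (A / k) * Complex.exp (Complex.I * (k : ℤ) * x) := by
      ext x; simp only [Pi.smul_apply, smul_eq_mul]; field_simp
    rw [this, fourierCoeffOn.const_smul]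
    simp
  · rw [fourierCoeffOn_exp_eq_zero hn, fourierCoeffOn_exp_eq_zero hn, mul_zero]

end BoundaryLayer

/-! ### Solving the viscous dispersion relation near the inviscid one. -/

namespace BoundaryLayer
open Metric

lemma intervalIntegrable_mul_velocityKernel {M : ℝ → ℝ} (hM : Continuous M) {c : ℂ} (hc : 0 < c.im) :
    IntervalIntegrable (fun u => (M u : ℂ) * velocityKernel c u) volume 0 1 := by
  have := continuous_velocityKernel hc
  exact Continuous.intervalIntegrable (by fun_prop) _ _

lemma differentiableOn_integral_velocityKernel {M : ℝ → ℝ} (hM : Continuous M) :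
    DifferentiableOn ℂ (fun c => ∫ u in (0 : ℝ)..1, (M u : ℂ) * velocityKernel c u)
      {c : ℂ | 0 < c.im} := by
  intro c hc
  have hc : 0 < c.im := hc
  set b := c.im / 2 with hb
  have hb0 : 0 < b := by positivity
  have him : ∀ x ∈ ball c b, b < x.im := by
    intro x hx
    have h1 := Complex.abs_im_le_norm (x - c)
    rw [mem_ball, dist_eq_norm] at hx
    have h2 := (abs_le.1 h1).1
    rw [Complex.sub_im] at h2
    linarith
  set R := ‖c‖ + b with hR
  have hx_norm : ∀ x ∈ ball c b, ‖x‖ ≤ R := by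
    intro x hx
    rw [mem_ball, dist_eq_norm] at hx
    have := norm_le_norm_add_norm_sub' x c
    linarith
  set F' : ℂ → ℝ → ℂ := fun x u =>
    (M u : ℂ) * (-2 * (((u : ℂ) - x) ^ 2)⁻¹ + 2 * (1 + u - 2 * x) * (((u : ℂ) - x) ^ 3)⁻¹) with hF'
  have hder : ∀ x ∈ ball c b, ∀ u : ℝ,
      HasDerivAt (fun x => (M u : ℂ) * velocityKernel x u) (F' x u) x := by
    intro x hx u
    have hne := sub_ne_zero_of_im_pos (hb0.trans (him x hx)) u
    have d1 : HasDerivAt (fun x : ℂ => (1 : ℂ) + u - 2 * x) (-2) x := by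
      simpa using ((hasDerivAt_id' x).const_mul 2).const_sub (1 + (u : ℂ))
    have d2 : HasDerivAt (fun x : ℂ => ((u : ℂ) - x) ^ 2) (-2 * ((u : ℂ) - x)) x :=
      (((hasDerivAt_id' x).const_sub (u : ℂ)).pow 2).congr_deriv (by simp)
    refine ((d1.div d2 (pow_ne_zero 2 hne)).const_mul (M u : ℂ)).congr_deriv ?_
    rw [hF']
    field_simp
    ring
  have hcontF' : ∀ x ∈ ball c b, Continuous (F' x) := by
    intro x hx
    have hne := sub_ne_zero_of_im_pos (hb0.trans (him x hx))
    rw [hF']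
    have h2 : Continuous fun u : ℝ => (((u : ℂ) - x) ^ 2)⁻¹ :=
      Continuous.inv₀ (by fun_prop) fun u => pow_ne_zero 2 (hne u)
    have h3 : Continuous fun u : ℝ => (((u : ℂ) - x) ^ 3)⁻¹ :=
      Continuous.inv₀ (by fun_prop) fun u => pow_ne_zero 3 (hne u)
    fun_prop
  have hmem : c ∈ ball c b := mem_ball_self hb0
  refine ((intervalIntegral.hasDerivAt_integral_of_dominated_loc_of_deriv_le (F' := F')
    (bound := fun u => |M u| * (2 * (b ^ 2)⁻¹ + 2 * (1 + |u| + 2 * R) * (b ^ 3)⁻¹))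
    (ball_mem_nhds c hb0) ?_ (intervalIntegrable_mul_velocityKernel hM hc)
    (hcontF' c hmem).aestronglyMeasurable ?_ ?_ ?_).2.differentiableAt).differentiableWithinAt
  · filter_upwards [ball_mem_nhds c hb0] with x hx
    have := continuous_velocityKernel (hb0.trans (him x hx))
    exact Continuous.aestronglyMeasurable (by fun_prop)
  · refine Eventually.of_forall fun u _ x hx => ?_
    have hlow : b ≤ ‖(u : ℂ) - x‖ := (him x hx).le.trans (im_le_norm_ofReal_sub u)
    have hnum : ‖1 + (u : ℂ) - 2 * x‖ ≤ 1 + |u| + 2 * R := by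
      refine (norm_sub_le _ _).trans (add_le_add ((norm_add_le _ _).trans ?_) ?_)
      · simp
      · rw [norm_mul]; simpa using hx_norm x hx
    rw [hF', norm_mul, Complex.norm_real, Real.norm_eq_abs]
    refine mul_le_mul_of_nonneg_left ((norm_add_le _ _).trans (add_le_add ?_ ?_)) (abs_nonneg _)
    · rw [norm_mul, norm_inv, norm_pow]
      simp only [norm_neg, Complex.norm_ofNat]
      gcongr
    · rw [norm_mul, norm_mul, norm_inv, norm_pow, Complex.norm_ofNat]
      gcongr
  · exact Continuous.intervalIntegrable (by fun_prop) _ _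
  · exact Eventually.of_forall fun u _ x hx => hder x hx u

/-- Quantifies E_c ≈ -2/c for large c on the imaginary axis. -/
lemma norm_mul_velocityKernel_add_two_le {T : ℝ} (hT : 0 < T) {u : ℝ} (hu : u ∈ Icc (0 : ℝ) 1) :
    ‖(T * Complex.I) * velocityKernel (T * Complex.I) u + 2‖ ≤ (2 * T + 2) / T ^ 2 := by
  have him : (T * Complex.I).im = T := by simp
  have hne := sub_ne_zero_of_im_pos (c := T * Complex.I) (by rw [him]; exact hT) u
  have hlow : T ≤ ‖(u : ℂ) - T * Complex.I‖ := by
    simpa using im_le_norm_ofReal_sub (c := T * Complex.I) u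
  have e : (T * Complex.I) * velocityKernel (T * Complex.I) u + 2 =
      ((T * Complex.I) * ((1 - 3 * u : ℝ) : ℂ) + ((2 * u ^ 2 : ℝ) : ℂ)) /
        ((u : ℂ) - T * Complex.I) ^ 2 := by
    unfold velocityKernel
    field_simp
    push_cast
    ring
  rw [e, norm_div, norm_pow]
  have h1 : |1 - 3 * u| ≤ 2 := abs_le.2 ⟨by linarith [hu.2], by linarith [hu.1]⟩
  have h2 : |2 * u ^ 2| ≤ 2 := abs_le.2 ⟨by nlinarith [hu.1], by nlinarith [hu.1, hu.2]⟩
  gcongr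
  refine (norm_add_le _ _).trans (add_le_add ?_ ?_)
  · rw [norm_mul, norm_mul, Complex.norm_real, Complex.norm_real, Complex.norm_I, Real.norm_eq_abs,
      Real.norm_eq_abs, abs_of_pos hT, mul_one, mul_comm]
    gcongr
  · rwa [Complex.norm_real, Real.norm_eq_abs]

/-- By analyticity, failure would make G constant on the upper half-plane. This contradicts G(iT) ≈
-2Δ/(iT), where Δ = ∫ M > 0. -/
lemma eventually_integral_velocityKernel_ne {M : ℝ → ℝ} (hM : Continuous M) (hM0 : ∀ u, 0 ≤ M u)
    (hpos : 0 < ∫ u in (0 : ℝ)..1, M u) {c₀ : ℂ} (hc₀ : 0 < c₀.im) :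
    ∀ᶠ c in 𝓝[≠] c₀, ∫ u in (0 : ℝ)..1, (M u : ℂ) * velocityKernel c u ≠
      ∫ u in (0 : ℝ)..1, (M u : ℂ) * velocityKernel c₀ u := by
  set G : ℂ → ℂ := fun c => ∫ u in (0 : ℝ)..1, (M u : ℂ) * velocityKernel c u with hG
  have hopen : IsOpen {c : ℂ | 0 < c.im} := isOpen_lt continuous_const Complex.continuous_im
  have han : AnalyticOnNhd ℂ G {c : ℂ | 0 < c.im} :=
    (differentiableOn_integral_velocityKernel hM).analyticOnNhd hopen
  rcases (han c₀ hc₀).eventually_eq_or_eventually_ne (analyticAt_const (v := G c₀)) with h | h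
  swap
  · exact h
  exfalso
  have heq := han.eqOn_of_preconnected_of_eventuallyEq (analyticOnNhd_const (v := G c₀))
    (convex_halfSpace_im_gt 0).isPreconnected hc₀ h
  set Δ := ∫ u in (0 : ℝ)..1, M u with hΔ
  have key : ∀ T : ℝ, 0 < T → ‖T * Complex.I * G c₀ + 2 * Δ‖ ≤ Δ * ((2 * T + 2) / T ^ 2) := by
    intro T hT
    have hTim : 0 < (T * Complex.I).im := by simpa using hT
    have hGT : G (T * Complex.I) = G c₀ := heq hTim
    have hint := intervalIntegrable_mul_velocityKernel hM hTim
    have hMi : IntervalIntegrable (fun u => (M u : ℂ)) volume 0 1 :=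
      Continuous.intervalIntegrable (by fun_prop) _ _
    have e : T * Complex.I * G c₀ + 2 * Δ = ∫ u in (0 : ℝ)..1,
        (M u : ℂ) * ((T * Complex.I) * velocityKernel (T * Complex.I) u + 2) := by
      rw [← hGT, hG, hΔ, ← intervalIntegral.integral_ofReal, ← intervalIntegral.integral_const_mul,
        ← intervalIntegral.integral_const_mul, ← intervalIntegral.integral_add
          (hint.const_mul _) (hMi.const_mul _)]
      refine intervalIntegral.integral_congr fun u _ => ?_
      ring
    rw [e, hΔ, ← intervalIntegral.integral_mul_const]
    refine intervalIntegral.norm_integral_le_of_norm_le zero_le_one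
      (Eventually.of_forall fun u hu => ?_) (Continuous.intervalIntegrable (by fun_prop) _ _)
    rw [norm_mul, Complex.norm_real, Real.norm_of_nonneg (hM0 u)]
    exact mul_le_mul_of_nonneg_left (norm_mul_velocityKernel_add_two_le hT ⟨hu.1.le, hu.2⟩) (hM0 u)
  -- Twice the expression at T = 6 minus the one at T = 12 eliminates G(c₀) and leaves 2Δ, while the
  -- bounds add up to (2·14/36 + 26/144)Δ < 2Δ.
  have k6 := key 6 (by norm_num)
  have k12 := key 12 (by norm_num)
  have e : ((2 * Δ : ℝ) : ℂ) = 2 * (((6 : ℝ) : ℂ) * Complex.I * G c₀ + 2 * Δ) -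
      (((12 : ℝ) : ℂ) * Complex.I * G c₀ + 2 * Δ) := by
    push_cast
    ring
  have hn : 2 * Δ = ‖((2 * Δ : ℝ) : ℂ)‖ := by
    rw [Complex.norm_real, Real.norm_of_nonneg (by positivity)]
  have := norm_sub_le (2 * (((6 : ℝ) : ℂ) * Complex.I * G c₀ + 2 * Δ))
    (((12 : ℝ) : ℂ) * Complex.I * G c₀ + 2 * Δ)
  rw [← e, ← hn, norm_mul, Complex.norm_ofNat] at this
  norm_num at k6 k12 this
  linarith

/-- Open mapping with constants: F - F(c₀) is at least 3d/4 on the circle, so F covers the ball of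
radius 3d/8 about F(c₀). That ball contains every point within d/8 of G(c₀), because d/8 + d/8 <
3d/8. -/
lemma ball_subset_image_of_norm_sub_le {F G : ℂ → ℂ} {c₀ : ℂ} {r b d : ℝ} (hr : 0 < r) (hrb : r < b)
    (hd : 0 < d) (hF : DifferentiableOn ℂ F (ball c₀ b)) (hG : ∀ z ∈ sphere c₀ r, d ≤ ‖G z - G c₀‖)
    (hFG : ∀ z ∈ ball c₀ b, ‖F z - G z‖ ≤ d / 8) :
    closedBall (G c₀) (d / 8) ⊆ F '' closedBall c₀ r := by
  have hc₀ : c₀ ∈ ball c₀ b := mem_ball_self (hr.trans hrb)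
  have hsub : closedBall c₀ r ⊆ ball c₀ b := closedBall_subset_ball hrb
  have hsph : ∀ z ∈ sphere c₀ r, d * (3 / 4) ≤ ‖F z - F c₀‖ := by
    intro z hz
    have h1 := hFG z (hsub (sphere_subset_closedBall hz))
    have h2 := hFG c₀ hc₀
    have h3 := hG z hz
    have e : G z - G c₀ = (F z - F c₀) - (F z - G z) + (F c₀ - G c₀) := by ring
    have h4 := norm_add_le ((F z - F c₀) - (F z - G z)) (F c₀ - G c₀)
    have h5 := norm_sub_le (F z - F c₀) (F z - G z)
    rw [← e] at h4
    linarith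
  have hfreq : ∃ᶠ z in 𝓝 c₀, F z ≠ F c₀ := by
    rw [Filter.Frequently]
    intro h
    simp only [not_not] at h
    have han := hF.analyticOnNhd isOpen_ball
    have heq := han.eqOn_of_preconnected_of_eventuallyEq (analyticOnNhd_const (v := F c₀))
      (convex_ball c₀ b).isPreconnected hc₀ h
    obtain ⟨z, hz⟩ := (NormedSpace.sphere_nonempty (x := c₀) (r := r)).2 hr.le
    have h1 := hsph z hz
    rw [heq (hsub (sphere_subset_closedBall hz)), sub_self, norm_zero] at h1
    linarith
  have hcl : DiffContOnCl ℂ F (ball c₀ r) := by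
    refine DifferentiableOn.diffContOnCl ?_
    rw [closure_ball c₀ hr.ne']
    exact hF.mono hsub
  refine Subset.trans ?_ (hcl.ball_subset_image_closedBall hr hsph hfreq)
  intro z hz
  rw [mem_closedBall, dist_eq_norm] at hz
  rw [mem_ball, dist_eq_norm]
  have e : z - F c₀ = (z - G c₀) - (F c₀ - G c₀) := by ring
  have h1 := norm_sub_le (z - G c₀) (F c₀ - G c₀)
  have h2 := hFG c₀ hc₀
  rw [← e] at h1
  linarith

variable {U U₁ U₂ U₃ : ℝ → ℝ} {C : ℝ}

/-- The viscous integral F is uniformly close to the inviscid G near c₀, and G - G(c₀) stays away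
from 0 on a small circle. So F attains every τ near G(c₀), with the same margin for all large k. -/
theorem exists_isMode_near (hU : DecayingProfile U U₁ U₂ U₃ C) {M : ℝ → ℝ} (hM : Continuous M)
    (hM0 : ∀ u, 0 ≤ M u) (hpos : 0 < ∫ u in (0 : ℝ)..1, M u)
    (hcv : ∀ H : ℝ → ℂ, Continuous H →
      IntegrableOn (fun y => ((1 - U y : ℝ) : ℂ) * H (U y)) (Ioi 0) ∧
      ∫ y in Ioi (0 : ℝ), ((1 - U y : ℝ) : ℂ) * H (U y) = ∫ u in (0 : ℝ)..1, (M u : ℂ) * H u)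
    {c₀ : ℂ} (hc₀ : 0 < c₀.im) {ρ : ℝ} (hρ : 0 < ρ) :
    ∃ K : ℝ, 0 < K ∧ ∃ η : ℝ, 0 < η ∧ ∀ k : ℝ, K ≤ k → ∀ τ : ℂ,
      ‖τ - ∫ u in (0 : ℝ)..1, (M u : ℂ) * velocityKernel c₀ u‖ ≤ η →
        ∃ c : ℂ, ‖c - c₀‖ ≤ ρ ∧ 0 < c.im ∧ ∃ φ u, IsMode U U₁ k c (-τ) φ u := by
  set G : ℂ → ℂ := fun c => ∫ u in (0 : ℝ)..1, (M u : ℂ) * velocityKernel c u with hG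
  set b := c₀.im / 2 with hb
  have hb0 : 0 < b := by positivity
  obtain ⟨m, hm, σ₀, B, hσ₀, hB, hsol⟩ := exists_viscousSolution hU hb0 (by rw [hb]; ring : c₀.im = 2 * b)
  have him : ∀ x ∈ ball c₀ b, b ≤ x.im := by
    intro x hx
    have h1 := Complex.abs_im_le_norm (x - c₀)
    rw [mem_ball, dist_eq_norm] at hx
    have h2 := (abs_le.1 h1).1
    rw [Complex.sub_im] at h2
    linarith
  obtain ⟨r₁, hr₁, hne⟩ := Metric.mem_nhdsWithin_iff.1
    (eventually_integral_velocityKernel_ne hM hM0 hpos hc₀)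
  set r := min r₁ (min ρ b) / 2 with hr
  have hr0 : 0 < r := by positivity
  have hmin : r < min r₁ (min ρ b) := by rw [hr]; exact half_lt_self (by positivity)
  have hrr : r < r₁ := hmin.trans_le (min_le_left _ _)
  have hrρ : r < ρ := hmin.trans_le ((min_le_right _ _).trans (min_le_left _ _))
  have hrb : r < b := hmin.trans_le ((min_le_right _ _).trans (min_le_right _ _))
  have hGc : ContinuousOn G (sphere c₀ r) :=
    (differentiableOn_integral_velocityKernel hM).continuousOn.mono fun z hz =>
      hb0.trans_le (him z (closedBall_subset_ball hrb (sphere_subset_closedBall hz)))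
  obtain ⟨z₁, hz₁, hz₁min⟩ := (isCompact_sphere c₀ r).exists_isMinOn
    ((NormedSpace.sphere_nonempty (x := c₀) (r := r)).2 hr0.le)
    ((hGc.sub continuousOn_const).norm (f := fun z => G z - G c₀))
  set d := ‖G z₁ - G c₀‖ with hd
  have hd0 : 0 < d := by
    rw [hd, norm_pos_iff, sub_ne_zero]
    refine hne ⟨?_, ?_⟩
    · rw [mem_ball, mem_sphere.1 hz₁]; exact hrr
    · rintro rfl
      rw [mem_sphere, dist_self] at hz₁
      exact hr0.ne hz₁
  set A := (2 * B * b⁻¹ + (4 * C + 12 * C * B) * (b⁻¹) ^ 2) * m with hA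
  -- Makes the viscous error A/σ at most d/8. Since σ² = mk, the condition σ ≥ S reads k ≥ S²/m.
  set S := max σ₀ (8 * A / d) with hS
  have hS2 : 2 ≤ S := hσ₀.trans (le_max_left _ _)
  refine ⟨S ^ 2 / m, by positivity, d / 8, by positivity, fun k hk τ hτ => ?_⟩
  have hmk : S ^ 2 ≤ m * k := by rw [div_le_iff₀ hm] at hk; linarith
  have hk0 : 0 < k := lt_of_lt_of_le (by positivity) hk
  set σ := Real.sqrt (m * k) with hσ
  have hσ2 : σ ^ 2 = m * k := Real.sq_sqrt (by positivity)
  have hσS : S ≤ σ := Real.le_sqrt_of_sq_le hmk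
  have hσpos : 0 < σ := by linarith
  obtain ⟨F, hF, hFv⟩ := hsol σ ((le_max_left _ _).trans hσS)
  have hFG : ∀ z ∈ ball c₀ b, ‖F z - G z‖ ≤ d / 8 := by
    intro z hz
    obtain ⟨w, p, h, W, hv, hw⟩ := hFv z hz
    have hcvz := hcv (velocityKernel z) (continuous_velocityKernel (hb0.trans_le (him z hz)))
    have := hv.norm_integral_sub_le hU hB hb0 (him z hz) hm (by linarith) hcvz.1
    rw [hcvz.2, hw] at this
    refine this.trans ?_
    rw [div_le_div_iff₀ hσpos (by norm_num), ← hA]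
    have h8 : 8 * A / d ≤ σ := (le_max_right _ _).trans hσS
    rw [div_le_iff₀ hd0] at h8
    linarith
  obtain ⟨c, hc, hFc⟩ := ball_subset_image_of_norm_sub_le hr0 hrb hd0 hF
    (fun z hz => isMinOn_iff.1 hz₁min z hz) hFG (mem_closedBall_iff_norm.2 hτ)
  have hcb := closedBall_subset_ball hrb hc
  obtain ⟨w, p, h, W, hv, hw⟩ := hFv c hcb
  have hcim : 0 < c.im := hb0.trans_le (him c hcb)
  refine ⟨c, (mem_closedBall_iff_norm.1 hc).trans hrρ.le, hcim, ?_⟩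
  have := hv.exists_isMode hU hcim hm hk0 hσ2 hB
  rwa [hw, hFc] at this

/-- Selecting for each k a point whose distance to μ is within 1/(k+1) of optimal serves all radii
at once, and it satisfies P whenever that is possible. -/
lemma exists_seq_tendsto_of_forall_eventually {P : ℕ → ℂ → Prop} {μ : ℂ}
    (h : ∀ ρ : ℝ, 0 < ρ → ∀ᶠ k in atTop, ∃ c, ‖c - μ‖ ≤ ρ ∧ P k c) :
    ∃ c : ℕ → ℂ, Tendsto c atTop (𝓝 μ) ∧ ∀ k, (∃ z, P k z) → P k (c k) := by
  have hch : ∀ k : ℕ, ∃ z, (∃ x, P k x) →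
      P k z ∧ dist μ z < infDist μ {x | P k x} + 1 / ((k : ℝ) + 1) := by
    intro k
    by_cases hk : ∃ x, P k x
    · obtain ⟨z, hz, hz'⟩ := (infDist_lt_iff (s := {x | P k x}) (x := μ)
        (r := infDist μ {x | P k x} + 1 / ((k : ℝ) + 1)) hk).1
          (lt_add_of_pos_right _ (by positivity))
      exact ⟨z, fun _ => ⟨hz, hz'⟩⟩
    · exact ⟨0, fun h => absurd h hk⟩
  choose c hc using hch
  refine ⟨c, Metric.tendsto_nhds.2 fun ε hε => ?_, fun k hk => (hc k hk).1⟩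
  have h1 : ∀ᶠ k : ℕ in atTop, 1 / ((k : ℝ) + 1) < ε / 2 :=
    tendsto_one_div_add_atTop_nhds_zero_nat.eventually_lt_const (by positivity)
  filter_upwards [h (ε / 2) (by positivity), h1] with k hk hk1
  obtain ⟨z, hz, hPz⟩ := hk
  have h2 := (hc k ⟨z, hPz⟩).2
  have h3 : infDist μ {x | P k x} ≤ dist μ z := infDist_le_dist_of_mem hPz
  rw [dist_comm μ z, dist_eq_norm] at h3
  rw [dist_comm]
  linarith

end BoundaryLayer

/-! ### The three instability statements. -/

namespace BoundaryLayer

/-- Common core: M is built with ∫ M(κ + E) = τ, and ∫ M = Δ_s turns this into the inviscid value τ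
- κΔ_s for ∫ M E. -/
theorem exists_shearFlow_modes {w : ℝ → ℝ} (hw : IsWeight w) {c₀ : ℂ} (hc₀ : 0 < c₀.im) {β τ : ℝ}
    (hβ : 0 ≤ β) {u₁ u₂ u₃ : ℝ} (h1 : u₁ ∈ Ioo 0 1) (h2 : u₂ ∈ Ioo 0 1) (h3 : u₃ ∈ Ioo 0 1) {κ : ℝ}
    (hE1 : (κ + velocityKernel c₀ u₁).im < 0) (hE3 : 0 < (κ + velocityKernel c₀ u₃).im)
    (hE2 : (κ + velocityKernel c₀ u₂).im = 0)
    (ht : (τ - β * (κ + velocityKernel c₀ u₂).re) *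
      ((κ + velocityKernel c₀ u₁) * (starRingEnd ℂ) (κ + velocityKernel c₀ u₃)).im < 0) :
    ∃ (U U₁ U₂ U₃ : ℝ → ℝ) (C : ℝ), DecayingProfile U U₁ U₂ U₃ C ∧ IsShearFlow w U ∧
      ∀ ρ : ℝ, 0 < ρ → ∃ K : ℝ, 0 < K ∧ ∃ η : ℝ, 0 < η ∧ ∀ k : ℝ, K ≤ k → ∀ s : ℂ,
        ‖s - (τ - κ * displacement U)‖ ≤ η →
          ∃ c : ℂ, ‖c - c₀‖ ≤ ρ ∧ 0 < c.im ∧ ∃ φ u, IsMode U U₁ k c (-s) φ u := by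
  have hvc := continuous_velocityKernel hc₀
  obtain ⟨δ₀, hδ₀, hflow⟩ := exists_shearFlow hw
  obtain ⟨δ, hδ, hδδ, Q, hQ, hmom⟩ := exists_polynomial_moment
    (E := fun u => κ + velocityKernel c₀ u) (by fun_prop) h1 h2 h3 hβ hE1 hE3 hE2 ht hδ₀
  obtain ⟨U, U₁, U₂, U₃, C, hU, hS, hcv⟩ := hflow δ hδ hδδ Q hQ
  set M : ℝ → ℝ := fun u => δ + u ^ 2 * (1 - u) ^ 2 * Q.eval u with hM
  have hMc : Continuous M := by
    have := Q.continuous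
    fun_prop
  have hMδ : ∀ u, δ ≤ M u := fun u => by
    have := mul_nonneg (by positivity : 0 ≤ u ^ 2 * (1 - u) ^ 2) (hQ u)
    simp only [hM]
    linarith
  have hpos : 0 < ∫ u in (0 : ℝ)..1, M u :=
    intervalIntegral.intervalIntegral_pos_of_pos (hMc.intervalIntegrable _ _)
      (fun u => hδ.trans_le (hMδ u)) zero_lt_one
  have hdisp : (displacement U : ℂ) = ∫ u in (0 : ℝ)..1, (M u : ℂ) := by
    have := (hcv (fun _ => 1) continuous_const).2
    simp only [mul_one] at this
    rw [displacement, ← this]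
    exact integral_ofReal.symm
  have hG : ∫ u in (0 : ℝ)..1, (M u : ℂ) * velocityKernel c₀ u = τ - κ * displacement U := by
    have hMi : IntervalIntegrable (fun u => (M u : ℂ)) volume 0 1 :=
      Continuous.intervalIntegrable (by fun_prop) _ _
    rw [← hmom, hdisp, ← intervalIntegral.integral_const_mul, ← intervalIntegral.integral_sub]
    · exact intervalIntegral.integral_congr fun u _ => by simp only [hM]; ring
    · exact Continuous.intervalIntegrable (by fun_prop) _ _
    · exact hMi.const_mul _
  refine ⟨U, U₁, U₂, U₃, C, hU, hS, fun ρ hρ => ?_⟩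
  rw [← hG]
  exact exists_isMode_near hU hMc (fun u => hδ.le.trans (hMδ u)) hpos hcv hc₀ hρ

theorem exists_PDT_instability {w : ℝ → ℝ} (hw : IsWeight w) {μ : ℂ} (hμ : μ ∈ Gamma1) :
    ∃ Us : ℝ → ℝ, IsShearFlow w Us ∧ ∃ K : ℝ, 0 < K ∧ ∃ lam : ℕ → ℂ,
      Asymptotics.IsEquivalent atTop lam (fun k : ℕ => -(Complex.I * (k : ℂ) * μ)) ∧
      ∀ k : ℕ, K ≤ (k : ℝ) → DisplaysInstability (SolvesPDT Us) (lam k) k := by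
  obtain ⟨hab, hneg⟩ := Gamma1.surrounding hμ
  obtain ⟨h0, h1, him, -⟩ := hμ
  obtain ⟨u₁, hu₁, u₂, hu₂, u₃, hu₃, hE1, hE3, hE2, hre, hE⟩ :=
    exists_velocities_surrounding 1 h0 h1 him hab le_rfl hneg
  -- A unit mass at u₂ contributes the negative number 1 + E(u₂), to be compensated by the peaks at
  -- u₁ and u₃, whose cone contains the positive half-axis.
  obtain ⟨U, U₁, U₂, U₃, C, hU, hS, hmodes⟩ := exists_shearFlow_modes hw him (β := 1) (τ := 0)
    zero_le_one hu₁ hu₂ hu₃ hE1 hE3 hE2 (mul_neg_of_pos_of_neg (by linarith) hE)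
  have hmodes' : ∀ ρ : ℝ, 0 < ρ → ∃ K : ℝ, 0 < K ∧ ∀ k : ℕ, K ≤ k →
      ∃ c, ‖c - μ‖ ≤ ρ ∧ (0 < c.im ∧ ∃ φ u, IsMode U U₁ k c (displacement U) φ u) := by
    intro ρ hρ
    obtain ⟨K, hK, η, hη, h⟩ := hmodes ρ hρ
    refine ⟨K, hK, fun k hk => ?_⟩
    -- For PDT the required value s = -Δ_s is the inviscid value itself, so c moves only because of
    -- viscosity.
    simpa using h k hk (-displacement U) (by simpa using hη.le)
  obtain ⟨c, hc, hP⟩ := exists_seq_tendsto_of_forall_eventually fun ρ hρ => by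
    obtain ⟨K, -, h⟩ := hmodes' ρ hρ
    exact (tendsto_natCast_atTop_atTop.eventually_ge_atTop K).mono h
  -- Radius 1 is used only to know that modes exist for every k ≥ K; convergence to μ is already
  -- part of the choice of `c`.
  obtain ⟨K, hK, hKc⟩ := hmodes' 1 one_pos
  have hμ0 : μ ≠ 0 := by rintro rfl; simp at him
  refine ⟨U, hS, K, hK, fun k => -(Complex.I * k * c k), ?_, fun k hk => ?_⟩
  · exact ((Asymptotics.IsEquivalent.refl (u := fun k : ℕ => Complex.I * (k : ℂ))).mul
      ((Asymptotics.isEquivalent_const_iff_tendsto hμ0).2 hc)).neg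
  · have hk1 : 1 ≤ k := by
      have : (0 : ℝ) < k := hK.trans_le hk
      exact_mod_cast this
    obtain ⟨z, -, hz⟩ := hKc k hk
    obtain ⟨hcim, φ, u, hm⟩ := hP k ⟨z, hz⟩
    exact hm.displaysInstability_PDT hU hk1 hcim

lemma norm_rotated_div_add {k : ℕ} (hk : 1 ≤ k) (c μ : ℂ) :
    ‖-(Complex.I * k * c) / (k : ℂ) + Complex.I * μ‖ = ‖c - μ‖ := by
  have hk0 : (k : ℂ) ≠ 0 := by exact_mod_cast (by omega : k ≠ 0)
  have : -(Complex.I * k * c) / (k : ℂ) + Complex.I * μ = -(Complex.I * (c - μ)) := by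
    field_simp
    ring
  rw [this, norm_neg, norm_mul, Complex.norm_I, one_mul]

theorem exists_IBL_instability_of_small {w : ℝ → ℝ} (hw : IsWeight w) {μ : ℂ} (hμ : μ ∈ Gamma2)
    {ε : ℝ} (hε : 0 < ε) :
    ∃ Us : ℝ → ℝ, IsShearFlow w Us ∧ ∃ K γp : ℝ, 0 < K ∧ 0 < γp ∧
      ∀ (k : ℕ) (ν : ℝ), K ≤ (k : ℝ) → 0 < ν → (Real.sqrt ν * (k : ℝ))⁻¹ ≤ γp →
        ∃ lam : ℂ, ‖lam / (k : ℂ) + Complex.I * μ‖ ≤ ε ∧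
          DisplaysInstability (SolvesIBL Us ν) lam k := by
  obtain ⟨hab, hneg⟩ := Gamma2.surrounding hμ
  obtain ⟨h0, h1, him, -⟩ := hμ
  obtain ⟨u₁, hu₁, u₂, hu₂, u₃, hu₃, hE1, hE3, hE2, hre, hE⟩ :=
    exists_velocities_surrounding 0 h0 (by linarith) him hab zero_le_one hneg
  obtain ⟨U, U₁, U₂, U₃, C, hU, hS, hmodes⟩ := exists_shearFlow_modes hw him (β := 1) (τ := 0)
    zero_le_one hu₁ hu₂ hu₃ hE1 hE3 hE2 (mul_neg_of_pos_of_neg (by linarith) hE)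
  obtain ⟨K, hK, η, hη, h⟩ := hmodes ε hε
  -- The target is 0 and the margin η does not depend on k or ν, so it serves directly as γ₊.
  refine ⟨U, hS, K, η, hK, hη, fun k ν hk hν hγ => ?_⟩
  have hk0 : (0 : ℝ) < k := hK.trans_le hk
  have hk1 : 1 ≤ k := by exact_mod_cast hk0
  obtain ⟨c, hcμ, hcim, φ, u, hm⟩ := h k hk (-(((Real.sqrt ν * k)⁻¹ : ℝ) : ℂ)) (by
    rw [Complex.ofReal_zero, zero_mul, sub_zero, sub_zero, norm_neg, Complex.norm_real,
      Real.norm_of_nonneg (by positivity)]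
    exact hγ)
  rw [neg_neg] at hm
  exact ⟨_, (norm_rotated_div_add hk1 c μ).trans_le hcμ, hm.displaysInstability_IBL hU hk1 hcim hν⟩

theorem exists_IBL_instability_of_near {w : ℝ → ℝ} (hw : IsWeight w) {μ : ℂ} (hμ : μ ∈ Gamma3)
    {γ : ℝ} (hγ : 0 < γ) {ε : ℝ} (hε : 0 < ε) :
    ∃ Us : ℝ → ℝ, IsShearFlow w Us ∧ ∃ K γm γp : ℝ, 0 < K ∧ 0 < γm ∧ γm < γ ∧ γ < γp ∧
      ∀ (k : ℕ) (ν : ℝ), K ≤ (k : ℝ) → 0 < ν →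
        γm ≤ (Real.sqrt ν * (k : ℝ))⁻¹ → (Real.sqrt ν * (k : ℝ))⁻¹ ≤ γp →
        ∃ lam : ℂ, ‖lam / (k : ℂ) + Complex.I * μ‖ ≤ ε ∧
          DisplaysInstability (SolvesIBL Us ν) lam k := by
  obtain ⟨h0, h1, him, hlt⟩ := hμ
  have hab : μ.im ^ 2 < μ.re * (1 - μ.re) := (Real.lt_sqrt him.le).1 hlt
  obtain ⟨u₁, hu₁, u₃, hu₃, hE1, hE3, hE⟩ := exists_velocities_around_crossing h1 him hab
  have h1' : 0 < 1 - μ.re := by linarith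
  have hdiv : μ.im ^ 2 / (1 - μ.re) < μ.re := (div_lt_iff₀ h1').2 hab
  have hdiv0 : 0 < μ.im ^ 2 / (1 - μ.re) := by positivity
  -- With β = 0 there is no mass at u₂. The cone of the two nearby values contains -γ, whatever the
  -- size of γ.
  obtain ⟨U, U₁, U₂, U₃, C, hU, hS, hmodes⟩ := exists_shearFlow_modes hw him (β := 0) (τ := -γ)
    (κ := 0) (u₂ := μ.re - μ.im ^ 2 / (1 - μ.re)) le_rfl hu₁ ⟨by linarith, by linarith⟩ hu₃
    (by simpa using hE1) (by simpa using hE3)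
    (by rw [velocityKernel_crossing him h1, Complex.ofReal_zero, zero_add, Complex.ofReal_im])
    (by
      rw [Complex.ofReal_zero, zero_add, zero_add, zero_add, zero_mul, sub_zero]
      exact mul_neg_of_neg_of_pos (by linarith) hE)
  obtain ⟨K, hK, η, hη, h⟩ := hmodes ε hε
  -- The admissible window is [γ - η, γ + η], cut at γ/2 to keep its lower end positive.
  refine ⟨U, hS, K, max (γ - η) (γ / 2), γ + η, hK, lt_max_of_lt_right (by positivity),
    max_lt (by linarith) (by linarith), by linarith, fun k ν hk hν hm hp => ?_⟩
  have hk0 : (0 : ℝ) < k := hK.trans_le hk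
  have hk1 : 1 ≤ k := by exact_mod_cast hk0
  obtain ⟨c, hcμ, hcim, φ, u, hm⟩ := h k hk (-(((Real.sqrt ν * k)⁻¹ : ℝ) : ℂ)) (by
    have e : -(((Real.sqrt ν * k)⁻¹ : ℝ) : ℂ) - (((-γ : ℝ) : ℂ) - ((0 : ℝ) : ℂ) * displacement U) =
        ((γ - (Real.sqrt ν * k)⁻¹ : ℝ) : ℂ) := by
      push_cast
      ring
    rw [e, Complex.norm_real, Real.norm_eq_abs, abs_le]
    exact ⟨by linarith, by linarith [le_max_left (γ - η) (γ / 2)]⟩)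
  rw [neg_neg] at hm
  exact ⟨_, (norm_rotated_div_add hk1 c μ).trans_le hcμ, hm.displaysInstability_IBL hU hk1 hcim hν⟩

end BoundaryLayer

end

theorem theorem4 (w : ℝ → ℝ) (hw : BoundaryLayer.IsWeight w) :
    (∀ μ ∈ BoundaryLayer.Gamma1,
      ∃ Us : ℝ → ℝ, BoundaryLayer.IsShearFlow w Us ∧
      ∃ K : ℝ, 0 < K ∧
      ∃ lam : ℕ → ℂ,
        Asymptotics.IsEquivalent atTop lam (fun k : ℕ => -(Complex.I * (k : ℂ) * μ)) ∧
        ∀ k : ℕ, K ≤ (k : ℝ) →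
          BoundaryLayer.DisplaysInstability (BoundaryLayer.SolvesPDT Us) (lam k) k) ∧
    (∀ μ ∈ BoundaryLayer.Gamma2, ∀ ε : ℝ, 0 < ε →
      ∃ Us : ℝ → ℝ, BoundaryLayer.IsShearFlow w Us ∧
      ∃ K γp : ℝ, 0 < K ∧ 0 < γp ∧
        ∀ (k : ℕ) (ν : ℝ), K ≤ (k : ℝ) → 0 < ν → (Real.sqrt ν * (k : ℝ))⁻¹ ≤ γp →
          ∃ lam : ℂ, ‖lam / (k : ℂ) + Complex.I * μ‖ ≤ ε ∧
            BoundaryLayer.DisplaysInstability (BoundaryLayer.SolvesIBL Us ν) lam k) ∧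
    (∀ μ ∈ BoundaryLayer.Gamma3, ∀ γ : ℝ, 0 < γ → ∀ ε : ℝ, 0 < ε →
      ∃ Us : ℝ → ℝ, BoundaryLayer.IsShearFlow w Us ∧
      ∃ K γm γp : ℝ, 0 < K ∧ 0 < γm ∧ γm < γ ∧ γ < γp ∧
        ∀ (k : ℕ) (ν : ℝ), K ≤ (k : ℝ) → 0 < ν →
          γm ≤ (Real.sqrt ν * (k : ℝ))⁻¹ → (Real.sqrt ν * (k : ℝ))⁻¹ ≤ γp →
          ∃ lam : ℂ, ‖lam / (k : ℂ) + Complex.I * μ‖ ≤ ε ∧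
            BoundaryLayer.DisplaysInstability (BoundaryLayer.SolvesIBL Us ν) lam k) := by
  exact ⟨fun μ hμ => BoundaryLayer.exists_PDT_instability hw hμ,
    fun μ hμ ε hε => BoundaryLayer.exists_IBL_instability_of_small hw hμ hε,
    fun μ hμ γ hγ ε hε => BoundaryLayer.exists_IBL_instability_of_near hw hμ hγ hε⟩
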